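/- Let $(N^{n+1},g)$ be a compact connected smooth Riemannian manifold without boundary, of dimension $n+1\ge 3$, with Riemannian distance $\mathrm{dist}_N$, and let $B_r(q)$ be the open metric ball of radius $r$ and centre $q$. Write $\mathrm{Vol}_g$ for the Riemannian volume (the $(n+1)$-dimensional Hausdorff measure of $\mathrm{dist}_N$). For a measurable set $F\subset N$ put $$\mathrm{Per}_g(F)=\sup\Big\{\int_F \mathrm{div}_g X\,d\mathrm{Vol}_g \;:\; X \text{ a smooth vector field on } N,\ |X|_g\le 1\Big\},$$ and let $\mathcal C(N)$ be the set of Caccioppoli sets, i.e. of measurable $F$ with $\mathrm{Per}_g(F)<\infty$. For $\lambda\in\mathbb R$ put $$\mathcal F_\lambda(F)=\mathrm{Per}_g(F)-\lambda\,\mathrm{Vol}_g(F)+\tfrac{\lambda}{2}\mathrm{Vol}_g(N).$$ Let $R_l$ be such that for every $R\in(0,R_l)$ and every $q\in N$ the ball $B_R(q)$ is $2$-bi-Lipschitz diffeomorphic, via a geodesic normal coordinate chart centred at $q$, to the Euclidean ball $B_R(0)\subset\mathbb R^{n+1}$. Let $E\in\mathcal C(N)$ be open and such that $E$ and $N\setminus\overline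 E$ have the same topological boundary $\partial E$. Let $p\in N$ and $0<r_1<r_2<R_l$ be such that $\partial E$ is a smooth embedded hypersurface near each of its points in the closed annulus $\overline{B}_{r_2}(p)\setminus B_{r_1}(p)$, where $\overline{B}_{r_2}(p)$ is the closed ball (no condition is imposed on the mean curvature of $\partial E$, nor on $\partial E$ inside $B_{r_1}(p)$ or outside $\overline{B}_{r_2}(p)$). **Proposition.** Let $F\in\mathcal C(N)$ satisfy $F\setminus B_{r_1}(p)=E\setminus B_{r_1}(p)$, and let $\tilde r_2\in(r_1,r_2)$. For each $\delta>0$ there exists $F_\delta\in\mathcal C(N)$ such that 1. $F_\delta$ has smooth boundary in $B_{r_2}(p)$: every $x\in\partial F_\delta\cap B_{r_2}(p)$ has an open neighbourhood $U$ with a smooth function $f:U\to\mathbb R$ without critical points such that $\partial F_\delta\cap U=\{f=0\}$ and $F_\delta\cap U=\{f>0\}$; 2. $F_\delta\setminus B_{\tilde r_2}(p)=E\setminus B_{\tilde r_2}(p)$; 3. $|\mathrm{Per}_g(F_\delta)-\mathrm{Per}_g(F)|\le\delta$; 4. $\mathrm{Vol}_g(F_\delta\,\Delta\,F)\le\delta$.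 In particular $F_\delta\setminus B_{\tilde r_2}(p)=F\setminus B_{\tilde r_2}(p)$, and for every $\lambda\in\mathbb R$ $$|\mathcal F_\lambda(F_\delta)-\mathcal F_\lambda(F)|\le(1+|\lambda|)\,\delta .$$ -/

import Mathlib

open Set MeasureTheory
open scoped Manifold ContDiff Bundle

namespace GeomBV

section Riemannian

variable {n : ℕ} {N : Type*} [MetricSpace N] [ChartedSpace (EuclideanSpace ℝ (Fin (n + 1))) N]
  [Bundle.RiemannianBundle (fun x : N ↦ TangentSpace (𝓡 (n + 1)) x)]

/-- The Riemannian density `√|g|` of the metric read in the chart `c`, at the point `y` of the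
model space: the square root of the determinant of the matrix `g_ij = g(∂_i, ∂_j)`, where
`∂_i = d(c⁻¹)_y e_i`. -/
noncomputable def chartDensity (c : OpenPartialHomeomorph N (EuclideanSpace ℝ (Fin (n + 1))))
    (y : EuclideanSpace ℝ (Fin (n + 1))) : ℝ :=
  Real.sqrt (Matrix.det (Matrix.of fun i j : Fin (n + 1) ↦
    inner ℝ
      (mfderiv (𝓡 (n + 1)) (𝓡 (n + 1)) c.symm y (EuclideanSpace.single i (1 : ℝ)))
      (mfderiv (𝓡 (n + 1)) (𝓡 (n + 1)) c.symm y (EuclideanSpace.single j (1 : ℝ)))))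

/-- The components `(X^1, …, X^{n+1})` of the vector field `X` in the chart `c`, as a function on
the model space. -/
noncomputable def chartField (c : OpenPartialHomeomorph N (EuclideanSpace ℝ (Fin (n + 1))))
    (X : ∀ x : N, TangentSpace (𝓡 (n + 1)) x) (y : EuclideanSpace ℝ (Fin (n + 1))) :
    EuclideanSpace ℝ (Fin (n + 1)) :=
  mfderiv (𝓡 (n + 1)) (𝓡 (n + 1)) c (c.symm y) (X (c.symm y))

/-- The Riemannian divergence `div_g X = |g|^{-1/2} ∑_i ∂_i (|g|^{1/2} X^i)`. The right-hand side
does not depend on the chart; at `x` it is computed in the preferred chart at `x`. -/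
noncomputable def divergence (X : ∀ x : N, TangentSpace (𝓡 (n + 1)) x) (x : N) : ℝ :=
  let c := chartAt (EuclideanSpace ℝ (Fin (n + 1))) x
  (chartDensity c (c x))⁻¹ * ∑ i : Fin (n + 1),
    fderiv ℝ (fun y ↦ chartDensity c y * chartField c X y i) (c x) (EuclideanSpace.single i 1)

/-- The volume `Vol_g`: the `(n+1)`-dimensional Hausdorff measure of the Riemannian distance,
normalised to agree with Lebesgue measure on `ℝ^{n+1}`. -/
noncomputable def vol (n : ℕ) (N : Type*) [MetricSpace N] [MeasurableSpace N] [BorelSpace N] :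
    Measure N :=
  Measure.euclideanHausdorffMeasure (n + 1)

variable [IsManifold (𝓡 (n + 1)) ∞ N] [MeasurableSpace N] [BorelSpace N]

variable (n) in
/-- The perimeter of `F`: the supremum of `∫_F div_g X` over the smooth vector fields `X` with
`|X|_g ≤ 1` everywhere. The field `X = 0` is admissible, so truncating the integrals at `0`
does not change the supremum. -/
noncomputable def perimeter (F : Set N) : ENNReal :=
  ⨆ (X : ∀ x : N, TangentSpace (𝓡 (n + 1)) x)
    (_ : ContMDiff (𝓡 (n + 1)) (𝓡 (n + 1)).tangent ∞
      (fun x ↦ (⟨x, X x⟩ : TangentBundle (𝓡 (n + 1)) N)))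
    (_ : ∀ x, ‖X x‖ ≤ 1),
    ENNReal.ofReal (∫ x in F, divergence X x ∂(vol n N))

variable (n) in
/-- Caccioppoli sets: (Lebesgue) measurable sets of finite perimeter. -/
def IsCaccioppoli (F : Set N) : Prop :=
  NullMeasurableSet F (vol n N) ∧ perimeter n F ≠ ⊤

variable (n) in
/-- The functional `𝓕_λ(F) = Per_g(F) - λ Vol_g(F) + (λ/2) Vol_g(N)`. -/
noncomputable def energy (lam : ℝ) (F : Set N) : ℝ :=
  (perimeter n F).toReal - lam * (vol n N).real F + lam / 2 * (vol n N).real univ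

end Riemannian

section Smooth

variable {N : Type*} [MetricSpace N]

variable (n : ℕ) [ChartedSpace (EuclideanSpace ℝ (Fin (n + 1))) N]

/-- `S` is a smooth embedded hypersurface near each of its points in `W`: near such a point it is
the zero set of a smooth function without critical points. -/
def IsSmoothHypersurfaceOn (S W : Set N) : Prop :=
  ∀ x ∈ S ∩ W, ∃ U : Set N, IsOpen U ∧ x ∈ U ∧ ∃ f : N → ℝ,
    ContMDiffOn (𝓡 (n + 1)) 𝓘(ℝ, ℝ) ∞ f U ∧
    (∀ y ∈ U, mfderiv (𝓡 (n + 1)) 𝓘(ℝ, ℝ) f y ≠ 0) ∧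
    S ∩ U = {y ∈ U | f y = 0}

/-- `A` has smooth boundary in `W`: near each point of `∂A ∩ W`, the boundary `∂A` is the zero set
of a smooth function without critical points, and `A` is the set where this function is
positive. -/
def HasSmoothBoundaryIn (A W : Set N) : Prop :=
  ∀ x ∈ frontier A ∩ W, ∃ U : Set N, IsOpen U ∧ x ∈ U ∧ ∃ f : N → ℝ,
    ContMDiffOn (𝓡 (n + 1)) 𝓘(ℝ, ℝ) ∞ f U ∧
    (∀ y ∈ U, mfderiv (𝓡 (n + 1)) 𝓘(ℝ, ℝ) f y ≠ 0) ∧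
    frontier A ∩ U = {y ∈ U | f y = 0} ∧ A ∩ U = {y ∈ U | 0 < f y}

/-- `φ` is a geodesic normal coordinate chart of the ball `B_R(q)` onto the Euclidean ball
`B_R(0)`: a smooth diffeomorphism with `φ(q) = 0` whose inverse maps each radial segment
`t ↦ t v`, `0 ≤ t ≤ 1`, to a minimising geodesic of constant speed `|v|`. (Then `φ⁻¹` is `exp_q`
composed with a linear isometry `ℝ^{n+1} → T_q N`.) -/
def IsNormalChart (q : N) (R : ℝ)
    (φ : OpenPartialHomeomorph N (EuclideanSpace ℝ (Fin (n + 1)))) : Prop :=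
  φ ∈ IsManifold.maximalAtlas (𝓡 (n + 1)) ∞ N ∧
  φ.source = Metric.ball q R ∧ φ.target = Metric.ball 0 R ∧ φ q = 0 ∧
  ∀ v ∈ Metric.ball (0 : EuclideanSpace ℝ (Fin (n + 1))) R,
    ∀ s ∈ Icc (0 : ℝ) 1, ∀ t ∈ Icc (0 : ℝ) 1,
      dist (φ.symm (s • v)) (φ.symm (t • v)) = |s - t| * ‖v‖

/-- The ball `B_R(q)` is 2-bi-Lipschitz diffeomorphic, via a geodesic normal coordinate chart, to
the Euclidean ball `B_R(0)`. -/
def HasBiLipschitzNormalChart (q : N) (R : ℝ) : Prop :=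
  ∃ φ : OpenPartialHomeomorph N (EuclideanSpace ℝ (Fin (n + 1))), IsNormalChart n q R φ ∧
    ∀ x ∈ Metric.ball q R, ∀ y ∈ Metric.ball q R,
      dist (φ x) (φ y) ≤ 2 * dist x y ∧ dist x y ≤ 2 * dist (φ x) (φ y)

end Smooth

end GeomBV

/-!
A set that is smooth near the annulus `r₁ ≤ dist x p ≤ r₂` is smoothed inside the ball `B_{r₂}(p)`
without changing it outside a smaller ball, at an arbitrarily small cost in perimeter and volume.

Everything takes place in the normal chart at `p`, where distances from `p` are Euclidean norms.
Three facts on Riemannian geometry in charts are needed: the Hausdorff measure of the distance is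
`√|g| dy` (`vol_symm_image`), the divergence does not depend on the chart (`chartDivergence_eq`),
and hence the flux `∫_F div X` of a field supported in the chart is a Euclidean flux with the
weight `ρ = √|g|` (`setIntegral_divergence_transplant_eq`). The metric of the chart is extended to
all of `ℝ^d` (`exists_smoothMetric_extension`), so that the analysis concerns a `SmoothMetric`.

Perimeters are suprema of fluxes. No reduced boundaries or measures of total variation are used:
each area is expressed by the fluxes it bounds, and an inequality `Per G ≤ Per F + small` is proved
by exhibiting, for the flux through `∂G` of every admissible field, one admissible field with
nearly the same or larger flux through `∂F`.

The smoothing itself is `SmoothMetric.exists_smooth_superlevel`. In the annulus `F` coincides with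
`E`, and there `E` is `{f > 0}` for a smooth `f` that is regular on `{f = 0}`
(`exists_defining_of_local`: local defining functions are added up with cutoffs). The indicator
function of `F` is approximated by smooth functions `u`: mollifications in the inner part, the steep
profiles `σ (L f)` with the sigmoid `σ` further out, and a smooth transition between the two inside
the annulus. Two estimates control their level sets.

* Where mollification enters, the weighted total variation of `u` is nearly bounded by the flux of
  a field through `∂F`, since mollification can be moved from the set to the field
  (`SmoothMetric.exists_mollification`, `SmoothMetric.exists_approximants`). The coarea inequality
  `exists_level_integral_ediv_le` then selects a level `t` whose level set has at most the mean
  area.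
* Where `u = σ (L f)`, the level sets are calibrated, up to a small factor, by the smooth field
  `∇f / √(|∇f|² + κ²)`. This persists under perturbations of bounded gradient once `L` is large, so
  the level can be moved from `t` back to `1 / 2`, that is to `{f = 0}`, as one leaves the ball
  (`SmoothMetric.exists_sigmoid_calibrated`, `integral_ediv_le_of_calibrated`).

Regularity of the level set follows from a form of Sard's theorem that only needs smooth images of
null sets: after almost every small tilt `u + ⟪a, ·⟫`, almost every level is regular
(`exists_ae_regular`).

On the manifold, `perimeter_le_of_flux_le` splits an admissible field by a cutoff `ξ` into a part in
the chart, to which the flux comparison applies, and a remainder that does not see the modification.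
The opposite inequality for the perimeter is its lower semicontinuity (`exists_perimeter_ge`).
-/

set_option linter.unusedSectionVars false

namespace GeomBV

open Filter Topology Manifold

/-! ### The metric in a chart -/

section ChartMetric

variable {n : ℕ} {N : Type*} [MetricSpace N] [ChartedSpace (EuclideanSpace ℝ (Fin (n + 1))) N]

/-- The derivative of the inverse of the chart `c` at the point `y` of the model space, as a
continuous linear map on the model space itself. -/
noncomputable def chartFrame (c : OpenPartialHomeomorph N (EuclideanSpace ℝ (Fin (n + 1))))
    (y : EuclideanSpace ℝ (Fin (n + 1))) :
    EuclideanSpace ℝ (Fin (n + 1)) →L[ℝ] TangentSpace (𝓡 (n + 1)) (c.symm y) :=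
  mfderiv (𝓡 (n + 1)) (𝓡 (n + 1)) c.symm y

/-- The derivative of the chart `c` at the point `x` of the manifold, with values in the model
space itself. -/
noncomputable def chartCoframe (c : OpenPartialHomeomorph N (EuclideanSpace ℝ (Fin (n + 1))))
    (x : N) : TangentSpace (𝓡 (n + 1)) x →L[ℝ] EuclideanSpace ℝ (Fin (n + 1)) :=
  mfderiv (𝓡 (n + 1)) (𝓡 (n + 1)) c x

variable {c : OpenPartialHomeomorph N (EuclideanSpace ℝ (Fin (n + 1)))}

section Smooth

lemma mdifferentiable_of_mem_maximalAtlas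
    (hc : c ∈ IsManifold.maximalAtlas (𝓡 (n + 1)) ∞ N) :
    c.MDifferentiable (𝓡 (n + 1)) (𝓡 (n + 1)) :=
  ⟨(contMDiffOn_of_mem_maximalAtlas hc).mdifferentiableOn (by simp),
    (contMDiffOn_symm_of_mem_maximalAtlas hc).mdifferentiableOn (by simp)⟩

variable [IsManifold (𝓡 (n + 1)) ∞ N]

lemma chartCoframe_chartFrame (hc : c ∈ IsManifold.maximalAtlas (𝓡 (n + 1)) ∞ N)
    {y : EuclideanSpace ℝ (Fin (n + 1))} (hy : y ∈ c.target)
    (v : EuclideanSpace ℝ (Fin (n + 1))) :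
    chartCoframe c (c.symm y) (chartFrame c y v) = v :=
  congrArg (fun L => L v) ((mdifferentiable_of_mem_maximalAtlas hc).comp_symm_deriv hy)

lemma chartFrame_chartCoframe (hc : c ∈ IsManifold.maximalAtlas (𝓡 (n + 1)) ∞ N)
    {y : EuclideanSpace ℝ (Fin (n + 1))} (hy : y ∈ c.target)
    (v : TangentSpace (𝓡 (n + 1)) (c.symm y)) :
    chartFrame c y (chartCoframe c (c.symm y) v) = v := by
  have h := (mdifferentiable_of_mem_maximalAtlas hc).symm_comp_deriv (c.map_target hy)
  rw [c.right_inv hy] at h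
  exact congrArg (fun L => L v) h

/-- The push-forward of a smooth field on the model space is a smooth field along the inverse of
the chart. -/
lemma contMDiffOn_chartFrame (hc : c ∈ IsManifold.maximalAtlas (𝓡 (n + 1)) ∞ N)
    {V : EuclideanSpace ℝ (Fin (n + 1)) → EuclideanSpace ℝ (Fin (n + 1))}
    (hV : ContDiffOn ℝ ∞ V c.target) :
    ContMDiffOn (𝓡 (n + 1)) (𝓡 (n + 1)).tangent ∞
      (fun y ↦ (⟨c.symm y, chartFrame c y (V y)⟩ :
        TangentBundle (𝓡 (n + 1)) N)) c.target := by
  have h1 := (contMDiffOn_symm_of_mem_maximalAtlas hc).contMDiffOn_tangentMapWithin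
    (m := ∞) (by simp) c.open_target.uniqueMDiffOn
  have h2 : ContMDiffOn (𝓡 (n + 1)) (𝓡 (n + 1)).tangent ∞
      (fun y ↦ (⟨y, V y⟩ : TangentBundle (𝓡 (n + 1)) (EuclideanSpace ℝ (Fin (n + 1)))))
      c.target := contMDiffOn_vectorSpace_iff_contDiffOn.2 hV
  refine (h1.comp h2 fun y hy ↦ hy).congr fun y hy ↦ ?_
  simp only [tangentMapWithin, Function.comp]
  rw [mfderivWithin_of_isOpen c.open_target hy]
  rfl

end Smooth

variable [Bundle.RiemannianBundle (fun x : N ↦ TangentSpace (𝓡 (n + 1)) x)]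

/-- The metric tensor `g(v, w)` read in the chart `c` at the point `y` of the model space. -/
noncomputable def chartMetric (c : OpenPartialHomeomorph N (EuclideanSpace ℝ (Fin (n + 1))))
    (y v w : EuclideanSpace ℝ (Fin (n + 1))) : ℝ :=
  inner ℝ (chartFrame c y v) (chartFrame c y w)

lemma chartMetric_self (y v : EuclideanSpace ℝ (Fin (n + 1))) :
    chartMetric c y v v = ‖chartFrame c y v‖ ^ 2 :=
  real_inner_self_eq_norm_sq _

lemma norm_chartFrame (y v : EuclideanSpace ℝ (Fin (n + 1))) :
    ‖chartFrame c y v‖ = √(chartMetric c y v v) := by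
  rw [chartMetric_self, Real.sqrt_sq (norm_nonneg _)]

lemma chartMetric_comm (y v w : EuclideanSpace ℝ (Fin (n + 1))) :
    chartMetric c y v w = chartMetric c y w v :=
  real_inner_comm _ _

lemma chartMetric_eq_sum (y v w : EuclideanSpace ℝ (Fin (n + 1))) :
    chartMetric c y v w = ∑ i, ∑ j, v i * w j *
      chartMetric c y (EuclideanSpace.single i 1) (EuclideanSpace.single j 1) := by
  have h : ∀ v : EuclideanSpace ℝ (Fin (n + 1)), chartFrame c y v
      = ∑ i, v i • chartFrame c y (EuclideanSpace.single i 1) := by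
    intro v
    have : v = ∑ i, v i • EuclideanSpace.single i (1 : ℝ) := by
      have := (EuclideanSpace.basisFun (Fin (n + 1)) ℝ).sum_repr v
      simpa using this.symm
    conv_lhs => rw [this]
    rw [map_sum]
    exact Finset.sum_congr rfl fun i _ ↦ map_smul _ _ _
  unfold chartMetric
  rw [h v, h w, sum_inner]
  refine Finset.sum_congr rfl fun i _ ↦ ?_
  rw [inner_sum]
  refine Finset.sum_congr rfl fun j _ ↦ ?_
  rw [real_inner_smul_left, real_inner_smul_right, mul_assoc]

lemma chartDensity_eq (y : EuclideanSpace ℝ (Fin (n + 1))) :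
    chartDensity c y = √(Matrix.det (Matrix.of fun i j : Fin (n + 1) ↦
      chartMetric c y (EuclideanSpace.single i 1) (EuclideanSpace.single j 1))) :=
  rfl

variable [IsManifold (𝓡 (n + 1)) ∞ N]

lemma chartMetric_pos (hc : c ∈ IsManifold.maximalAtlas (𝓡 (n + 1)) ∞ N)
    {y v : EuclideanSpace ℝ (Fin (n + 1))} (hy : y ∈ c.target) (hv : v ≠ 0) :
    0 < chartMetric c y v v := by
  rw [chartMetric_self]
  have : chartFrame c y v ≠ 0 := by
    intro h0
    apply hv
    rw [← chartCoframe_chartFrame hc hy v, h0, map_zero]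
  have := norm_pos_iff.2 this
  positivity

lemma posDef_chartMetric (hc : c ∈ IsManifold.maximalAtlas (𝓡 (n + 1)) ∞ N)
    {y : EuclideanSpace ℝ (Fin (n + 1))} (hy : y ∈ c.target) :
    (Matrix.of fun i j : Fin (n + 1) ↦
      chartMetric c y (EuclideanSpace.single i 1) (EuclideanSpace.single j 1)).PosDef := by
  refine Matrix.PosDef.of_dotProduct_mulVec_pos ?_ ?_
  · ext i j
    simp [Matrix.conjTranspose_apply, chartMetric_comm]
  · intro x hx
    have h := chartMetric_pos hc hy (v := WithLp.toLp 2 x) (by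
      intro h; apply hx; simpa using congrArg WithLp.ofLp h)
    rw [chartMetric_eq_sum] at h
    refine h.trans_eq ?_
    simp only [dotProduct, Matrix.mulVec, Finset.mul_sum, Matrix.of_apply, star_trivial]
    refine Finset.sum_congr rfl fun i _ ↦ Finset.sum_congr rfl fun j _ ↦ ?_
    change x i * x j * _ = _
    ring

lemma chartDensity_pos (hc : c ∈ IsManifold.maximalAtlas (𝓡 (n + 1)) ∞ N)
    {y : EuclideanSpace ℝ (Fin (n + 1))} (hy : y ∈ c.target) : 0 < chartDensity c y := by
  rw [chartDensity_eq]
  exact Real.sqrt_pos.2 (posDef_chartMetric hc hy).det_pos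

variable [IsContMDiffRiemannianBundle (𝓡 (n + 1)) ∞ (EuclideanSpace ℝ (Fin (n + 1)))
      (fun x : N ↦ TangentSpace (𝓡 (n + 1)) x)]

lemma contDiffOn_chartMetric (hc : c ∈ IsManifold.maximalAtlas (𝓡 (n + 1)) ∞ N)
    (v w : EuclideanSpace ℝ (Fin (n + 1))) :
    ContDiffOn ℝ ∞ (fun y ↦ chartMetric c y v w) c.target := by
  have := (contMDiffOn_chartFrame hc (contDiffOn_const (c := v))).inner_bundle
    (contMDiffOn_chartFrame hc (contDiffOn_const (c := w)))
  exact this.contDiffOn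

lemma contDiffOn_chartDensity (hc : c ∈ IsManifold.maximalAtlas (𝓡 (n + 1)) ∞ N) :
    ContDiffOn ℝ ∞ (chartDensity c) c.target := by
  have : ContDiffOn ℝ ∞ (fun y ↦ Matrix.det (Matrix.of fun i j : Fin (n + 1) ↦
      chartMetric c y (EuclideanSpace.single i 1) (EuclideanSpace.single j 1))) c.target := by
    simp only [Matrix.det_apply]
    refine ContDiffOn.sum fun σ _ ↦ ContDiffOn.const_smul _ ?_
    refine contDiffOn_prod fun i _ ↦ ?_
    exact contDiffOn_chartMetric hc _ _
  exact this.sqrt fun y hy ↦ (posDef_chartMetric hc hy).det_pos.ne'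

end ChartMetric

/-! ### The distance in a chart -/

section DistanceInCharts

variable {n : ℕ} {N : Type*} [MetricSpace N] [ChartedSpace (EuclideanSpace ℝ (Fin (n + 1))) N]
  [Bundle.RiemannianBundle (fun x : N ↦ TangentSpace (𝓡 (n + 1)) x)]
  [IsManifold (𝓡 (n + 1)) ∞ N]
  {c : OpenPartialHomeomorph N (EuclideanSpace ℝ (Fin (n + 1)))}

lemma norm_chartFrame_chartCoframe (hc : c ∈ IsManifold.maximalAtlas (𝓡 (n + 1)) ∞ N)
    {x : N} (hx : x ∈ c.source) (w : TangentSpace (𝓡 (n + 1)) x) :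
    ‖chartFrame c (c x) (chartCoframe c x w)‖ = ‖w‖ := by
  obtain ⟨y, hy, rfl⟩ : ∃ y ∈ c.target, c.symm y = x := ⟨c x, c.map_source hx, c.left_inv hx⟩
  have : ∀ y', y' = y → ‖chartFrame c y' (chartCoframe c (c.symm y) w)‖ = ‖w‖ := by
    rintro _ rfl
    rw [chartFrame_chartCoframe hc hy]
  exact this _ (c.right_inv hy)

/-- A path which stays inside a region of a chart where `‖L v‖ ≤ C |v|_g` is at least as long,
up to the factor `C`, as the `L`-length of the displacement in the chart. -/
lemma enorm_sub_le_pathELength (hc : c ∈ IsManifold.maximalAtlas (𝓡 (n + 1)) ∞ N)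
    {S : Set (EuclideanSpace ℝ (Fin (n + 1)))}
    {L : EuclideanSpace ℝ (Fin (n + 1)) →L[ℝ] EuclideanSpace ℝ (Fin (n + 1))} {C : ℝ}
    (hC : ∀ y ∈ S, ∀ v, ‖L v‖ ≤ C * ‖chartFrame c y v‖)
    {γ : ℝ → N} {t : ℝ} (ht : 0 ≤ t) (hγ : ContMDiffOn 𝓘(ℝ, ℝ) (𝓡 (n + 1)) 1 γ (Icc 0 t))
    (hγS : ∀ s ∈ Icc 0 t, γ s ∈ c.source ∧ c (γ s) ∈ S) :
    ‖L (c (γ t)) - L (c (γ 0))‖ₑ ≤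
      ENNReal.ofReal C * pathELength (𝓡 (n + 1)) γ 0 t := by
  rcases ht.eq_or_lt with rfl | ht0
  · simp
  have hcγ : ContMDiffOn 𝓘(ℝ, ℝ) (𝓡 (n + 1)) 1 (c ∘ γ) (Icc 0 t) :=
    ((contMDiffOn_of_mem_maximalAtlas hc).of_le (by simp)).comp hγ fun s hs ↦ (hγS s hs).1
  have hcγ' : ContDiffOn ℝ 1 (c ∘ γ) (Icc 0 t) := contMDiffOn_iff_contDiffOn.1 hcγ
  have hLcγ : ContDiffOn ℝ 1 (L ∘ c ∘ γ) (Icc 0 t) := L.contDiff.comp_contDiffOn hcγ'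
  have hu : UniqueDiffOn ℝ (Icc 0 t) := uniqueDiffOn_Icc ht0
  calc ‖L (c (γ t)) - L (c (γ 0))‖ₑ
      ≤ ∫⁻ s in Icc 0 t, ‖derivWithin (L ∘ c ∘ γ) (Icc 0 t) s‖ₑ :=
        enorm_sub_le_lintegral_derivWithin_Icc_of_contDiffOn_Icc hLcγ ht
    _ ≤ ∫⁻ s in Icc 0 t,
          ENNReal.ofReal C * ‖mfderivWithin 𝓘(ℝ, ℝ) (𝓡 (n + 1)) γ (Icc 0 t) s 1‖ₑ := by
        refine setLIntegral_mono' measurableSet_Icc fun s hs ↦ ?_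
        obtain ⟨hs1, hs2⟩ := hγS s hs
        have hd : derivWithin (L ∘ c ∘ γ) (Icc 0 t) s = L (derivWithin (c ∘ γ) (Icc 0 t) s) := by
          rw [← fderivWithin_derivWithin, ← fderivWithin_derivWithin,
            fderivWithin_comp s L.differentiableAt.differentiableWithinAt
              (hcγ'.differentiableOn one_ne_zero s hs) (mapsTo_univ _ _) (hu s hs)]
          simp
        have hm : mfderivWithin 𝓘(ℝ, ℝ) (𝓡 (n + 1)) (c ∘ γ) (Icc 0 t) s =
            (mfderiv (𝓡 (n + 1)) (𝓡 (n + 1)) c (γ s)).comp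
              (mfderivWithin 𝓘(ℝ, ℝ) (𝓡 (n + 1)) γ (Icc 0 t) s) := by
          apply mfderiv_comp_mfderivWithin
          · exact (mdifferentiable_of_mem_maximalAtlas hc).mdifferentiableAt hs1
          · exact hγ.mdifferentiableOn one_ne_zero s hs
          · rw [uniqueMDiffWithinAt_iff_uniqueDiffWithinAt]
            exact hu s hs
        have hv : derivWithin (c ∘ γ) (Icc 0 t) s =
            chartCoframe c (γ s) (mfderivWithin 𝓘(ℝ, ℝ) (𝓡 (n + 1)) γ (Icc 0 t) s 1) := by
          have h1 : mfderivWithin 𝓘(ℝ, ℝ) (𝓡 (n + 1)) (c ∘ γ) (Icc 0 t) s 1 =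
              chartCoframe c (γ s) (mfderivWithin 𝓘(ℝ, ℝ) (𝓡 (n + 1)) γ (Icc 0 t) s 1) :=
            congrArg (fun A ↦ A 1) hm
          rw [← h1, ← fderivWithin_derivWithin]
          exact congrArg (fun A : ℝ →L[ℝ] EuclideanSpace ℝ (Fin (n + 1)) ↦ A 1)
            mfderivWithin_eq_fderivWithin.symm
        set w := mfderivWithin 𝓘(ℝ, ℝ) (𝓡 (n + 1)) γ (Icc 0 t) s 1
        have hw := norm_chartFrame_chartCoframe hc hs1 w
        rw [hd, hv]
        have h2 := hC _ hs2 (chartCoframe c (γ s) w)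
        rw [hw] at h2
        rw [← ofReal_norm, ← ofReal_norm, ← ENNReal.ofReal_mul']
        · exact ENNReal.ofReal_le_ofReal h2
        · exact norm_nonneg _
    _ = ENNReal.ofReal C * pathELength (𝓡 (n + 1)) γ 0 t := by
        rw [lintegral_const_mul' _ _ ENNReal.ofReal_ne_top,
          pathELength_eq_lintegral_mfderivWithin_Icc]

/-- In a ball of a chart where `|v|_g ≤ C ‖L v‖`, the distance is at most `C` times the
`L`-distance of the coordinates: the image of a segment is a competitor. -/
lemma edist_symm_le (hc : c ∈ IsManifold.maximalAtlas (𝓡 (n + 1)) ∞ N)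
    [IsRiemannianManifold (𝓡 (n + 1)) N]
    {B : Set (EuclideanSpace ℝ (Fin (n + 1)))} (hB : B ⊆ c.target) (hBc : Convex ℝ B)
    {L : EuclideanSpace ℝ (Fin (n + 1)) →L[ℝ] EuclideanSpace ℝ (Fin (n + 1))} {C : ℝ}
    (hC : ∀ y ∈ B, ∀ v, ‖chartFrame c y v‖ ≤ C * ‖L v‖)
    {y z : EuclideanSpace ℝ (Fin (n + 1))} (hy : y ∈ B) (hz : z ∈ B) :
    edist (c.symm y) (c.symm z) ≤ ENNReal.ofReal C * edist (L y) (L z) := by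
  set η : ℝ → EuclideanSpace ℝ (Fin (n + 1)) := fun t ↦ y + t • (z - y)
  have hη : ∀ t ∈ Icc (0 : ℝ) 1, η t ∈ B := fun t ht ↦
    hBc.add_smul_sub_mem hy hz ht
  have hηc : ContDiff ℝ ∞ η := by fun_prop
  have hηd : ∀ t, HasDerivAt η (z - y) t := fun t ↦ by
    have := ((hasDerivAt_id t).smul_const (z - y)).const_add y
    rw [one_smul] at this
    exact this
  have hγ : ContMDiffOn 𝓘(ℝ, ℝ) (𝓡 (n + 1)) 1 (c.symm ∘ η) (Icc 0 1) :=
    ((contMDiffOn_symm_of_mem_maximalAtlas hc).of_le (by simp)).comp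
      (contMDiffOn_iff_contDiffOn.2 (hηc.of_le (by simp)).contDiffOn) fun t ht ↦ hB (hη t ht)
  rw [IsRiemannianManifold.out (I := 𝓡 (n + 1)) (c.symm y) (c.symm z)]
  refine (riemannianEDist_le_pathELength hγ (by simp [η]) (by simp [η]) zero_le_one).trans ?_
  rw [pathELength_eq_lintegral_mfderivWithin_Icc]
  have hb : ∀ t ∈ Icc (0 : ℝ) 1,
      ‖mfderivWithin 𝓘(ℝ, ℝ) (𝓡 (n + 1)) (c.symm ∘ η) (Icc 0 1) t 1‖ₑ ≤
        ENNReal.ofReal C * edist (L y) (L z) := by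
    intro t ht
    have hm : mfderivWithin 𝓘(ℝ, ℝ) (𝓡 (n + 1)) (c.symm ∘ η) (Icc 0 1) t =
        (mfderiv (𝓡 (n + 1)) (𝓡 (n + 1)) c.symm (η t)).comp
          (mfderivWithin 𝓘(ℝ, ℝ) (𝓡 (n + 1)) η (Icc 0 1) t) := by
      apply mfderiv_comp_mfderivWithin
      · exact (mdifferentiable_of_mem_maximalAtlas hc).mdifferentiableAt_symm (hB (hη t ht))
      · exact (hηd t).differentiableAt.mdifferentiableAt.mdifferentiableWithinAt
      · rw [uniqueMDiffWithinAt_iff_uniqueDiffWithinAt]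
        exact uniqueDiffOn_Icc zero_lt_one t ht
    have hd : mfderivWithin 𝓘(ℝ, ℝ) (𝓡 (n + 1)) η (Icc 0 1) t =
        fderivWithin ℝ η (Icc 0 1) t := mfderivWithin_eq_fderivWithin
    have hd' : fderivWithin ℝ η (Icc 0 1) t 1 = z - y := by
      rw [fderivWithin_derivWithin]
      exact (hηd t).hasDerivWithinAt.derivWithin (uniqueDiffOn_Icc zero_lt_one t ht)
    have h1 : mfderivWithin 𝓘(ℝ, ℝ) (𝓡 (n + 1)) (c.symm ∘ η) (Icc 0 1) t 1 =
        chartFrame c (η t) (z - y) := by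
      rw [← hd', hm, hd]
      rfl
    have h2 : ‖mfderivWithin 𝓘(ℝ, ℝ) (𝓡 (n + 1)) (c.symm ∘ η) (Icc 0 1) t 1‖ₑ =
        ‖chartFrame c (η t) (z - y)‖ₑ := congrArg (fun v ↦ ‖v‖ₑ) h1
    rw [h2, edist_comm, edist_eq_enorm_sub, ← map_sub, ← ofReal_norm, ← ofReal_norm,
      ← ENNReal.ofReal_mul' (norm_nonneg _)]
    exact ENNReal.ofReal_le_ofReal (hC _ (hη t ht) _)
  refine (setLIntegral_mono' measurableSet_Icc hb).trans_eq ?_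
  simp

/-- Near the centre of a closed ball of a chart where `‖L v‖ ≤ C |v|_g`, the `L`-distance of the
coordinates is at most `C` times the distance: a path which leaves the ball is longer than the
points are apart. -/
lemma edist_le_of_mem_ball (hc : c ∈ IsManifold.maximalAtlas (𝓡 (n + 1)) ∞ N)
    [IsRiemannianManifold (𝓡 (n + 1)) N]
    {y₀ : EuclideanSpace ℝ (Fin (n + 1))} {r R : ℝ}
    (hR : Metric.closedBall y₀ R ⊆ c.target)
    {L : EuclideanSpace ℝ (Fin (n + 1)) →L[ℝ] EuclideanSpace ℝ (Fin (n + 1))} {C m M : ℝ}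
    (hC : ∀ y ∈ Metric.closedBall y₀ R, ∀ v, ‖L v‖ ≤ C * ‖chartFrame c y v‖)
    (hm0 : 0 ≤ m) (hm : ∀ v, m * ‖v‖ ≤ ‖L v‖) (hM : ∀ v, ‖L v‖ ≤ M * ‖v‖)
    (hrR : r ≤ R) (hr : M * (2 * r) ≤ m * (R - r)) (hM0 : 0 ≤ M)
    {x x' : N} (hx : x ∈ c.source) (hxr : c x ∈ Metric.ball y₀ r) (hxr' : c x' ∈ Metric.ball y₀ r) :
    edist (L (c x)) (L (c x')) ≤ ENNReal.ofReal C * edist x x' := by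
  have key : ∀ γ : ℝ → N, γ 0 = x → γ 1 = x' →
      ContMDiffOn 𝓘(ℝ, ℝ) (𝓡 (n + 1)) 1 γ (Icc 0 1) →
      edist (L (c x)) (L (c x')) ≤ ENNReal.ofReal C * pathELength (𝓡 (n + 1)) γ 0 1 := by
    intro γ h0 h1 hγ
    have hγc : ContinuousOn γ (Icc 0 1) := hγ.continuousOn
    set O : Set N := c.source ∩ c ⁻¹' Metric.ball y₀ R
    have hO : IsOpen O := c.isOpen_inter_preimage Metric.isOpen_ball
    set K : Set N := c.symm '' Metric.closedBall y₀ R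
    have hK : IsClosed K :=
      ((isCompact_closedBall y₀ R).image_of_continuousOn (c.continuousOn_symm.mono hR)).isClosed
    have hOK : O ⊆ K := fun z hz ↦
      ⟨c z, Metric.ball_subset_closedBall hz.2, c.left_inv hz.1⟩
    have hK' : ∀ z ∈ K, z ∈ c.source ∧ c z ∈ Metric.closedBall y₀ R := by
      rintro _ ⟨y, hy, rfl⟩
      exact ⟨c.map_target (hR hy), by rwa [c.right_inv (hR hy)]⟩
    by_cases hex : ∃ t ∈ Icc (0 : ℝ) 1, γ t ∉ O
    · -- the first exit time from `O`
      set S : Set ℝ := {t | t ∈ Icc (0 : ℝ) 1 ∧ γ t ∉ O}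
      have hSc : IsClosed S := by
        have : S = Icc 0 1 ∩ γ ⁻¹' Oᶜ := rfl
        rw [this]
        exact hγc.preimage_isClosed_of_isClosed isClosed_Icc hO.isClosed_compl
      have hSb : BddBelow S := ⟨0, fun t ht ↦ ht.1.1⟩
      obtain ⟨ht, htO⟩ : sInf S ∈ S := hSc.csInf_mem hex hSb
      set t := sInf S
      have hlt : ∀ s ∈ Ico 0 t, γ s ∈ O := by
        intro s hs
        by_contra hsO
        exact absurd (csInf_le hSb ⟨⟨hs.1, hs.2.le.trans ht.2⟩, hsO⟩) (not_le.2 hs.2)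
      have ht0 : 0 < t := by
        rcases ht.1.eq_or_lt with h | h
        · exfalso
          apply htO
          rw [← h, h0]
          exact ⟨hx, Metric.ball_subset_ball hrR hxr⟩
        · exact h
      have hsub : Icc 0 t ⊆ Icc 0 1 := Icc_subset_Icc_right ht.2
      have htK : ∀ s ∈ Icc 0 t, γ s ∈ K := by
        have : closure (Ico 0 t) ⊆ Icc 0 1 ∩ γ ⁻¹' K := by
          refine closure_minimal ?_ (hγc.preimage_isClosed_of_isClosed isClosed_Icc hK)
          exact fun s hs ↦ ⟨⟨hs.1, hs.2.le.trans ht.2⟩, hOK (hlt s hs)⟩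
        rw [closure_Ico ht0.ne] at this
        exact fun s hs ↦ (this hs).2
      have h2 := enorm_sub_le_pathELength hc hC ht.1 (hγ.mono hsub)
        fun s hs ↦ hK' _ (htK s hs)
      have h3 : pathELength (𝓡 (n + 1)) γ 0 t ≤ pathELength (𝓡 (n + 1)) γ 0 1 :=
        pathELength_mono le_rfl ht.2
      refine le_trans ?_ (h2.trans (by gcongr))
      rw [edist_eq_enorm_sub, ← map_sub, ← map_sub, ← ofReal_norm, ← ofReal_norm]
      apply ENNReal.ofReal_le_ofReal
      rw [h0]
      have h4 : R ≤ ‖c (γ t) - y₀‖ := by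
        rw [← dist_eq_norm]
        by_contra h
        exact htO ⟨(hK' _ (htK t ⟨ht.1, le_rfl⟩)).1, not_le.1 h⟩
      have h5 : ‖c x - y₀‖ < r := by rwa [← dist_eq_norm]
      have h5' : ‖c x' - y₀‖ < r := by rwa [← dist_eq_norm]
      have h6 : R - r ≤ ‖c (γ t) - c x‖ := by
        have := norm_sub_le_norm_sub_add_norm_sub (c (γ t)) (c x) y₀
        linarith
      have h7 : ‖c x - c x'‖ ≤ 2 * r := by
        have := norm_sub_le_norm_sub_add_norm_sub (c x) y₀ (c x')
        rw [norm_sub_rev y₀] at this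
        linarith
      calc ‖L (c x - c x')‖ ≤ M * ‖c x - c x'‖ := hM _
        _ ≤ M * (2 * r) := by gcongr
        _ ≤ m * (R - r) := hr
        _ ≤ m * ‖c (γ t) - c x‖ := by gcongr
        _ ≤ _ := hm _
    · push Not at hex
      have h2 := enorm_sub_le_pathELength hc hC zero_le_one hγ
        fun s hs ↦ hK' _ (hOK (hex s hs))
      rwa [h0, h1, ← edist_eq_enorm_sub, edist_comm] at h2
  rw [IsRiemannianManifold.out (I := 𝓡 (n + 1)) x x']
  rcases eq_or_ne (ENNReal.ofReal C) 0 with hC0 | hC0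
  · have : ∃ γ : ℝ → N, γ 0 = x ∧ γ 1 = x' ∧
        ContMDiffOn 𝓘(ℝ, ℝ) (𝓡 (n + 1)) 1 γ (Icc 0 1) := by
      have h : riemannianEDist (𝓡 (n + 1)) x x' < ⊤ := by
        rw [← IsRiemannianManifold.out (I := 𝓡 (n + 1)) x x']
        exact edist_lt_top _ _
      obtain ⟨γ, h0, h1, h2, -⟩ := exists_lt_of_riemannianEDist_lt h
      exact ⟨γ, h0, h1, h2⟩
    obtain ⟨γ, h0, h1, h2⟩ := this
    have := key γ h0 h1 h2
    rw [hC0, zero_mul] at this ⊢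
    exact this
  · rw [mul_comm, ← ENNReal.div_le_iff hC0 ENNReal.ofReal_ne_top]
    refine le_of_forall_gt fun b hb ↦ ?_
    obtain ⟨γ, h0, h1, h2, h3⟩ := exists_lt_of_riemannianEDist_lt hb
    refine lt_of_le_of_lt ?_ h3
    rw [ENNReal.div_le_iff hC0 ENNReal.ofReal_ne_top, mul_comm]
    exact key γ h0 h1 h2

end DistanceInCharts

/-! ### The volume in a chart -/

section MeasureComparison

/-- A local inequality between measures is global. -/
lemma measure_le_of_local {X : Type*} [TopologicalSpace X] [SecondCountableTopology X]
    [MeasurableSpace X] [BorelSpace X] {μ ν : Measure X} {T : Set X}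
    (h : ∀ x ∈ T, ∃ V ∈ 𝓝[T] x, ∀ A ⊆ V, MeasurableSet A → μ A ≤ ν A)
    {A : Set X} (hA : MeasurableSet A) (hAT : A ⊆ T) : μ A ≤ ν A := by
  choose! V hV hVA using h
  obtain ⟨t, htT, htc, hcov⟩ := TopologicalSpace.countable_cover_nhdsWithin hV
  have hV' : ∀ x ∈ T, ∃ U, IsOpen U ∧ x ∈ U ∧ U ∩ T ⊆ V x := fun x hx ↦ by
    obtain ⟨U, hU, hxU, h⟩ := mem_nhdsWithin.1 (hV x hx)
    exact ⟨U, hU, hxU, h⟩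
  choose! U hU hxU hUV using hV'
  have hU' : ∀ x ∈ T, U x ∈ 𝓝[T] x := fun x hx ↦
    mem_nhdsWithin_of_mem_nhds ((hU x hx).mem_nhds (hxU x hx))
  obtain ⟨t, htT, htc, hcov⟩ := TopologicalSpace.countable_cover_nhdsWithin hU'
  rcases t.eq_empty_or_nonempty with rfl | hne
  · have : A = ∅ := by
      apply eq_empty_of_subset_empty
      exact (hAT.trans hcov).trans (by simp)
    simp [this]
  obtain ⟨f, rfl⟩ := htc.exists_eq_range hne
  have hfT : ∀ i, f i ∈ T := fun i ↦ htT ⟨i, rfl⟩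
  set D := disjointed fun i ↦ U (f i)
  have hD : ∀ i, MeasurableSet (D i) := fun i ↦
    MeasurableSet.disjointed (fun i ↦ (hU _ (hfT i)).measurableSet) i
  have hAD : A = ⋃ i, A ∩ D i := by
    rw [← inter_iUnion, iUnion_disjointed, eq_comm, inter_eq_left]
    intro x hx
    have := hcov (hAT hx)
    simpa using this
  have hdisj : Pairwise (Function.onFun Disjoint fun i ↦ A ∩ D i) := fun i j hij ↦
    ((disjoint_disjointed fun i ↦ U (f i)) hij).mono inter_subset_right inter_subset_right
  rw [hAD, measure_iUnion hdisj fun i ↦ hA.inter (hD i),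
    measure_iUnion hdisj fun i ↦ hA.inter (hD i)]
  refine ENNReal.tsum_le_tsum fun i ↦ ?_
  refine hVA (f i) (hfT i) _ ?_ (hA.inter (hD i))
  exact fun x hx ↦ hUV _ (hfT i) ⟨disjointed_subset _ i hx.2, hAT hx.1⟩

/-- A map which does not increase distances by more than a factor `K` does not increase the
Euclidean Hausdorff measure of dimension `d` by more than `K ^ d`. -/
lemma euclideanHausdorffMeasure_image_le {X Y : Type*} [MetricSpace X] [MeasurableSpace X]
    [BorelSpace X] [MetricSpace Y] [MeasurableSpace Y] [BorelSpace Y] {K : ℝ} (hK : 0 ≤ K)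
    {f : X → Y} {s : Set X}
    (hf : ∀ x ∈ s, ∀ y ∈ s, edist (f x) (f y) ≤ ENNReal.ofReal K * edist x y) (d : ℕ) :
    Measure.euclideanHausdorffMeasure d (f '' s) ≤
      ENNReal.ofReal (K ^ d) * Measure.euclideanHausdorffMeasure d s := by
  have h : LipschitzOnWith K.toNNReal f s := fun x hx y hy ↦ hf x hx y hy
  have := h.hausdorffMeasure_image_le (d := d) (by positivity)
  rw [Measure.euclideanHausdorffMeasure_def, Measure.euclideanHausdorffMeasure_def,
    Measure.smul_apply, Measure.smul_apply, ENNReal.smul_def, ENNReal.smul_def, smul_eq_mul,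
    smul_eq_mul, mul_left_comm]
  gcongr
  refine this.trans_eq ?_
  rw [ENNReal.rpow_natCast, ENNReal.ofReal_pow hK]
  rfl

end MeasureComparison

section VolumeInCharts

open scoped MatrixOrder Matrix.Norms.L2Operator in
lemma exists_eq_conjTranspose_mul_self {m : ℕ} {A : Matrix (Fin m) (Fin m) ℝ} (hA : A.PosDef) :
    ∃ B : Matrix (Fin m) (Fin m) ℝ, A = B.conjTranspose * B :=
  CStarAlgebra.nonneg_iff_eq_star_mul_self.1 hA.posSemidef.nonneg

variable {n : ℕ} {N : Type*} [MetricSpace N] [ChartedSpace (EuclideanSpace ℝ (Fin (n + 1))) N]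
  [Bundle.RiemannianBundle (fun x : N ↦ TangentSpace (𝓡 (n + 1)) x)]
  [IsManifold (𝓡 (n + 1)) ∞ N]
  {c : OpenPartialHomeomorph N (EuclideanSpace ℝ (Fin (n + 1)))}

/-- The metric at a point of a chart is Euclidean in suitable linear coordinates, and the density
is the Jacobian of this change of coordinates. -/
lemma exists_linearEquiv_chartMetric (hc : c ∈ IsManifold.maximalAtlas (𝓡 (n + 1)) ∞ N)
    {y : EuclideanSpace ℝ (Fin (n + 1))} (hy : y ∈ c.target) :
    ∃ L : EuclideanSpace ℝ (Fin (n + 1)) ≃L[ℝ] EuclideanSpace ℝ (Fin (n + 1)),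
      (∀ v, ‖L v‖ ^ 2 = chartMetric c y v v) ∧
      |(L : EuclideanSpace ℝ (Fin (n + 1)) →ₗ[ℝ] EuclideanSpace ℝ (Fin (n + 1))).det| =
        chartDensity c y := by
  obtain ⟨B, hB⟩ := exists_eq_conjTranspose_mul_self (posDef_chartMetric hc hy)
  have hBdet : B.det ≠ 0 := by
    have := (posDef_chartMetric hc hy).det_pos
    rw [hB, Matrix.det_mul, Matrix.det_conjTranspose] at this
    exact fun h ↦ by simp [h] at this
  set T := Matrix.toLin (EuclideanSpace.basisFun (Fin (n + 1)) ℝ).toBasis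
    (EuclideanSpace.basisFun (Fin (n + 1)) ℝ).toBasis B
  have hT : T.det = B.det := LinearMap.det_toLin _ _
  have hTu : IsUnit T.det := by rw [hT]; exact hBdet.isUnit
  set e := (LinearMap.equivOfIsUnitDet hTu).toContinuousLinearEquiv
  have heT : ∀ v, e v = T v := fun v ↦
    LinearMap.equivOfIsUnitDet_apply hTu v
  have hei : ∀ v i, e v i = ∑ j, B i j * v j := by
    intro v i
    rw [heT]
    have := congrArg (fun u ↦ u i) (Matrix.repr_toLin (EuclideanSpace.basisFun (Fin (n + 1))
      ℝ).toBasis (EuclideanSpace.basisFun (Fin (n + 1)) ℝ).toBasis B v)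
    simpa [Matrix.mulVec, dotProduct] using this
  refine ⟨e, fun v ↦ ?_, ?_⟩
  · rw [EuclideanSpace.real_norm_sq_eq, chartMetric_eq_sum]
    have hent : ∀ i j, chartMetric c y (EuclideanSpace.single i 1) (EuclideanSpace.single j 1)
        = ∑ k, B k i * B k j := by
      intro i j
      have := congrFun (congrFun hB i) j
      simpa [Matrix.mul_apply] using this
    simp_rw [hent, hei, sq, Finset.sum_mul_sum, Finset.mul_sum]
    rw [Finset.sum_comm]
    refine Finset.sum_congr rfl fun i _ ↦ ?_
    rw [Finset.sum_comm]
    refine Finset.sum_congr rfl fun j _ ↦ Finset.sum_congr rfl fun k _ ↦ ?_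
    ring
  · have h1 : (e : EuclideanSpace ℝ (Fin (n + 1)) →ₗ[ℝ] EuclideanSpace ℝ (Fin (n + 1))).det
        = B.det := by
      rw [← hT]
      exact congrArg _ (LinearMap.coe_equivOfIsUnitDet hTu)
    rw [h1, chartDensity_eq, hB, Matrix.det_mul, Matrix.det_conjTranspose]
    simp [Real.sqrt_mul_self_eq_abs]

variable [IsContMDiffRiemannianBundle (𝓡 (n + 1)) ∞ (EuclideanSpace ℝ (Fin (n + 1)))
      (fun x : N ↦ TangentSpace (𝓡 (n + 1)) x)]

lemma eventually_chartMetric_sub_le (hc : c ∈ IsManifold.maximalAtlas (𝓡 (n + 1)) ∞ N)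
    {y₀ : EuclideanSpace ℝ (Fin (n + 1))} (hy₀ : y₀ ∈ c.target) {ε : ℝ} (hε : 0 < ε) :
    ∀ᶠ y in 𝓝 y₀, ∀ v, |chartMetric c y v v - chartMetric c y₀ v v| ≤ ε * ‖v‖ ^ 2 := by
  set ε' := ε / ((n + 1) * (n + 1))
  have hε' : 0 < ε' := by positivity
  have h : ∀ i j : Fin (n + 1), ∀ᶠ y in 𝓝 y₀,
      |chartMetric c y (EuclideanSpace.single i 1) (EuclideanSpace.single j 1) -
        chartMetric c y₀ (EuclideanSpace.single i 1) (EuclideanSpace.single j 1)| < ε' := by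
    intro i j
    have hcont := ((contDiffOn_chartMetric hc (EuclideanSpace.single i 1)
      (EuclideanSpace.single j 1)).continuousOn.continuousAt (c.open_target.mem_nhds hy₀))
    have := Metric.tendsto_nhds.1 hcont ε' hε'
    simpa [Real.dist_eq] using this
  have h' := eventually_all.2 fun i ↦ eventually_all.2 (h i)
  filter_upwards [h'] with y hy v
  rw [chartMetric_eq_sum y, chartMetric_eq_sum y₀, ← Finset.sum_sub_distrib]
  simp_rw [← Finset.sum_sub_distrib, ← mul_sub]
  have hv : ∀ i, |v i| ≤ ‖v‖ := fun i ↦ by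
    simpa using PiLp.norm_apply_le v i
  calc |∑ i, ∑ j, v i * v j * (chartMetric c y (EuclideanSpace.single i 1)
          (EuclideanSpace.single j 1) - chartMetric c y₀ (EuclideanSpace.single i 1)
          (EuclideanSpace.single j 1))|
      ≤ ∑ i : Fin (n + 1), ∑ j : Fin (n + 1), ‖v‖ * ‖v‖ * ε' := by
        refine (Finset.abs_sum_le_sum_abs _ _).trans (Finset.sum_le_sum fun i _ ↦ ?_)
        refine (Finset.abs_sum_le_sum_abs _ _).trans (Finset.sum_le_sum fun j _ ↦ ?_)
        rw [abs_mul, abs_mul]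
        gcongr
        · exact hv i
        · exact hv j
        · exact (hy i j).le
    _ = ε * ‖v‖ ^ 2 := by
        simp [ε']
        field_simp

variable [IsRiemannianManifold (𝓡 (n + 1)) N] [MeasurableSpace N] [BorelSpace N]

/-- Near each point of a chart the volume of the image of a set is, up to a factor close to `1`,
the integral of the density: the chart followed by a linear map is almost an isometry, and the
Hausdorff measure is distorted accordingly. -/
lemma exists_vol_image_le (hc : c ∈ IsManifold.maximalAtlas (𝓡 (n + 1)) ∞ N)
    {y₀ : EuclideanSpace ℝ (Fin (n + 1))} (hy₀ : y₀ ∈ c.target) {K : ℝ} (hK : 1 < K) :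
    ∃ V ∈ 𝓝 y₀, V ⊆ c.target ∧ ∀ A ⊆ V, MeasurableSet A →
      vol n N (c.symm '' A) ≤
        ENNReal.ofReal (K ^ (n + 2)) * ∫⁻ y in A, ENNReal.ofReal (chartDensity c y) ∧
      ∫⁻ y in A, ENNReal.ofReal (chartDensity c y) ≤
        ENNReal.ofReal (K ^ (n + 2)) * vol n N (c.symm '' A) := by
  have hK0 : 0 < K := zero_lt_one.trans hK
  obtain ⟨L, hL, hdet⟩ := exists_linearEquiv_chartMetric hc hy₀
  -- lower and upper bounds for `L`
  obtain ⟨m, hm0, hm⟩ : ∃ m : ℝ, 0 < m ∧ ∀ v, m * ‖v‖ ≤ ‖L v‖ := by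
    set k := ‖(L.symm : EuclideanSpace ℝ (Fin (n + 1)) →L[ℝ] EuclideanSpace ℝ (Fin (n + 1)))‖
    have hk : 0 < k + 1 := by positivity
    refine ⟨(k + 1)⁻¹, inv_pos.2 hk, fun v ↦ ?_⟩
    rw [inv_mul_le_iff₀ hk]
    have h1 : ‖v‖ ≤ k * ‖L v‖ := by
      simpa using (L.symm : EuclideanSpace ℝ (Fin (n + 1)) →L[ℝ]
        EuclideanSpace ℝ (Fin (n + 1))).le_opNorm (L v)
    nlinarith [norm_nonneg (L v)]
  set M := ‖(L : EuclideanSpace ℝ (Fin (n + 1)) →L[ℝ] EuclideanSpace ℝ (Fin (n + 1)))‖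
  have hM : ∀ v, ‖L v‖ ≤ M * ‖v‖ := fun v ↦
    (L : EuclideanSpace ℝ (Fin (n + 1)) →L[ℝ] EuclideanSpace ℝ (Fin (n + 1))).le_opNorm v
  have hM0 : 0 ≤ M := norm_nonneg _
  -- the metric varies by a factor at most `K`
  have hKi : K⁻¹ < 1 := inv_lt_one_of_one_lt₀ hK
  have hKi0 : 0 < K⁻¹ := inv_pos.2 hK0
  set ε := m ^ 2 * (1 - K⁻¹ ^ 2)
  have hε : 0 < ε := by
    have : K⁻¹ ^ 2 < 1 := pow_lt_one₀ hKi0.le hKi two_ne_zero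
    have : 0 < 1 - K⁻¹ ^ 2 := by linarith
    positivity
  have hεK : 1 - K⁻¹ ^ 2 ≤ K ^ 2 - 1 := by
    have h1 : K⁻¹ ^ 2 * K ^ 2 = 1 := by field_simp
    nlinarith [sq_nonneg (K - K⁻¹), mul_inv_cancel₀ hK0.ne']
  have hmet : ∀ᶠ y in 𝓝 y₀, ∀ v, ‖chartFrame c y v‖ ≤ K * ‖L v‖ ∧
      ‖L v‖ ≤ K * ‖chartFrame c y v‖ := by
    filter_upwards [eventually_chartMetric_sub_le hc hy₀ hε] with y hy v
    have h1 := hy v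
    rw [← hL, chartMetric_self, abs_le] at h1
    have h2 : ε * ‖v‖ ^ 2 ≤ (1 - K⁻¹ ^ 2) * ‖L v‖ ^ 2 := by
      have : (m * ‖v‖) ^ 2 ≤ ‖L v‖ ^ 2 := by
        gcongr
        exact hm v
      have h3 : 0 ≤ 1 - K⁻¹ ^ 2 := by
        have : K⁻¹ ^ 2 < 1 := pow_lt_one₀ hKi0.le hKi two_ne_zero
        linarith
      calc ε * ‖v‖ ^ 2 = (1 - K⁻¹ ^ 2) * (m * ‖v‖) ^ 2 := by simp only [ε]; ring
        _ ≤ _ := by gcongr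
    constructor
    · refine le_of_sq_le_sq ?_ (by positivity)
      rw [mul_pow]
      nlinarith [sq_nonneg ‖L v‖]
    · have : (K⁻¹ * ‖L v‖) ≤ ‖chartFrame c y v‖ := by
        refine le_of_sq_le_sq ?_ (by positivity)
        rw [mul_pow]
        nlinarith
      rwa [inv_mul_le_iff₀ hK0] at this
  have hden : ∀ᶠ y in 𝓝 y₀, chartDensity c y ≤ K * chartDensity c y₀ ∧
      chartDensity c y₀ ≤ K * chartDensity c y := by
    have hρ := chartDensity_pos hc hy₀
    have hcont := (contDiffOn_chartDensity hc).continuousOn.continuousAt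
      (c.open_target.mem_nhds hy₀)
    have h1 := hcont.eventually (gt_mem_nhds (show chartDensity c y₀ < K * chartDensity c y₀ by
      nlinarith))
    have h2 := hcont.eventually (lt_mem_nhds (show K⁻¹ * chartDensity c y₀ < chartDensity c y₀ by
      nlinarith))
    filter_upwards [h1, h2] with y hy1 hy2
    exact ⟨hy1.le, (inv_mul_le_iff₀ hK0).1 hy2.le⟩
  obtain ⟨R, hR0, hR⟩ := Metric.nhds_basis_closedBall.mem_iff.1
    (inter_mem (inter_mem hmet hden) (c.open_target.mem_nhds hy₀))
  -- a ball so small that it is not worth leaving the ball of radius `R`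
  set r := R * (m / (2 * M + m))
  have hden0 : 0 < 2 * M + m := by positivity
  have hr0 : 0 < r := by positivity
  have hrR : r ≤ R := by
    have : m / (2 * M + m) ≤ 1 := (div_le_one hden0).2 (by linarith)
    calc r ≤ R * 1 := by simp only [r]; gcongr
      _ = R := mul_one R
  have hrr : M * (2 * r) ≤ m * (R - r) := by
    have : r * (2 * M + m) = R * m := by simp only [r]; field_simp
    linarith
  have hVR : Metric.ball y₀ r ⊆ Metric.closedBall y₀ R :=
    (Metric.ball_subset_ball hrR).trans Metric.ball_subset_closedBall
  have hVt : Metric.ball y₀ r ⊆ c.target := fun y hy ↦ (hR (hVR hy)).2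
  refine ⟨Metric.ball y₀ r, Metric.ball_mem_nhds _ hr0, hVt, fun A hA hAm ↦ ?_⟩
  have hup : ∀ y ∈ A, ∀ z ∈ A, edist (c.symm y) (c.symm z) ≤
      ENNReal.ofReal K * edist (L y) (L z) := fun y hy z hz ↦
    edist_symm_le hc (L := L) hVt (convex_ball _ _) (fun y hy v ↦ ((hR (hVR hy)).1.1 v).1)
      (hA hy) (hA hz)
  have hlow : ∀ y ∈ A, ∀ z ∈ A, edist (L y) (L z) ≤
      ENNReal.ofReal K * edist (c.symm y) (c.symm z) := by
    intro y hy z hz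
    have hyt := hVt (hA hy)
    have hzt := hVt (hA hz)
    have := edist_le_of_mem_ball hc (L := L) (fun y hy ↦ (hR hy).2)
      (fun y hy v ↦ ((hR hy).1.1 v).2) hm0.le hm hM hrR hrr hM0 (c.map_target hyt)
      (x' := c.symm z) (by rw [c.right_inv hyt]; exact hA hy) (by rw [c.right_inv hzt]; exact hA hz)
    rwa [c.right_inv hyt, c.right_inv hzt] at this
  have hHL : Measure.euclideanHausdorffMeasure (n + 1) (L '' A) =
      ENNReal.ofReal (chartDensity c y₀) * volume A := by
    rw [EuclideanSpace.euclideanHausdorffMeasure_eq_volume, ← hdet]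
    exact Measure.addHaar_image_continuousLinearEquiv _ _ _
  have h1 : vol n N (c.symm '' A) ≤
      ENNReal.ofReal (K ^ (n + 1)) * (ENNReal.ofReal (chartDensity c y₀) * volume A) := by
    have := euclideanHausdorffMeasure_image_le hK0.le (f := c.symm ∘ L.symm) (s := L '' A) (by
      rintro _ ⟨y, hy, rfl⟩ _ ⟨z, hz, rfl⟩
      simpa using hup y hy z hz) (n + 1)
    rw [hHL, ← image_comp] at this
    simp only [Function.comp_def, L.symm_apply_apply] at this
    exact this
  have h2 : ENNReal.ofReal (chartDensity c y₀) * volume A ≤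
      ENNReal.ofReal (K ^ (n + 1)) * vol n N (c.symm '' A) := by
    have := euclideanHausdorffMeasure_image_le hK0.le (f := L ∘ c) (s := c.symm '' A) (by
      rintro _ ⟨y, hy, rfl⟩ _ ⟨z, hz, rfl⟩
      have := hlow y hy z hz
      simp only [Function.comp]
      rwa [c.right_inv (hVt (hA hy)), c.right_inv (hVt (hA hz))]) (n + 1)
    rw [← image_comp] at this
    have himg : (L ∘ c) ∘ c.symm '' A = L '' A := by
      refine image_congr fun y hy ↦ ?_
      simp only [Function.comp]
      rw [c.right_inv (hVt (hA hy))]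
    rw [himg, hHL] at this
    exact this
  have h3 : ENNReal.ofReal (chartDensity c y₀) * volume A ≤
      ENNReal.ofReal K * ∫⁻ y in A, ENNReal.ofReal (chartDensity c y) := by
    rw [← setLIntegral_const, ← lintegral_const_mul' _ _ ENNReal.ofReal_ne_top]
    refine setLIntegral_mono' hAm fun y hy ↦ ?_
    rw [← ENNReal.ofReal_mul hK0.le]
    exact ENNReal.ofReal_le_ofReal (hR (hVR (hA hy))).1.2.2
  have h4 : ∫⁻ y in A, ENNReal.ofReal (chartDensity c y) ≤
      ENNReal.ofReal K * (ENNReal.ofReal (chartDensity c y₀) * volume A) := by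
    rw [← setLIntegral_const, ← lintegral_const_mul' _ _ ENNReal.ofReal_ne_top]
    refine setLIntegral_mono' hAm fun y hy ↦ ?_
    rw [← ENNReal.ofReal_mul hK0.le]
    exact ENNReal.ofReal_le_ofReal (hR (hVR (hA hy))).1.2.1
  have hKK : ENNReal.ofReal (K ^ (n + 2)) = ENNReal.ofReal (K ^ (n + 1)) * ENNReal.ofReal K := by
    rw [← ENNReal.ofReal_mul (by positivity), pow_succ]
  constructor
  · refine h1.trans ?_
    rw [hKK, mul_assoc]
    gcongr
  · refine h4.trans ?_
    rw [hKK, mul_comm _ (ENNReal.ofReal K), mul_assoc]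
    gcongr

/-- The volume in a chart: `dVol_g = √|g| dy`. -/
theorem vol_symm_image (hc : c ∈ IsManifold.maximalAtlas (𝓡 (n + 1)) ∞ N)
    {A : Set (EuclideanSpace ℝ (Fin (n + 1)))} (hA : MeasurableSet A) (hAt : A ⊆ c.target) :
    vol n N (c.symm '' A) = ∫⁻ y in A, ENNReal.ofReal (chartDensity c y) := by
  have himg : ∀ A : Set (EuclideanSpace ℝ (Fin (n + 1))), A ⊆ c.target →
      c.symm '' A = c.source ∩ c ⁻¹' A := fun A hA ↦ by
    rw [← c.symm_image_eq_source_inter_preimage hA]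
  have hae : AEMeasurable c ((vol n N).restrict c.source) :=
    c.continuousOn.aemeasurable c.open_source.measurableSet
  set ν₁ := ((vol n N).restrict c.source).map c
  set ν₂ := (volume : Measure (EuclideanSpace ℝ (Fin (n + 1)))).withDensity
    fun y ↦ ENNReal.ofReal (chartDensity c y)
  have hν₁ : ∀ A ⊆ c.target, MeasurableSet A → ν₁ A = vol n N (c.symm '' A) := by
    intro A hA hAm
    rw [Measure.map_apply_of_aemeasurable hae hAm, himg A hA, inter_comm]
    exact Measure.restrict_apply' c.open_source.measurableSet
  have hν₂ : ∀ A, MeasurableSet A → ν₂ A = ∫⁻ y in A, ENNReal.ofReal (chartDensity c y) :=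
    fun A hAm ↦ withDensity_apply _ hAm
  have key : ∀ K : ℝ, 1 < K → ν₁ A ≤ ENNReal.ofReal (K ^ (n + 2)) * ν₂ A ∧
      ν₂ A ≤ ENNReal.ofReal (K ^ (n + 2)) * ν₁ A := by
    intro K hK
    constructor
    · refine measure_le_of_local (ν := ENNReal.ofReal (K ^ (n + 2)) • ν₂) ?_ hA hAt
      intro y hy
      obtain ⟨V, hV, hVt, h⟩ := exists_vol_image_le hc hy hK
      refine ⟨V, mem_nhdsWithin_of_mem_nhds hV, fun B hB hBm ↦ ?_⟩
      rw [hν₁ B (hB.trans hVt) hBm, Measure.smul_apply, hν₂ B hBm]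
      exact (h B hB hBm).1
    · refine measure_le_of_local (ν := ENNReal.ofReal (K ^ (n + 2)) • ν₁) ?_ hA hAt
      intro y hy
      obtain ⟨V, hV, hVt, h⟩ := exists_vol_image_le hc hy hK
      refine ⟨V, mem_nhdsWithin_of_mem_nhds hV, fun B hB hBm ↦ ?_⟩
      rw [hν₂ B hBm, Measure.smul_apply, hν₁ B (hB.trans hVt) hBm]
      exact (h B hB hBm).2
  have hlim : ∀ b : ENNReal, Tendsto (fun K : ℝ ↦ ENNReal.ofReal (K ^ (n + 2)) * b) (𝓝[>] 1)
      (𝓝 b) := by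
    intro b
    have h1 : Tendsto (fun K : ℝ ↦ ENNReal.ofReal (K ^ (n + 2))) (𝓝[>] 1) (𝓝 1) := by
      have : Continuous fun K : ℝ ↦ ENNReal.ofReal (K ^ (n + 2)) :=
        ENNReal.continuous_ofReal.comp (continuous_pow _)
      simpa using (this.tendsto 1).mono_left nhdsWithin_le_nhds
    simpa using ENNReal.Tendsto.mul_const h1 (Or.inl one_ne_zero)
  rw [← hν₁ A hAt hA, ← hν₂ A hA]
  apply le_antisymm
  · refine ge_of_tendsto (hlim _) ?_
    filter_upwards [self_mem_nhdsWithin] with K hK using (key K hK).1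
  · refine ge_of_tendsto (hlim _) ?_
    filter_upwards [self_mem_nhdsWithin] with K hK using (key K hK).2

end VolumeInCharts

/-! ### The Euclidean divergence -/

section EuclideanDivergence

variable {d : ℕ}

/-- The Euclidean divergence `∑ i, ∂_i U^i`. -/
noncomputable def ediv (U : EuclideanSpace ℝ (Fin d) → EuclideanSpace ℝ (Fin d))
    (y : EuclideanSpace ℝ (Fin d)) : ℝ :=
  ∑ i, fderiv ℝ (fun z ↦ U z i) y (EuclideanSpace.single i 1)

variable {U V : EuclideanSpace ℝ (Fin d) → EuclideanSpace ℝ (Fin d)}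
  {y : EuclideanSpace ℝ (Fin d)}

lemma differentiableAt_coord (hU : DifferentiableAt ℝ U y) (i : Fin d) :
    DifferentiableAt ℝ (fun z ↦ U z i) y :=
  (EuclideanSpace.proj i : EuclideanSpace ℝ (Fin d) →L[ℝ] ℝ).differentiableAt.comp y hU

lemma ediv_congr (h : U =ᶠ[𝓝 y] V) : ediv U y = ediv V y := by
  refine Finset.sum_congr rfl fun i _ ↦ ?_
  have : (fun z ↦ U z i) =ᶠ[𝓝 y] fun z ↦ V z i := h.mono fun z hz ↦ congrArg (fun v ↦ v i) hz
  rw [this.fderiv_eq]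

lemma ediv_zero_of_eventuallyEq (h : U =ᶠ[𝓝 y] 0) : ediv U y = 0 := by
  rw [ediv_congr h]
  simp [ediv]

lemma ediv_add (hU : DifferentiableAt ℝ U y) (hV : DifferentiableAt ℝ V y) :
    ediv (fun z ↦ U z + V z) y = ediv U y + ediv V y := by
  unfold ediv
  rw [← Finset.sum_add_distrib]
  refine Finset.sum_congr rfl fun i _ ↦ ?_
  simp only [PiLp.add_apply]
  rw [fderiv_fun_add (differentiableAt_coord hU i) (differentiableAt_coord hV i)]
  rfl

lemma ediv_smul {u : EuclideanSpace ℝ (Fin d) → ℝ} (hu : DifferentiableAt ℝ u y)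
    (hU : DifferentiableAt ℝ U y) :
    ediv (fun z ↦ u z • U z) y = u y * ediv U y + fderiv ℝ u y (U y) := by
  have h : fderiv ℝ u y (U y) = ∑ i, U y i * fderiv ℝ u y (EuclideanSpace.single i 1) := by
    conv_lhs => rw [← (EuclideanSpace.basisFun (Fin d) ℝ).sum_repr (U y)]
    simp
  unfold ediv
  rw [h, Finset.mul_sum, ← Finset.sum_add_distrib]
  refine Finset.sum_congr rfl fun i _ ↦ ?_
  simp only [PiLp.smul_apply, smul_eq_mul]
  rw [fderiv_fun_mul hu (differentiableAt_coord hU i)]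
  simp

lemma ediv_const_smul (a : ℝ) (hU : DifferentiableAt ℝ U y) :
    ediv (fun z ↦ a • U z) y = a * ediv U y := by
  rw [ediv_smul (differentiableAt_const a) hU]
  simp

lemma contDiff_coord {k : WithTop ℕ∞} (hU : ContDiff ℝ k U) (i : Fin d) :
    ContDiff ℝ k fun z ↦ U z i :=
  (EuclideanSpace.proj i : EuclideanSpace ℝ (Fin d) →L[ℝ] ℝ).contDiff.comp hU

lemma continuous_ediv (hU : ContDiff ℝ 1 U) : Continuous (ediv U) := by
  refine continuous_finsetSum _ fun i _ ↦ ?_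
  exact ((contDiff_coord hU i).continuous_fderiv one_ne_zero).clm_apply continuous_const

lemma support_ediv_subset : Function.support (ediv U) ⊆ tsupport U := by
  intro y hy
  by_contra h
  exact hy (ediv_zero_of_eventuallyEq (notMem_tsupport_iff_eventuallyEq.1 h))

lemma hasCompactSupport_ediv (hU : HasCompactSupport U) : HasCompactSupport (ediv U) :=
  hU.of_isClosed_subset (isClosed_tsupport _)
    (closure_minimal support_ediv_subset (isClosed_tsupport _))

lemma integrable_ediv (hU : ContDiff ℝ 1 U) (hUc : HasCompactSupport U) :
    Integrable (ediv U) :=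
  (continuous_ediv hU).integrable_of_hasCompactSupport (hasCompactSupport_ediv hUc)

/-- The divergence theorem for compactly supported fields. -/
lemma integral_ediv_eq_zero (hU : ContDiff ℝ 1 U) (hUc : HasCompactSupport U) :
    ∫ y, ediv U y = 0 := by
  have hc : ∀ i, HasCompactSupport fun z ↦ U z i := fun i ↦
    hUc.comp_left (g := fun v : EuclideanSpace ℝ (Fin d) ↦ v i) rfl
  have hint : ∀ i, Integrable fun y ↦ fderiv ℝ (fun z ↦ U z i) y (EuclideanSpace.single i 1) :=
    fun i ↦ (((contDiff_coord hU i).continuous_fderiv one_ne_zero).clm_apply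
      continuous_const).integrable_of_hasCompactSupport ((hc i).fderiv_apply (𝕜 := ℝ) _)
  unfold ediv
  rw [integral_finsetSum _ fun i _ ↦ hint i]
  refine Finset.sum_eq_zero fun i _ ↦ ?_
  have := integral_mul_fderiv_eq_neg_fderiv_mul_of_integrable (μ := volume)
    (f := fun _ : EuclideanSpace ℝ (Fin d) ↦ (1 : ℝ)) (g := fun z ↦ U z i)
    (v := EuclideanSpace.single i 1) (by simp) (by simpa using hint i)
    (by simpa using (contDiff_coord hU i).continuous.integrable_of_hasCompactSupport (hc i))
    (fun x _ ↦ differentiableAt_const _)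
    (fun x _ ↦ (contDiff_coord hU i).differentiable one_ne_zero x)
  simpa using this

/-- Integration by parts. -/
lemma integral_mul_ediv {u : EuclideanSpace ℝ (Fin d) → ℝ} (hu : ContDiff ℝ 1 u)
    (hU : ContDiff ℝ 1 U) (hUc : HasCompactSupport U) :
    ∫ y, u y * ediv U y = -∫ y, fderiv ℝ u y (U y) := by
  have h1 : ∀ y, ediv (fun z ↦ u z • U z) y = u y * ediv U y + fderiv ℝ u y (U y) := fun y ↦
    ediv_smul (hu.differentiable one_ne_zero y) (hU.differentiable one_ne_zero y)
  have h2 := integral_ediv_eq_zero (hu.smul hU) hUc.smul_left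
  simp only [Pi.smul_def', h1] at h2
  have hi1 : Integrable fun y ↦ u y * ediv U y :=
    (hu.continuous.mul (continuous_ediv hU)).integrable_of_hasCompactSupport
      (hasCompactSupport_ediv hUc).mul_left
  have hi2 : Integrable fun y ↦ fderiv ℝ u y (U y) :=
    ((hu.continuous_fderiv one_ne_zero).clm_apply hU.continuous).integrable_of_hasCompactSupport
      (hUc.mono fun y hy h ↦ hy (by simp [h]))
  rw [integral_add hi1 hi2] at h2
  linarith

end EuclideanDivergence

/-! ### Integrals and divergence in a chart -/

section IntegrationInCharts

variable {n : ℕ} {N : Type*} [MetricSpace N] [ChartedSpace (EuclideanSpace ℝ (Fin (n + 1))) N]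
  [Bundle.RiemannianBundle (fun x : N ↦ TangentSpace (𝓡 (n + 1)) x)]
  [IsManifold (𝓡 (n + 1)) ∞ N]
  [IsContMDiffRiemannianBundle (𝓡 (n + 1)) ∞ (EuclideanSpace ℝ (Fin (n + 1)))
      (fun x : N ↦ TangentSpace (𝓡 (n + 1)) x)]
  [IsRiemannianManifold (𝓡 (n + 1)) N] [MeasurableSpace N] [BorelSpace N]
  {c : OpenPartialHomeomorph N (EuclideanSpace ℝ (Fin (n + 1)))}

lemma measurableSet_target_inter_preimage_symm {S : Set N} (hS : MeasurableSet S) :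
    MeasurableSet (c.target ∩ c.symm ⁻¹' S) := by
  have h : Measurable (c.target.domRestrict c.symm) := c.continuousOn_symm.domRestrict.measurable
  have := c.open_target.measurableSet.subtype_image (h hS)
  convert this using 1
  ext y
  constructor
  · exact fun hy ↦ ⟨⟨y, hy.1⟩, hy.2, rfl⟩
  · rintro ⟨z, hz, rfl⟩
    exact ⟨z.2, hz⟩

/-- The volume of the domain of a chart is the image of the measure `√|g| dy`. -/
lemma map_symm_withDensity (hc : c ∈ IsManifold.maximalAtlas (𝓡 (n + 1)) ∞ N) :
    (((volume : Measure (EuclideanSpace ℝ (Fin (n + 1)))).restrict c.target).withDensity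
      fun y ↦ ENNReal.ofReal (chartDensity c y)).map c.symm = (vol n N).restrict c.source := by
  have hae : AEMeasurable c.symm (((volume :
      Measure (EuclideanSpace ℝ (Fin (n + 1)))).restrict c.target).withDensity
      fun y ↦ ENNReal.ofReal (chartDensity c y)) :=
    (c.continuousOn_symm.aemeasurable c.open_target.measurableSet).mono_ac
      (withDensity_absolutelyContinuous _ _)
  ext S hS
  rw [Measure.map_apply_of_aemeasurable hae hS, Measure.restrict_apply hS,
    ← restrict_withDensity c.open_target.measurableSet,
    Measure.restrict_apply' c.open_target.measurableSet, inter_comm _ c.target,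
    withDensity_apply _ (measurableSet_target_inter_preimage_symm hS),
    ← vol_symm_image hc (measurableSet_target_inter_preimage_symm hS) inter_subset_left,
    inter_comm S c.source]
  congr 1
  ext x
  constructor
  · rintro ⟨y, ⟨hy, hyS⟩, rfl⟩
    exact ⟨c.map_target hy, hyS⟩
  · rintro ⟨h1, h2⟩
    exact ⟨c x, ⟨c.map_source h1, by simpa [c.left_inv h1] using h2⟩, c.left_inv h1⟩

/-- Integrals over the domain of a chart, read in the chart. -/
lemma setIntegral_source (hc : c ∈ IsManifold.maximalAtlas (𝓡 (n + 1)) ∞ N) {h : N → ℝ}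
    (hh : AEStronglyMeasurable h ((vol n N).restrict c.source)) :
    ∫ x in c.source, h x ∂(vol n N) = ∫ y in c.target, chartDensity c y * h (c.symm y) := by
  have hae : AEMeasurable c.symm (((volume :
      Measure (EuclideanSpace ℝ (Fin (n + 1)))).restrict c.target).withDensity
      fun y ↦ ENNReal.ofReal (chartDensity c y)) :=
    (c.continuousOn_symm.aemeasurable c.open_target.measurableSet).mono_ac
      (withDensity_absolutelyContinuous _ _)
  have hρ : AEMeasurable (fun y ↦ (chartDensity c y).toNNReal)
      ((volume : Measure (EuclideanSpace ℝ (Fin (n + 1)))).restrict c.target) :=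
    ((contDiffOn_chartDensity hc).continuousOn.aemeasurable
      c.open_target.measurableSet).real_toNNReal
  rw [← map_symm_withDensity hc] at hh ⊢
  rw [integral_map hae hh]
  have := integral_withDensity_eq_integral_smul₀ hρ fun y ↦ h (c.symm y)
  refine this.trans ?_
  refine setIntegral_congr_fun c.open_target.measurableSet fun y hy ↦ ?_
  simp only [NNReal.smul_def, smul_eq_mul]
  rw [Real.coe_toNNReal _ (chartDensity_pos hc hy).le]

lemma exists_mem_nhds_vol_lt_top (x : N) : ∃ V ∈ 𝓝 x, vol n N V < ⊤ := by
  set c := chartAt (EuclideanSpace ℝ (Fin (n + 1))) x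
  have hc : c ∈ IsManifold.maximalAtlas (𝓡 (n + 1)) ∞ N := IsManifold.chart_mem_maximalAtlas x
  have hx : x ∈ c.source := mem_chart_source _ x
  obtain ⟨r, hr, hrt⟩ := Metric.nhds_basis_closedBall.mem_iff.1
    (c.open_target.mem_nhds (c.map_source hx))
  refine ⟨c.symm '' Metric.closedBall (c x) r, ?_, ?_⟩
  · have := c.symm.image_mem_nhds (c.map_source hx) (Metric.closedBall_mem_nhds (c x) hr)
    rwa [c.left_inv hx] at this
  · rw [vol_symm_image hc measurableSet_closedBall hrt]
    have hcont := (contDiffOn_chartDensity hc).continuousOn.mono hrt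
    exact (hcont.integrableOn_compact (isCompact_closedBall _ _)).lintegral_lt_top

instance isFiniteMeasure_vol [CompactSpace N] : IsFiniteMeasure (vol n N) := by
  constructor
  refine isCompact_univ.measure_lt_top_of_nhdsWithin fun x _ ↦ ?_
  obtain ⟨V, hV, h⟩ := exists_mem_nhds_vol_lt_top (n := n) x
  exact ⟨V, mem_nhdsWithin_of_mem_nhds hV, h⟩

lemma volume_eq_zero_of_vol_symm_image (hc : c ∈ IsManifold.maximalAtlas (𝓡 (n + 1)) ∞ N)
    {A : Set (EuclideanSpace ℝ (Fin (n + 1)))} (hA : MeasurableSet A) (hAt : A ⊆ c.target)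
    (h : vol n N (c.symm '' A) = 0) : volume A = 0 := by
  rw [vol_symm_image hc hA hAt, setLIntegral_eq_zero_iff' hA
    (((contDiffOn_chartDensity hc).continuousOn.mono hAt).aemeasurable hA).ennreal_ofReal] at h
  refine measure_mono_null (fun y hy ↦ ?_) (ae_iff.1 h)
  simp only [mem_ofPred_eq, Classical.not_imp, ENNReal.ofReal_eq_zero, not_le]
  exact ⟨hy, chartDensity_pos hc (hAt hy)⟩

lemma volume_target_inter_preimage_eq_zero (hc : c ∈ IsManifold.maximalAtlas (𝓡 (n + 1)) ∞ N)
    {Z : Set N} (hZ : vol n N Z = 0) : volume (c.target ∩ c.symm ⁻¹' Z) = 0 := by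
  refine measure_mono_null (t := c.target ∩ c.symm ⁻¹' toMeasurable (vol n N) Z)
    (inter_subset_inter_right _ (preimage_mono (subset_toMeasurable _ _))) ?_
  refine volume_eq_zero_of_vol_symm_image hc
    (measurableSet_target_inter_preimage_symm (measurableSet_toMeasurable _ _))
    inter_subset_left (measure_mono_null (t := toMeasurable (vol n N) Z) ?_ ?_)
  · rintro _ ⟨y, hy, rfl⟩
    exact hy.2
  · rwa [measure_toMeasurable]

lemma nullMeasurableSet_target_inter_preimage
    (hc : c ∈ IsManifold.maximalAtlas (𝓡 (n + 1)) ∞ N)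
    {A : Set N} (hA : NullMeasurableSet A (vol n N)) :
    NullMeasurableSet (c.target ∩ c.symm ⁻¹' A) volume := by
  obtain ⟨B, hB, hAB⟩ := hA
  refine ⟨_, measurableSet_target_inter_preimage_symm (c := c) hB, ?_⟩
  have h := volume_target_inter_preimage_eq_zero hc (measure_symmDiff_eq_zero_iff.2 hAB)
  rw [← measure_symmDiff_eq_zero_iff]
  refine measure_mono_null ?_ h
  rintro y (⟨⟨h1, h2⟩, h3⟩ | ⟨⟨h1, h2⟩, h3⟩)
  · exact ⟨h1, Or.inl ⟨h2, fun h ↦ h3 ⟨h1, h⟩⟩⟩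
  · exact ⟨h1, Or.inr ⟨h2, fun h ↦ h3 ⟨h1, h⟩⟩⟩

lemma vol_pos_of_isOpen {U : Set N} (hU : IsOpen U) (hne : U.Nonempty) : 0 < vol n N U := by
  obtain ⟨x, hx⟩ := hne
  set c := chartAt (EuclideanSpace ℝ (Fin (n + 1))) x
  have hc : c ∈ IsManifold.maximalAtlas (𝓡 (n + 1)) ∞ N := IsManifold.chart_mem_maximalAtlas x
  have hxs : x ∈ c.source := mem_chart_source _ x
  have hA : IsOpen (c.target ∩ c.symm ⁻¹' U) := c.symm.isOpen_inter_preimage hU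
  have hxA : c x ∈ c.target ∩ c.symm ⁻¹' U :=
    ⟨c.map_source hxs, by simpa [c.left_inv hxs] using hx⟩
  rw [pos_iff_ne_zero]
  exact fun h ↦ (hA.measure_pos volume ⟨_, hxA⟩).ne' (volume_target_inter_preimage_eq_zero hc h)

instance isOpenPosMeasure_vol : (vol n N).IsOpenPosMeasure :=
  ⟨fun _ hU hne ↦ (vol_pos_of_isOpen hU hne).ne'⟩

end IntegrationInCharts

section DivergenceInCharts

/-- Extension by zero of a smooth map on an open set which vanishes off a compact subset. -/
lemma contDiff_indicator {E G : Type*} [NormedAddCommGroup E] [NormedSpace ℝ E]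
    [NormedAddCommGroup G] [NormedSpace ℝ G] {T K : Set E} (hT : IsOpen T) (hK : IsCompact K)
    (hKT : K ⊆ T) {W : E → G} (hW : ContDiffOn ℝ ∞ W T) (hWK : ∀ y ∈ T, y ∉ K → W y = 0) :
    ContDiff ℝ ∞ (T.indicator W) ∧ HasCompactSupport (T.indicator W) := by
  have h0 : ∀ y ∉ K, T.indicator W y = 0 := by
    intro y hy
    by_cases hyT : y ∈ T
    · rw [indicator_of_mem hyT, hWK y hyT hy]
    · exact indicator_of_notMem hyT _
  refine ⟨contDiff_iff_contDiffAt.2 fun y ↦ ?_, HasCompactSupport.intro hK h0⟩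
  by_cases hy : y ∈ T
  · refine (hW.contDiffAt (hT.mem_nhds hy)).congr_of_eventuallyEq ?_
    filter_upwards [hT.mem_nhds hy] with z hz using indicator_of_mem hz _
  · refine (contDiffAt_const (c := (0 : G))).congr_of_eventuallyEq ?_
    filter_upwards [hK.isClosed.isOpen_compl.mem_nhds fun h ↦ hy (hKT h)] with z hz
    exact h0 z hz

variable {n : ℕ} {N : Type*} [MetricSpace N] [ChartedSpace (EuclideanSpace ℝ (Fin (n + 1))) N]
  {c : OpenPartialHomeomorph N (EuclideanSpace ℝ (Fin (n + 1)))}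
  {X Y : ∀ x : N, TangentSpace (𝓡 (n + 1)) x}

lemma chartField_eq (y : EuclideanSpace ℝ (Fin (n + 1))) :
    chartField c X y = chartCoframe c (c.symm y) (X (c.symm y)) :=
  rfl

lemma chartField_add (y : EuclideanSpace ℝ (Fin (n + 1))) :
    chartField c (fun x ↦ X x + Y x) y = chartField c X y + chartField c Y y := by
  rw [chartField_eq, chartField_eq, chartField_eq, map_add]

lemma chartFrame_chartField [IsManifold (𝓡 (n + 1)) ∞ N]
    (hc : c ∈ IsManifold.maximalAtlas (𝓡 (n + 1)) ∞ N)
    {y : EuclideanSpace ℝ (Fin (n + 1))} (hy : y ∈ c.target) :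
    chartFrame c y (chartField c X y) = X (c.symm y) :=
  chartFrame_chartCoframe hc hy _

lemma contDiffOn_chartField [IsManifold (𝓡 (n + 1)) ∞ N]
    (hc : c ∈ IsManifold.maximalAtlas (𝓡 (n + 1)) ∞ N)
    (hX : ContMDiff (𝓡 (n + 1)) (𝓡 (n + 1)).tangent ∞
      (fun x ↦ (⟨x, X x⟩ : TangentBundle (𝓡 (n + 1)) N))) :
    ContDiffOn ℝ ∞ (chartField c X) c.target := by
  have h1 := (contMDiffOn_of_mem_maximalAtlas hc).contMDiffOn_tangentMapWithin
    (m := ∞) (by simp) c.open_source.uniqueMDiffOn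
  have h2 : ContMDiffOn (𝓡 (n + 1)) (𝓡 (n + 1)).tangent ∞
      (fun y ↦ (⟨c.symm y, X (c.symm y)⟩ : TangentBundle (𝓡 (n + 1)) N)) c.target :=
    hX.comp_contMDiffOn (contMDiffOn_symm_of_mem_maximalAtlas hc)
  refine contMDiffOn_vectorSpace_iff_contDiffOn.1
    ((h1.comp h2 fun y hy ↦ c.map_target hy).congr fun y hy ↦ ?_)
  simp only [tangentMapWithin, Function.comp]
  rw [mfderivWithin_of_isOpen c.open_source (c.map_target hy), c.right_inv hy]
  rfl

variable [Bundle.RiemannianBundle (fun x : N ↦ TangentSpace (𝓡 (n + 1)) x)]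

/-- The Riemannian divergence computed in the chart `c`. -/
noncomputable def chartDivergence (c : OpenPartialHomeomorph N (EuclideanSpace ℝ (Fin (n + 1))))
    (X : ∀ x : N, TangentSpace (𝓡 (n + 1)) x) (y : EuclideanSpace ℝ (Fin (n + 1))) : ℝ :=
  (chartDensity c y)⁻¹ * ediv (fun z ↦ chartDensity c z • chartField c X z) y

lemma divergence_eq_chartDivergence (x : N) :
    divergence X x = chartDivergence (chartAt (EuclideanSpace ℝ (Fin (n + 1))) x) X
      (chartAt (EuclideanSpace ℝ (Fin (n + 1))) x x) :=
  rfl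

variable [IsManifold (𝓡 (n + 1)) ∞ N]
  [IsContMDiffRiemannianBundle (𝓡 (n + 1)) ∞ (EuclideanSpace ℝ (Fin (n + 1)))
      (fun x : N ↦ TangentSpace (𝓡 (n + 1)) x)]

lemma contDiffOn_density_smul_chartField (hc : c ∈ IsManifold.maximalAtlas (𝓡 (n + 1)) ∞ N)
    (hX : ContMDiff (𝓡 (n + 1)) (𝓡 (n + 1)).tangent ∞
      (fun x ↦ (⟨x, X x⟩ : TangentBundle (𝓡 (n + 1)) N))) :
    ContDiffOn ℝ ∞ (fun z ↦ chartDensity c z • chartField c X z) c.target :=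
  (contDiffOn_chartDensity hc).smul (contDiffOn_chartField hc hX)

lemma continuousOn_ediv {d : ℕ} {U : EuclideanSpace ℝ (Fin d) → EuclideanSpace ℝ (Fin d)}
    {T : Set (EuclideanSpace ℝ (Fin d))} (hT : IsOpen T) (hU : ContDiffOn ℝ ∞ U T) :
    ContinuousOn (ediv U) T := by
  refine continuousOn_finsetSum _ fun i _ ↦ ?_
  have : ContDiffOn ℝ ∞ (fun z ↦ U z i) T :=
    (EuclideanSpace.proj i : EuclideanSpace ℝ (Fin d) →L[ℝ] ℝ).contDiff.comp_contDiffOn hU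
  exact (this.continuousOn_fderiv_of_isOpen hT (by simp)).clm_apply continuousOn_const

lemma continuousOn_chartDivergence (hc : c ∈ IsManifold.maximalAtlas (𝓡 (n + 1)) ∞ N)
    (hX : ContMDiff (𝓡 (n + 1)) (𝓡 (n + 1)).tangent ∞
      (fun x ↦ (⟨x, X x⟩ : TangentBundle (𝓡 (n + 1)) N))) :
    ContinuousOn (chartDivergence c X) c.target :=
  ((contDiffOn_chartDensity hc).continuousOn.inv₀ fun _ hy ↦ (chartDensity_pos hc hy).ne').mul
    (continuousOn_ediv c.open_target (contDiffOn_density_smul_chartField hc hX))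

/-- The derivative `X u` of the function `u` along the vector field `X`. -/
noncomputable def fieldDeriv (u : N → ℝ) (X : ∀ x : N, TangentSpace (𝓡 (n + 1)) x) (x : N) : ℝ :=
  mfderiv (𝓡 (n + 1)) 𝓘(ℝ, ℝ) u x (X x)

lemma fderiv_comp_symm (hc : c ∈ IsManifold.maximalAtlas (𝓡 (n + 1)) ∞ N) {u : N → ℝ}
    {y : EuclideanSpace ℝ (Fin (n + 1))} (hy : y ∈ c.target)
    (hu : MDifferentiableAt (𝓡 (n + 1)) 𝓘(ℝ, ℝ) u (c.symm y))
    : fderiv ℝ (u ∘ c.symm) y (chartField c X y) = fieldDeriv u X (c.symm y) := by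
  have h := mfderiv_comp y hu
    ((mdifferentiable_of_mem_maximalAtlas hc).mdifferentiableAt_symm hy)
  rw [mfderiv_eq_fderiv] at h
  have h2 : fderiv ℝ (u ∘ c.symm) y (chartField c X y) =
      mfderiv (𝓡 (n + 1)) 𝓘(ℝ, ℝ) u (c.symm y) (chartFrame c y (chartField c X y)) :=
    congrArg (fun A ↦ A (chartField c X y)) h
  rw [h2, chartFrame_chartField hc hy]
  rfl

variable [IsRiemannianManifold (𝓡 (n + 1)) N] [MeasurableSpace N] [BorelSpace N]

/-- Integration by parts against a test function supported in the domain of a chart. The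
right-hand side does not involve the chart. -/
lemma integral_mul_chartDivergence (hc : c ∈ IsManifold.maximalAtlas (𝓡 (n + 1)) ∞ N)
    (hX : ContMDiff (𝓡 (n + 1)) (𝓡 (n + 1)).tangent ∞
      (fun x ↦ (⟨x, X x⟩ : TangentBundle (𝓡 (n + 1)) N)))
    {u : N → ℝ} (hu : ContMDiff (𝓡 (n + 1)) 𝓘(ℝ, ℝ) ∞ u) (huc : HasCompactSupport u)
    (hus : tsupport u ⊆ c.source) :
    ∫ x, u x * chartDivergence c X (c x) ∂(vol n N) =
      -∫ x, fieldDeriv u X x ∂(vol n N) := by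
  set T := c.target
  set K : Set (EuclideanSpace ℝ (Fin (n + 1))) := c '' tsupport u
  have hK : IsCompact K := huc.image_of_continuousOn (c.continuousOn.mono hus)
  have hKT : K ⊆ T := by rintro _ ⟨x, hx, rfl⟩; exact c.map_source (hus hx)
  have hKu : ∀ y ∈ T, y ∉ K → c.symm y ∉ tsupport u := fun y hy hyK h ↦
    hyK ⟨_, h, c.right_inv hy⟩
  have huc' : ContDiffOn ℝ ∞ (u ∘ c.symm) T :=
    (hu.comp_contMDiffOn (contMDiffOn_symm_of_mem_maximalAtlas hc)).contDiffOn
  set U : EuclideanSpace ℝ (Fin (n + 1)) → EuclideanSpace ℝ (Fin (n + 1)) :=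
    fun z ↦ chartDensity c z • chartField c X z
  have hU : ContDiffOn ℝ ∞ U T := contDiffOn_density_smul_chartField hc hX
  have hdu : ∀ y ∈ T, fderiv ℝ (u ∘ c.symm) y (U y) =
      chartDensity c y * fieldDeriv u X (c.symm y) := by
    intro y hy
    simp only [U]
    rw [map_smul, fderiv_comp_symm hc hy (hu.mdifferentiable (by simp) _), smul_eq_mul]
  -- the field `u U`, extended by zero
  obtain ⟨hW, hWc⟩ := contDiff_indicator c.open_target hK hKT (huc'.smul hU) (by
    intro y hy hyK
    simp [image_eq_zero_of_notMem_tsupport (hKu y hy hyK)])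
  have hWdiv := integral_ediv_eq_zero (hW.of_le (by simp)) hWc
  have hediv : ∀ y ∈ T, ediv (T.indicator ((u ∘ c.symm) • U)) y =
      (u ∘ c.symm) y * ediv U y + fderiv ℝ (u ∘ c.symm) y (U y) := by
    intro y hy
    have : T.indicator ((u ∘ c.symm) • U) =ᶠ[𝓝 y] fun z ↦ (u ∘ c.symm) z • U z := by
      filter_upwards [c.open_target.mem_nhds hy] with z hz using indicator_of_mem hz _
    rw [ediv_congr this]
    exact ediv_smul ((huc'.differentiableOn (by simp)).differentiableAt
      (c.open_target.mem_nhds hy)) ((hU.differentiableOn (by simp)).differentiableAt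
      (c.open_target.mem_nhds hy))
  have hint : ∀ h : EuclideanSpace ℝ (Fin (n + 1)) → ℝ, ContinuousOn h T →
      (∀ y ∈ T, y ∉ K → h y = 0) → IntegrableOn h T := by
    intro h hh h0
    refine ((hh.mono hKT).integrableOn_compact hK).of_forall_sdiff_eq_zero
      c.open_target.measurableSet fun y hy ↦ h0 y hy.1 hy.2
  have hsrc : ∀ x, x ∉ c.source → x ∉ tsupport u := fun x hx h ↦ hx (hus h)
  have hmf : ∀ x ∉ tsupport u, fieldDeriv u X x = 0 := by
    intro x hx
    have : u =ᶠ[𝓝 x] fun _ ↦ (0 : ℝ) := notMem_tsupport_iff_eventuallyEq.1 hx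
    unfold fieldDeriv
    rw [this.mfderiv_eq, mfderiv_const]
    rfl
  have hcont2 : ContinuousOn (fun y ↦ fderiv ℝ (u ∘ c.symm) y (U y)) T :=
    (huc'.continuousOn_fderiv_of_isOpen c.open_target (by simp)).clm_apply hU.continuousOn
  have hcont1 : ContinuousOn (fun y ↦ (u ∘ c.symm) y * ediv U y) T :=
    huc'.continuousOn.mul (continuousOn_ediv c.open_target hU)
  have e1 : ∫ x, u x * chartDivergence c X (c x) ∂(vol n N) =
      ∫ y in T, (u ∘ c.symm) y * ediv U y := by
    rw [← setIntegral_eq_integral_of_forall_compl_eq_zero (s := c.source) (by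
      intro x hx
      rw [image_eq_zero_of_notMem_tsupport (hsrc x hx), zero_mul]),
      setIntegral_source hc]
    · refine setIntegral_congr_fun c.open_target.measurableSet fun y hy ↦ ?_
      simp only [chartDivergence, c.right_inv hy, Function.comp]
      have := (chartDensity_pos hc hy).ne'
      field_simp
      rfl
    · refine ContinuousOn.aestronglyMeasurable ?_ c.open_source.measurableSet
      exact hu.continuous.continuousOn.mul
        ((continuousOn_chartDivergence hc hX).comp c.continuousOn fun x hx ↦ c.map_source hx)
  have e2 : ∫ x, fieldDeriv u X x ∂(vol n N) =
      ∫ y in T, fderiv ℝ (u ∘ c.symm) y (U y) := by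
    rw [← setIntegral_eq_integral_of_forall_compl_eq_zero (s := c.source) (by
      intro x hx
      exact hmf x (hsrc x hx)), setIntegral_source hc]
    · exact setIntegral_congr_fun c.open_target.measurableSet fun y hy ↦ (hdu y hy).symm
    · have : ContinuousOn (fun x ↦ (chartDensity c (c x))⁻¹ *
          fderiv ℝ (u ∘ c.symm) (c x) (U (c x))) c.source :=
        ((((contDiffOn_chartDensity hc).continuousOn.inv₀ fun _ hy ↦
          (chartDensity_pos hc hy).ne').mul hcont2).comp c.continuousOn
            fun x hx ↦ c.map_source hx)
      refine (this.aestronglyMeasurable c.open_source.measurableSet).congr ?_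
      refine (ae_restrict_iff' c.open_source.measurableSet).2 (Eventually.of_forall fun x hx ↦ ?_)
      simp only
      rw [hdu _ (c.map_source hx), c.left_inv hx, ← mul_assoc,
        inv_mul_cancel₀ (chartDensity_pos hc (c.map_source hx)).ne', one_mul]
  have e3 : ∫ y, ediv (T.indicator ((u ∘ c.symm) • U)) y =
      ∫ y in T, ((u ∘ c.symm) y * ediv U y + fderiv ℝ (u ∘ c.symm) y (U y)) := by
    rw [← setIntegral_eq_integral_of_forall_compl_eq_zero (s := T)]
    · exact setIntegral_congr_fun c.open_target.measurableSet hediv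
    · intro y hy
      apply ediv_zero_of_eventuallyEq
      filter_upwards [hK.isClosed.isOpen_compl.mem_nhds fun h ↦ hy (hKT h)] with z hz
      by_cases hzT : z ∈ T
      · rw [indicator_of_mem hzT]
        simp [image_eq_zero_of_notMem_tsupport (hKu z hzT hz)]
      · exact indicator_of_notMem hzT _
  rw [e3, integral_add] at hWdiv
  · rw [e1, e2]
    linarith
  · refine hint _ hcont1 fun y hy hyK ↦ ?_
    simp [image_eq_zero_of_notMem_tsupport (hKu y hy hyK)]
  · refine hint _ hcont2 fun y hy hyK ↦ ?_
    rw [hdu y hy, hmf _ (hKu y hy hyK)]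
    simp

/-- The divergence does not depend on the chart used to compute it. -/
theorem chartDivergence_eq {c' : OpenPartialHomeomorph N (EuclideanSpace ℝ (Fin (n + 1)))}
    [CompactSpace N]
    (hc : c ∈ IsManifold.maximalAtlas (𝓡 (n + 1)) ∞ N)
    (hc' : c' ∈ IsManifold.maximalAtlas (𝓡 (n + 1)) ∞ N)
    (hX : ContMDiff (𝓡 (n + 1)) (𝓡 (n + 1)).tangent ∞
      (fun x ↦ (⟨x, X x⟩ : TangentBundle (𝓡 (n + 1)) N)))
    {x : N} (hx : x ∈ c.source) (hx' : x ∈ c'.source) :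
    chartDivergence c X (c x) = chartDivergence c' X (c' x) := by
  set O := c.source ∩ c'.source
  have hO : IsOpen O := c.open_source.inter c'.open_source
  have hd : ContinuousOn (fun x ↦ chartDivergence c X (c x)) O :=
    ((continuousOn_chartDivergence hc hX).comp c.continuousOn
      fun x hx ↦ c.map_source hx).mono inter_subset_left
  have hd' : ContinuousOn (fun x ↦ chartDivergence c' X (c' x)) O :=
    ((continuousOn_chartDivergence hc' hX).comp c'.continuousOn
      fun x hx ↦ c'.map_source hx).mono inter_subset_right
  have hae : ∀ᵐ x ∂(vol n N), x ∈ O →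
      chartDivergence c X (c x) - chartDivergence c' X (c' x) = 0 := by
    refine hO.ae_eq_zero_of_integral_contMDiff_smul_eq_zero (𝓡 (n + 1)) 
      ((hd.sub hd').locallyIntegrableOn hO.measurableSet) fun u hu huc hus ↦ ?_
    have h1 := integral_mul_chartDivergence hc hX hu huc (hus.trans inter_subset_left)
    have h2 := integral_mul_chartDivergence hc' hX hu huc (hus.trans inter_subset_right)
    have hint : ∀ h : N → ℝ, ContinuousOn h O → Integrable (fun x ↦ u x * h x) (vol n N) := by
      intro h hh
      have h3 : IntegrableOn (fun x ↦ u x * h x) (tsupport u) (vol n N) :=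
        (hu.continuous.continuousOn.mul (hh.mono hus)).integrableOn_compact huc
      refine (integrableOn_iff_integrable_of_support_subset ?_).1 h3
      intro x hx
      by_contra h
      exact hx (by simp [image_eq_zero_of_notMem_tsupport h])
    simp only [smul_eq_mul, mul_sub]
    rw [integral_sub (hint _ hd) (hint _ hd'), h1, h2, sub_self]
  have heq : EqOn (fun x ↦ chartDivergence c X (c x)) (fun x ↦ chartDivergence c' X (c' x)) O := by
    refine Measure.eqOn_open_of_ae_eq (μ := vol n N) ?_ hO hd hd'
    rw [Filter.EventuallyEq, ae_restrict_iff' hO.measurableSet]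
    filter_upwards [hae] with x hx h using sub_eq_zero.1 (hx h)
  exact heq ⟨hx, hx'⟩

end DivergenceInCharts

/-! ### Linearity of the divergence, and fields supported in a chart -/

section Divergence

variable {n : ℕ} {N : Type*} [MetricSpace N] [ChartedSpace (EuclideanSpace ℝ (Fin (n + 1))) N]
  {c : OpenPartialHomeomorph N (EuclideanSpace ℝ (Fin (n + 1)))}
  {X Y : ∀ x : N, TangentSpace (𝓡 (n + 1)) x}
  [Bundle.RiemannianBundle (fun x : N ↦ TangentSpace (𝓡 (n + 1)) x)]
  [IsManifold (𝓡 (n + 1)) ∞ N]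
  [IsContMDiffRiemannianBundle (𝓡 (n + 1)) ∞ (EuclideanSpace ℝ (Fin (n + 1)))
      (fun x : N ↦ TangentSpace (𝓡 (n + 1)) x)]

lemma differentiableAt_density_smul_chartField
    (hc : c ∈ IsManifold.maximalAtlas (𝓡 (n + 1)) ∞ N)
    (hX : ContMDiff (𝓡 (n + 1)) (𝓡 (n + 1)).tangent ∞
      (fun x ↦ (⟨x, X x⟩ : TangentBundle (𝓡 (n + 1)) N)))
    {y : EuclideanSpace ℝ (Fin (n + 1))} (hy : y ∈ c.target) :
    DifferentiableAt ℝ (fun z ↦ chartDensity c z • chartField c X z) y :=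
  ((contDiffOn_density_smul_chartField hc hX).differentiableOn (by simp)).differentiableAt
    (c.open_target.mem_nhds hy)

lemma divergence_add
    (hX : ContMDiff (𝓡 (n + 1)) (𝓡 (n + 1)).tangent ∞
      (fun x ↦ (⟨x, X x⟩ : TangentBundle (𝓡 (n + 1)) N)))
    (hY : ContMDiff (𝓡 (n + 1)) (𝓡 (n + 1)).tangent ∞
      (fun x ↦ (⟨x, Y x⟩ : TangentBundle (𝓡 (n + 1)) N))) (x : N) :
    divergence (fun x ↦ X x + Y x) x = divergence X x + divergence Y x := by
  set c := chartAt (EuclideanSpace ℝ (Fin (n + 1))) x with hcdef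
  have hc : c ∈ IsManifold.maximalAtlas (𝓡 (n + 1)) ∞ N := IsManifold.chart_mem_maximalAtlas x
  have hx : c x ∈ c.target := c.map_source (mem_chart_source _ x)
  simp only [divergence_eq_chartDivergence, ← hcdef, chartDivergence, chartField_add, smul_add]
  rw [ediv_add (differentiableAt_density_smul_chartField hc hX hx)
    (differentiableAt_density_smul_chartField hc hY hx), mul_add]

lemma chartField_const_smul (a : ℝ) (y : EuclideanSpace ℝ (Fin (n + 1))) :
    chartField c (fun x ↦ a • X x) y = a • chartField c X y := by
  rw [chartField_eq, chartField_eq, map_smul]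

lemma divergence_const_smul (a : ℝ)
    (hX : ContMDiff (𝓡 (n + 1)) (𝓡 (n + 1)).tangent ∞
      (fun x ↦ (⟨x, X x⟩ : TangentBundle (𝓡 (n + 1)) N))) (x : N) :
    divergence (fun x ↦ a • X x) x = a * divergence X x := by
  set c := chartAt (EuclideanSpace ℝ (Fin (n + 1))) x with hcdef
  have hc : c ∈ IsManifold.maximalAtlas (𝓡 (n + 1)) ∞ N := IsManifold.chart_mem_maximalAtlas x
  have hx : c x ∈ c.target := c.map_source (mem_chart_source _ x)
  simp only [divergence_eq_chartDivergence, ← hcdef, chartDivergence, chartField_const_smul,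
    smul_comm _ a]
  rw [ediv_const_smul a (differentiableAt_density_smul_chartField hc hX hx), mul_left_comm]

lemma divergence_eq_zero_of_eventually {x : N} (h : ∀ᶠ z in 𝓝 x, X z = 0) :
    divergence X x = 0 := by
  set c := chartAt (EuclideanSpace ℝ (Fin (n + 1))) x with hcdef
  have hx : x ∈ c.source := mem_chart_source _ x
  rw [divergence_eq_chartDivergence, ← hcdef, chartDivergence, ediv_zero_of_eventuallyEq, mul_zero]
  have hcont : Tendsto c.symm (𝓝 (c x)) (𝓝 x) := by
    have := c.continuousAt_symm (c.map_source hx)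
    rwa [ContinuousAt, c.left_inv hx] at this
  filter_upwards [hcont.eventually h] with y hy
  rw [chartField_eq, hy, map_zero, smul_zero]
  rfl

variable [IsRiemannianManifold (𝓡 (n + 1)) N] [MeasurableSpace N] [BorelSpace N] [CompactSpace N]

lemma divergence_eq_of_mem_maximalAtlas (hc : c ∈ IsManifold.maximalAtlas (𝓡 (n + 1)) ∞ N)
    (hX : ContMDiff (𝓡 (n + 1)) (𝓡 (n + 1)).tangent ∞
      (fun x ↦ (⟨x, X x⟩ : TangentBundle (𝓡 (n + 1)) N))) {x : N} (hx : x ∈ c.source) :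
    divergence X x = chartDivergence c X (c x) :=
  chartDivergence_eq (IsManifold.chart_mem_maximalAtlas x) hc hX (mem_chart_source _ x) hx

lemma continuous_divergence (hX : ContMDiff (𝓡 (n + 1)) (𝓡 (n + 1)).tangent ∞
      (fun x ↦ (⟨x, X x⟩ : TangentBundle (𝓡 (n + 1)) N))) : Continuous (divergence X) := by
  refine continuous_iff_continuousAt.2 fun x ↦ ?_
  set c := chartAt (EuclideanSpace ℝ (Fin (n + 1))) x
  have hc : c ∈ IsManifold.maximalAtlas (𝓡 (n + 1)) ∞ N := IsManifold.chart_mem_maximalAtlas x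
  have hx : x ∈ c.source := mem_chart_source _ x
  have h : ContinuousAt (fun x ↦ chartDivergence c X (c x)) x :=
    (((continuousOn_chartDivergence hc hX).comp c.continuousOn fun x hx ↦ c.map_source hx)
      ).continuousAt (c.open_source.mem_nhds hx)
  refine h.congr ?_
  filter_upwards [c.open_source.mem_nhds hx] with z hz
  exact (divergence_eq_of_mem_maximalAtlas hc hX hz).symm

lemma integrable_divergence (hX : ContMDiff (𝓡 (n + 1)) (𝓡 (n + 1)).tangent ∞
      (fun x ↦ (⟨x, X x⟩ : TangentBundle (𝓡 (n + 1)) N))) :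
    Integrable (divergence X) (vol n N) :=
  integrableOn_univ.1 ((continuous_divergence hX).continuousOn.integrableOn_compact isCompact_univ)

end Divergence

section Transplant

variable {n : ℕ} {N : Type*} [MetricSpace N] [ChartedSpace (EuclideanSpace ℝ (Fin (n + 1))) N]
  {c : OpenPartialHomeomorph N (EuclideanSpace ℝ (Fin (n + 1)))}
  {Y : EuclideanSpace ℝ (Fin (n + 1)) → EuclideanSpace ℝ (Fin (n + 1))}

open Classical in
/-- The vector field on the manifold whose components in the chart `c` are `Y`, extended by zero
outside the domain of the chart. -/
noncomputable def transplant (c : OpenPartialHomeomorph N (EuclideanSpace ℝ (Fin (n + 1))))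
    (Y : EuclideanSpace ℝ (Fin (n + 1)) → EuclideanSpace ℝ (Fin (n + 1))) (x : N) :
    TangentSpace (𝓡 (n + 1)) x :=
  if x ∈ c.source then
    (chartFrame c (c x) (Y (c x)) : EuclideanSpace ℝ (Fin (n + 1)))
  else 0

lemma transplant_symm {y : EuclideanSpace ℝ (Fin (n + 1))} (hy : y ∈ c.target) :
    transplant c Y (c.symm y) = chartFrame c y (Y y) := by
  have : ∀ y', y' = y → (chartFrame c y' (Y y') : EuclideanSpace ℝ (Fin (n + 1))) =
      (chartFrame c y (Y y) : EuclideanSpace ℝ (Fin (n + 1))) := by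
    rintro _ rfl
    rfl
  exact (if_pos (c.map_target hy)).trans (this _ (c.right_inv hy))

lemma transplant_of_notMem {x : N} (hx : x ∉ c.source) : transplant c Y x = 0 :=
  if_neg hx

variable [IsManifold (𝓡 (n + 1)) ∞ N]

lemma chartField_transplant (hc : c ∈ IsManifold.maximalAtlas (𝓡 (n + 1)) ∞ N)
    {y : EuclideanSpace ℝ (Fin (n + 1))} (hy : y ∈ c.target) :
    chartField c (transplant c Y) y = Y y := by
  rw [chartField_eq, transplant_symm hy, chartCoframe_chartFrame hc hy]

lemma transplant_eventually_eq_zero (hYc : HasCompactSupport Y) (hYt : tsupport Y ⊆ c.target)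
    {x : N} (hx : x ∉ c.source) : ∀ᶠ z in 𝓝 x, transplant c Y z = 0 := by
  have hK : IsClosed (c.symm '' tsupport Y) :=
    (hYc.isCompact.image_of_continuousOn (c.continuousOn_symm.mono hYt)).isClosed
  have hxK : x ∉ c.symm '' tsupport Y := by
    rintro ⟨y, hy, rfl⟩
    exact hx (c.map_target (hYt hy))
  filter_upwards [hK.isOpen_compl.mem_nhds hxK] with z hz
  by_cases hzs : z ∈ c.source
  · obtain ⟨y, hy, rfl⟩ : ∃ y ∈ c.target, c.symm y = z := ⟨c z, c.map_source hzs, c.left_inv hzs⟩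
    have : Y y = 0 := image_eq_zero_of_notMem_tsupport fun h ↦ hz ⟨y, h, rfl⟩
    rw [transplant_symm hy, this, map_zero]
  · exact transplant_of_notMem hzs

lemma contMDiff_transplant (hc : c ∈ IsManifold.maximalAtlas (𝓡 (n + 1)) ∞ N)
    (hY : ContDiff ℝ ∞ Y) (hYc : HasCompactSupport Y) (hYt : tsupport Y ⊆ c.target) :
    ContMDiff (𝓡 (n + 1)) (𝓡 (n + 1)).tangent ∞
      (fun x ↦ (⟨x, transplant c Y x⟩ : TangentBundle (𝓡 (n + 1)) N)) := by
  intro x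
  by_cases hx : x ∈ c.source
  · have h := (contMDiffOn_chartFrame hc hY.contDiffOn).comp
      (contMDiffOn_of_mem_maximalAtlas hc) fun x hx ↦ c.map_source hx
    refine (h.contMDiffAt (c.open_source.mem_nhds hx)).congr_of_eventuallyEq ?_
    filter_upwards [c.open_source.mem_nhds hx] with z hz
    obtain ⟨y, hy, rfl⟩ : ∃ y ∈ c.target, c.symm y = z := ⟨c z, c.map_source hz, c.left_inv hz⟩
    have : ∀ y', y' = y → (⟨c.symm y, chartFrame c y (Y y)⟩ : TangentBundle (𝓡 (n + 1)) N) =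
        ⟨c.symm y', chartFrame c y' (Y y')⟩ := by
      rintro _ rfl
      rfl
    rw [transplant_symm hy]
    exact this _ (c.right_inv hy)
  · refine ((Bundle.contMDiff_zeroSection ℝ (TangentSpace (𝓡 (n + 1)) : N → Type _)) x
      ).congr_of_eventuallyEq ?_
    filter_upwards [transplant_eventually_eq_zero hYc hYt hx] with z hz
    rw [hz]
    rfl

variable [Bundle.RiemannianBundle (fun x : N ↦ TangentSpace (𝓡 (n + 1)) x)]
  [IsContMDiffRiemannianBundle (𝓡 (n + 1)) ∞ (EuclideanSpace ℝ (Fin (n + 1)))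
      (fun x : N ↦ TangentSpace (𝓡 (n + 1)) x)]
  [IsRiemannianManifold (𝓡 (n + 1)) N] [MeasurableSpace N] [BorelSpace N] [CompactSpace N]

lemma divergence_transplant_symm (hc : c ∈ IsManifold.maximalAtlas (𝓡 (n + 1)) ∞ N)
    (hY : ContDiff ℝ ∞ Y) (hYc : HasCompactSupport Y) (hYt : tsupport Y ⊆ c.target)
    {y : EuclideanSpace ℝ (Fin (n + 1))} (hy : y ∈ c.target) :
    divergence (transplant c Y) (c.symm y) =
      (chartDensity c y)⁻¹ * ediv (fun z ↦ chartDensity c z • Y z) y := by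
  rw [divergence_eq_of_mem_maximalAtlas hc (contMDiff_transplant hc hY hYc hYt) (c.map_target hy),
    c.right_inv hy, chartDivergence]
  congr 1
  apply ediv_congr
  filter_upwards [c.open_target.mem_nhds hy] with z hz
  rw [chartField_transplant hc hz]

/-- The integral of the divergence of a transplanted field, read in the chart. -/
lemma setIntegral_divergence_transplant (hc : c ∈ IsManifold.maximalAtlas (𝓡 (n + 1)) ∞ N)
    (hY : ContDiff ℝ ∞ Y) (hYc : HasCompactSupport Y) (hYt : tsupport Y ⊆ c.target)
    {A : Set N} (hA : NullMeasurableSet A (vol n N)) :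
    ∫ x in A, divergence (transplant c Y) x ∂(vol n N) =
      ∫ y in c.target ∩ c.symm ⁻¹' A, ediv (fun z ↦ chartDensity c z • Y z) y := by
  have hsm := contMDiff_transplant hc hY hYc hYt
  rw [← integral_indicator₀ hA, ← setIntegral_eq_integral_of_forall_compl_eq_zero (s := c.source)]
  · rw [setIntegral_source hc, ← integral_indicator c.open_target.measurableSet,
      ← integral_indicator₀ (nullMeasurableSet_target_inter_preimage hc hA)]
    · congr 1
      ext y
      by_cases hy : y ∈ c.target
      · rw [indicator_of_mem hy]
        by_cases hyA : c.symm y ∈ A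
        · rw [indicator_of_mem hyA, indicator_of_mem (show y ∈ c.target ∩ c.symm ⁻¹' A from
            ⟨hy, hyA⟩), divergence_transplant_symm hc hY hYc hYt hy, ← mul_assoc,
            mul_inv_cancel₀ (chartDensity_pos hc hy).ne', one_mul]
        · rw [indicator_of_notMem hyA, mul_zero, indicator_of_notMem fun h ↦ hyA h.2]
      · rw [indicator_of_notMem hy, indicator_of_notMem fun h ↦ hy h.1]
    · exact ((continuous_divergence hsm).aestronglyMeasurable.indicator₀ hA).restrict
  · intro x hx
    by_cases hxA : x ∈ A
    · rw [indicator_of_mem hxA]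
      exact divergence_eq_zero_of_eventually (transplant_eventually_eq_zero hYc hYt hx)
    · exact indicator_of_notMem hxA _

end Transplant

/-! ### Metrics on Euclidean space -/

/-- A smooth Riemannian metric on `ℝ^d`, given by its bilinear forms. -/
structure SmoothMetric (d : ℕ) where
  form : EuclideanSpace ℝ (Fin d) →
    EuclideanSpace ℝ (Fin d) →L[ℝ] EuclideanSpace ℝ (Fin d) →L[ℝ] ℝ
  contDiff : ContDiff ℝ ∞ form
  symm : ∀ y v w, form y v w = form y w v
  pos : ∀ y v, v ≠ 0 → 0 < form y v v

namespace SmoothMetric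

variable {d : ℕ} (g : SmoothMetric d)

/-- The length of the vector `v` at the point `y`. -/
noncomputable def nrm (y v : EuclideanSpace ℝ (Fin d)) : ℝ := √(g.form y v v)

/-- The vector at `y` dual to the covector `ℓ`. -/
noncomputable def grad (y : EuclideanSpace ℝ (Fin d)) (l : EuclideanSpace ℝ (Fin d) →L[ℝ] ℝ) :
    EuclideanSpace ℝ (Fin d) := (g.form y).inverse l

/-- The length of the covector `ℓ` at the point `y`. -/
noncomputable def dualNrm (y : EuclideanSpace ℝ (Fin d))
    (l : EuclideanSpace ℝ (Fin d) →L[ℝ] ℝ) : ℝ := √(l (g.grad y l))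

variable {g} {y v w : EuclideanSpace ℝ (Fin d)} {l l' : EuclideanSpace ℝ (Fin d) →L[ℝ] ℝ}

lemma form_self_nonneg (y v : EuclideanSpace ℝ (Fin d)) : 0 ≤ g.form y v v := by
  by_cases hv : v = 0
  · simp [hv]
  · exact (g.pos y v hv).le

lemma exists_equiv (y : EuclideanSpace ℝ (Fin d)) :
    ∃ e : EuclideanSpace ℝ (Fin d) ≃L[ℝ] (EuclideanSpace ℝ (Fin d) →L[ℝ] ℝ),
      (e : EuclideanSpace ℝ (Fin d) →L[ℝ] (EuclideanSpace ℝ (Fin d) →L[ℝ] ℝ)) = g.form y := by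
  have hinj : Function.Injective (g.form y).toLinearMap := by
    rw [← LinearMap.ker_eq_bot, LinearMap.ker_eq_bot']
    intro v hv
    by_contra h
    have h1 : g.form y v = 0 := hv
    have := g.pos y v h
    simp [h1] at this
  have hdim : Module.finrank ℝ (EuclideanSpace ℝ (Fin d)) =
      Module.finrank ℝ (EuclideanSpace ℝ (Fin d) →L[ℝ] ℝ) :=
    (InnerProductSpace.toDual ℝ (EuclideanSpace ℝ (Fin d))).toLinearEquiv.finrank_eq
  refine ⟨(LinearEquiv.ofInjectiveOfFinrankEq (g.form y).toLinearMap hinj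
    hdim).toContinuousLinearEquiv, ?_⟩
  ext v w
  rfl

lemma form_grad (y : EuclideanSpace ℝ (Fin d)) (l : EuclideanSpace ℝ (Fin d) →L[ℝ] ℝ) :
    g.form y (g.grad y l) = l := by
  obtain ⟨e, he⟩ := g.exists_equiv y
  rw [grad, ← he, ContinuousLinearMap.inverse_equiv]
  simp

lemma apply_grad_nonneg (y : EuclideanSpace ℝ (Fin d)) (l : EuclideanSpace ℝ (Fin d) →L[ℝ] ℝ) :
    0 ≤ l (g.grad y l) := by
  have := g.form_self_nonneg y (g.grad y l)
  rwa [form_grad] at this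

lemma contDiff_grad {k : EuclideanSpace ℝ (Fin d) → EuclideanSpace ℝ (Fin d) →L[ℝ] ℝ}
    (hk : ContDiff ℝ ∞ k) : ContDiff ℝ ∞ (fun y ↦ g.grad y (k y)) := by
  refine ContDiff.clm_apply ?_ hk
  refine contDiff_iff_contDiffAt.2 fun y ↦ ?_
  obtain ⟨e, he⟩ := g.exists_equiv y
  have h := contDiffAt_map_inverse (𝕜 := ℝ) (n := ∞) e
  rw [he] at h
  exact h.comp y g.contDiff.contDiffAt

lemma nrm_nonneg (y v : EuclideanSpace ℝ (Fin d)) : 0 ≤ g.nrm y v := Real.sqrt_nonneg _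

lemma dualNrm_nonneg (y : EuclideanSpace ℝ (Fin d)) (l : EuclideanSpace ℝ (Fin d) →L[ℝ] ℝ) :
    0 ≤ g.dualNrm y l := Real.sqrt_nonneg _

lemma nrm_grad : g.nrm y (g.grad y l) = g.dualNrm y l := by
  rw [nrm, form_grad, dualNrm]

lemma sq_nrm : g.nrm y v ^ 2 = g.form y v v := Real.sq_sqrt (form_self_nonneg y v)

lemma sq_dualNrm : g.dualNrm y l ^ 2 = l (g.grad y l) := Real.sq_sqrt (apply_grad_nonneg y l)

/-- The Cauchy–Schwarz inequality for the metric. -/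
lemma abs_form_le (y v w : EuclideanSpace ℝ (Fin d)) :
    |g.form y v w| ≤ g.nrm y v * g.nrm y w := by
  have key : g.form y v w ^ 2 ≤ g.form y v v * g.form y w w := by
    have h : ∀ t : ℝ, 0 ≤ g.form y w w * (t * t) + (2 * g.form y v w) * t + g.form y v v := by
      intro t
      have := form_self_nonneg (g := g) y (v + t • w)
      simp only [map_add, map_smul, add_apply, smul_apply,
        smul_eq_mul] at this
      rw [g.symm y w v] at this
      linarith
    have := discrim_le_zero h
    rw [discrim] at this
    nlinarith
  rw [nrm, nrm, ← Real.sqrt_mul (form_self_nonneg y v)]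
  exact Real.abs_le_sqrt key

lemma abs_apply_le (y : EuclideanSpace ℝ (Fin d)) (l : EuclideanSpace ℝ (Fin d) →L[ℝ] ℝ)
    (w : EuclideanSpace ℝ (Fin d)) : |l w| ≤ g.dualNrm y l * g.nrm y w := by
  have := g.abs_form_le y (g.grad y l) w
  rwa [form_grad, nrm_grad] at this

lemma nrm_smul (a : ℝ) : g.nrm y (a • v) = |a| * g.nrm y v := by
  rw [nrm, nrm, ← Real.sqrt_sq_eq_abs, ← Real.sqrt_mul (sq_nonneg a)]
  congr 1
  simp
  ring

lemma nrm_add_le : g.nrm y (v + w) ≤ g.nrm y v + g.nrm y w := by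
  refine Real.sqrt_le_iff.2 ⟨add_nonneg (nrm_nonneg _ _) (nrm_nonneg _ _), ?_⟩
  have h1 := (le_abs_self _).trans (g.abs_form_le y v w)
  simp only [map_add, add_apply]
  rw [add_sq, sq_nrm, sq_nrm, g.symm y w v]
  linarith

@[simp] lemma nrm_zero : g.nrm y 0 = 0 := by simp [nrm]

lemma grad_add : g.grad y (l + l') = g.grad y l + g.grad y l' := map_add _ _ _

lemma grad_smul (a : ℝ) : g.grad y (a • l) = a • g.grad y l := map_smul _ _ _

lemma dualNrm_add_le : g.dualNrm y (l + l') ≤ g.dualNrm y l + g.dualNrm y l' := by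
  rw [← nrm_grad, ← nrm_grad, ← nrm_grad, grad_add]
  exact nrm_add_le

lemma dualNrm_smul (a : ℝ) : g.dualNrm y (a • l) = |a| * g.dualNrm y l := by
  rw [← nrm_grad, ← nrm_grad, grad_smul, nrm_smul]

lemma dualNrm_pos (hl : l ≠ 0) : 0 < g.dualNrm y l := by
  rw [← nrm_grad]
  refine Real.sqrt_pos.2 (g.pos _ _ fun h ↦ hl ?_)
  rw [← g.form_grad y l, h, map_zero]

lemma continuous_dualNrm {k : EuclideanSpace ℝ (Fin d) → EuclideanSpace ℝ (Fin d) →L[ℝ] ℝ}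
    (hk : ContDiff ℝ ∞ k) : Continuous (fun y ↦ g.dualNrm y (k y)) :=
  (hk.clm_apply (contDiff_grad hk)).continuous.sqrt

/-- On compact sets a metric dominates the Euclidean one. -/
lemma exists_norm_le (g : SmoothMetric d) {K : Set (EuclideanSpace ℝ (Fin d))}
    (hK : IsCompact K) : ∃ C, 0 < C ∧ ∀ y ∈ K, ∀ v, ‖v‖ ≤ C * g.nrm y v := by
  have hc : Continuous fun p : EuclideanSpace ℝ (Fin d) × EuclideanSpace ℝ (Fin d) ↦
      g.form p.1 p.2 p.2 :=
    ((g.contDiff.continuous.comp continuous_fst).clm_apply continuous_snd).clm_apply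
      continuous_snd
  obtain ⟨m, hm, h⟩ :=
    (hK.prod (isCompact_sphere (0 : EuclideanSpace ℝ (Fin d)) 1)).exists_forall_le'
    hc.continuousOn (a := 0) (fun p hp ↦ g.pos _ _ (by
      rintro h0
      simpa [h0] using hp.2))
  refine ⟨(√m)⁻¹, by positivity, fun y hy v ↦ ?_⟩
  by_cases hv : v = 0
  · simp [hv]
  have hv' : 0 < ‖v‖ := norm_pos_iff.2 hv
  have h1 := h (y, ‖v‖⁻¹ • v) ⟨hy, by simp [norm_smul, hv'.ne']⟩
  have h2 : √m ≤ g.nrm y (‖v‖⁻¹ • v) := Real.sqrt_le_sqrt h1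
  rw [nrm_smul, abs_of_pos (by positivity), le_inv_mul_iff₀ hv'] at h2
  rw [le_inv_mul_iff₀ (by positivity)]
  linarith

/-- The length of a bounded covector is bounded on compact sets. -/
lemma exists_dualNrm_le (g : SmoothMetric d) {K : Set (EuclideanSpace ℝ (Fin d))}
    (hK : IsCompact K) : ∃ C, 0 < C ∧ ∀ y ∈ K, ∀ l, g.dualNrm y l ≤ C * ‖l‖ := by
  obtain ⟨C, hC, h⟩ := g.exists_norm_le hK
  refine ⟨C, hC, fun y hy l ↦ ?_⟩
  have h1 : g.dualNrm y l ^ 2 ≤ (C * ‖l‖) * g.dualNrm y l := by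
    rw [sq_dualNrm]
    refine (le_abs_self _).trans ((l.le_opNorm _).trans ?_)
    have := h y hy (g.grad y l)
    rw [nrm_grad] at this
    nlinarith [norm_nonneg l]
  rcases (g.dualNrm_nonneg y l).eq_or_lt with h0 | h0
  · rw [← h0]; positivity
  · nlinarith

/-- The gradient of a covector, normalised to length less than one by means of the parameter
`κ > 0`, which keeps the field smooth where the covector vanishes. -/
noncomputable def unitGrad (g : SmoothMetric d) (κ : ℝ) (y : EuclideanSpace ℝ (Fin d))
    (l : EuclideanSpace ℝ (Fin d) →L[ℝ] ℝ) : EuclideanSpace ℝ (Fin d) :=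
  (√(l (g.grad y l) + κ ^ 2))⁻¹ • g.grad y l

lemma contDiff_unitGrad {κ : ℝ} (hκ : 0 < κ)
    {k : EuclideanSpace ℝ (Fin d) → EuclideanSpace ℝ (Fin d) →L[ℝ] ℝ}
    (hk : ContDiff ℝ ∞ k) : ContDiff ℝ ∞ (fun y ↦ g.unitGrad κ y (k y)) := by
  have h : ∀ y, 0 < k y (g.grad y (k y)) + κ ^ 2 := fun y ↦ by
    have := g.apply_grad_nonneg y (k y)
    positivity
  refine ContDiff.smul (ContDiff.inv (ContDiff.sqrt ?_ fun y ↦ (h y).ne') fun y ↦ ?_)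
    (contDiff_grad hk)
  · exact (hk.clm_apply (contDiff_grad hk)).add contDiff_const
  · exact (Real.sqrt_pos.2 (h y)).ne'

lemma nrm_unitGrad_le {κ : ℝ} : g.nrm y (g.unitGrad κ y l) ≤ 1 := by
  have h := g.apply_grad_nonneg y l
  rw [unitGrad, nrm_smul, nrm_grad, dualNrm, abs_of_nonneg (by positivity), inv_mul_eq_div]
  refine div_le_one_of_le₀ (Real.sqrt_le_sqrt (by nlinarith [sq_nonneg κ])) (by positivity)

lemma dualNrm_le_apply_unitGrad {κ : ℝ} (hκ : 0 < κ) :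
    g.dualNrm y l ≤ l (g.unitGrad κ y l) + κ := by
  have h := g.apply_grad_nonneg y l
  rw [unitGrad, map_smul, dualNrm, smul_eq_mul]
  set q := l (g.grad y l)
  have h1 : 0 < √(q + κ ^ 2) := Real.sqrt_pos.2 (by positivity)
  have h2 : √q ≤ √(q + κ ^ 2) := Real.sqrt_le_sqrt (by nlinarith [sq_nonneg κ])
  have h3 : κ ≤ √(q + κ ^ 2) := Real.le_sqrt_of_sq_le (by linarith)
  have h4 := Real.sq_sqrt (show 0 ≤ q + κ ^ 2 by positivity)
  have : √(q + κ ^ 2) ≤ (√(q + κ ^ 2))⁻¹ * q + κ := by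
    have : (√(q + κ ^ 2))⁻¹ * q = √(q + κ ^ 2) - (√(q + κ ^ 2))⁻¹ * κ ^ 2 := by
      field_simp
      linarith
    rw [this]
    have : (√(q + κ ^ 2))⁻¹ * κ ^ 2 ≤ κ := by
      rw [inv_mul_le_iff₀ h1]
      nlinarith
    linarith
  linarith

/-- Where a covector is bounded below, its value on its regularised unit gradient is nearly its
length. -/
lemma dualNrm_le_mul_apply_unitGrad {κ c : ℝ} (hκ : 0 < κ)
    (hl : c ≤ g.dualNrm y l) {θ : ℝ} (hθ : 0 < θ) (h : κ * (1 + θ) ≤ θ * c) :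
    g.dualNrm y l ≤ (1 + θ) * l (g.unitGrad κ y l) := by
  have h1 := g.dualNrm_le_apply_unitGrad (y := y) (l := l) hκ
  nlinarith

end SmoothMetric

/-! ### Superlevel sets of smooth functions -/

section Superlevel

variable {d : ℕ}

/-- The derivative of a smooth step rising from `0` to `1` between `0` and `1 / (k + 1)`: an
approximation of the Dirac mass at `0`. -/
noncomputable def stepDeriv (k : ℕ) (x : ℝ) : ℝ :=
  (k + 1) * deriv Real.smoothTransition ((k + 1) * x)

lemma differentiable_smoothTransition : Differentiable ℝ Real.smoothTransition :=
  (Real.smoothTransition.contDiff (n := 1)).differentiable (by simp)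

lemma hasDerivAt_step (k : ℕ) (x : ℝ) :
    HasDerivAt (fun x : ℝ ↦ Real.smoothTransition ((k + 1) * x)) (stepDeriv k x) x := by
  have h := (differentiable_smoothTransition ((k + 1) * x)).hasDerivAt
  have h2 : HasDerivAt (fun x : ℝ ↦ ((k : ℝ) + 1) * x) (k + 1) x := by
    simpa using (hasDerivAt_id x).const_mul ((k : ℝ) + 1)
  simpa [stepDeriv, mul_comm, Function.comp_def] using h.comp x h2

lemma continuous_stepDeriv (k : ℕ) : Continuous (stepDeriv k) := by
  have := (Real.smoothTransition.contDiff (n := 1)).continuous_deriv (by simp)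
  unfold stepDeriv
  fun_prop

lemma stepDeriv_nonneg (k : ℕ) (x : ℝ) : 0 ≤ stepDeriv k x :=
  mul_nonneg (by positivity) Real.smoothTransition.monotone.deriv_nonneg

lemma stepDeriv_eq_zero {k : ℕ} {x : ℝ} (h : x ∉ Icc 0 ((k + 1 : ℝ)⁻¹)) : stepDeriv k x = 0 := by
  rw [stepDeriv, mul_eq_zero]
  right
  have hk : (0 : ℝ) < k + 1 := by positivity
  rw [mem_Icc, not_and_or, not_le, not_le] at h
  rcases h with h | h
  · have : Real.smoothTransition =ᶠ[𝓝 ((k + 1) * x)] fun _ ↦ 0 := by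
      filter_upwards [Iio_mem_nhds (show ((k : ℝ) + 1) * x < 0 by nlinarith)] with z hz
      exact Real.smoothTransition.zero_of_nonpos (le_of_lt hz)
    rw [this.deriv_eq]; simp
  · rw [inv_lt_iff_one_lt_mul₀ hk] at h
    have : Real.smoothTransition =ᶠ[𝓝 ((k + 1) * x)] fun _ ↦ 1 := by
      filter_upwards [Ioi_mem_nhds (show 1 < ((k : ℝ) + 1) * x by nlinarith)] with z hz
      exact Real.smoothTransition.one_of_one_le (le_of_lt hz)
    rw [this.deriv_eq]; simp

lemma tendsto_step (x : ℝ) :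
    Tendsto (fun k : ℕ ↦ Real.smoothTransition ((k + 1) * x)) atTop
      (𝓝 (indicator (Ioi 0) 1 x)) := by
  by_cases hx : 0 < x
  · rw [indicator_of_mem (by exact hx)]
    refine tendsto_const_nhds.congr' ?_
    have h : Tendsto (fun k : ℕ ↦ ((k : ℝ) + 1) * x) atTop atTop :=
      (tendsto_natCast_atTop_atTop.atTop_add tendsto_const_nhds).atTop_mul_const hx
    filter_upwards [h.eventually_ge_atTop 1] with k hk
    exact (Real.smoothTransition.one_of_one_le hk).symm
  · rw [indicator_of_notMem (by simpa using hx)]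
    refine tendsto_const_nhds.congr fun k ↦ ?_
    refine (Real.smoothTransition.zero_of_nonpos ?_).symm
    have : (0 : ℝ) < k + 1 := by positivity
    nlinarith

lemma measurableSet_superlevel {v : EuclideanSpace ℝ (Fin d) → ℝ} (hv : Continuous v) (t : ℝ) :
    MeasurableSet {y | t < v y} := measurableSet_lt measurable_const hv.measurable

/-- The flux through the boundary of a superlevel set, as a limit of integrals over thin layers. -/
lemma tendsto_integral_stepDeriv {v : EuclideanSpace ℝ (Fin d) → ℝ}
    {U : EuclideanSpace ℝ (Fin d) → EuclideanSpace ℝ (Fin d)} (hv : ContDiff ℝ ∞ v)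
    (hU : ContDiff ℝ ∞ U) (hUc : HasCompactSupport U) :
    Tendsto (fun k : ℕ ↦ -∫ y, stepDeriv k (v y) * fderiv ℝ v y (U y)) atTop
      (𝓝 (∫ y in {y | 0 < v y}, ediv U y)) := by
  have hU1 : ContDiff ℝ 1 U := hU.of_le (by simp)
  have hv1 : ContDiff ℝ 1 v := hv.of_le (by simp)
  have h1 : ∀ k : ℕ, ∫ y, Real.smoothTransition ((k + 1) * v y) * ediv U y =
      -∫ y, stepDeriv k (v y) * fderiv ℝ v y (U y) := by
    intro k
    have hs : ContDiff ℝ 1 (fun y ↦ Real.smoothTransition ((k + 1) * v y)) :=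
      (Real.smoothTransition.contDiff (n := 1)).comp (contDiff_const.mul hv1)
    rw [integral_mul_ediv hs hU1 hUc]
    congr 2
    ext y
    have := (hasDerivAt_step k (v y)).comp_hasFDerivAt y
      (hv1.differentiable (by simp) y).hasFDerivAt
    rw [HasFDerivAt.fderiv (f := fun y ↦ Real.smoothTransition ((k + 1) * v y)) this]
    simp
  simp_rw [← h1]
  rw [← integral_indicator (measurableSet_superlevel hv.continuous 0)]
  have hc := continuous_ediv hU1
  refine tendsto_integral_of_dominated_convergence (fun y ↦ ‖ediv U y‖)
    (fun k ↦ ?_) (integrable_ediv hU1 hUc).norm (fun k ↦ ae_of_all _ fun y ↦ ?_)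
    (ae_of_all _ fun y ↦ ?_)
  · have := Real.smoothTransition.continuous
    have := hv.continuous
    exact Continuous.aestronglyMeasurable (by fun_prop)
  · rw [norm_mul]
    refine mul_le_of_le_one_left (norm_nonneg _) ?_
    rw [Real.norm_of_nonneg (Real.smoothTransition.nonneg _)]
    exact Real.smoothTransition.le_one _
  · have := (tendsto_step (v y)).mul_const (ediv U y)
    convert this using 2
    by_cases h : 0 < v y <;> simp [indicator, h]

/-- A coarea inequality: between `α` and `β` there is a level `t`, which may be taken outside a
null set, at which the area of `{u = t}` with respect to a weight is at most its mean value over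
the levels. Here a weighted area is expressed by the fluxes of the fields that it bounds. -/
lemma exists_level_integral_ediv_le {u h : EuclideanSpace ℝ (Fin d) → ℝ} (hu : ContDiff ℝ ∞ u)
    (hh : Continuous h) (h0 : ∀ y, 0 ≤ h y) (hc : HasCompactSupport h) {α β : ℝ} (hαβ : α < β)
    {p : ℝ → Prop} (hp : ∀ᵐ t, p t) :
    ∃ t ∈ Ioo α β, p t ∧ ∀ V : EuclideanSpace ℝ (Fin d) → EuclideanSpace ℝ (Fin d),
      ContDiff ℝ ∞ V → HasCompactSupport V → (∀ y, -fderiv ℝ u y (V y) ≤ h y) →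
      ∫ y in {y | t < u y}, ediv V y ≤ (β - α)⁻¹ * ∫ y, h y := by
  -- the mass of `h` in thin layers above the level `t`; Fatou's lemma in `t` gives a good level
  set Q : ℕ → ℝ → ENNReal := fun k t ↦
    ∫⁻ y, ENNReal.ofReal (stepDeriv k (u y - t) * h y) with hQ
  have hmeas : ∀ k, Measurable (fun q : ℝ × EuclideanSpace ℝ (Fin d) ↦
      ENNReal.ofReal (stepDeriv k (u q.2 - q.1) * h q.2)) := fun k ↦ by
    have := continuous_stepDeriv k
    have := hu.continuous
    exact (Continuous.measurable (by fun_prop)).ennreal_ofReal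
  have hQm : ∀ k, Measurable (Q k) := fun k ↦ (hmeas k).lintegral_prod_right'
  have hint : ∀ k, ∫⁻ t in Ioo α β, Q k t ≤ ENNReal.ofReal (∫ y, h y) := by
    intro k
    have h1 : ∫⁻ t in Ioo α β, Q k t = ∫⁻ y, ∫⁻ t in Ioo α β,
        ENNReal.ofReal (stepDeriv k (u y - t) * h y) :=
      lintegral_lintegral_swap (hmeas k).aemeasurable
    rw [h1, ofReal_integral_eq_lintegral_ofReal (hh.integrable_of_hasCompactSupport hc)
      (ae_of_all _ h0)]
    refine lintegral_mono fun y ↦ ?_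
    have h2 : ∀ t, HasDerivAt (fun t ↦ -Real.smoothTransition ((k + 1) * (u y - t)))
        (stepDeriv k (u y - t)) t := by
      intro t
      have h3 : HasDerivAt (fun t ↦ u y - t) (-1) t := by
        simpa using (hasDerivAt_id t).const_sub (u y)
      have := ((hasDerivAt_step k (u y - t)).comp t h3).fun_neg
      simpa [Function.comp_def] using this
    have hcont : Continuous fun t ↦ stepDeriv k (u y - t) :=
      (continuous_stepDeriv k).comp (continuous_const.sub continuous_id)
    have h3 := intervalIntegral.integral_eq_sub_of_hasDerivAt (a := α) (b := β)
      (fun t _ ↦ h2 t) (hcont.intervalIntegrable _ _)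
    rw [intervalIntegral.integral_of_le hαβ.le, integral_Ioc_eq_integral_Ioo] at h3
    have h4 : ∫⁻ t in Ioo α β, ENNReal.ofReal (stepDeriv k (u y - t)) ≤ 1 := by
      rw [← ofReal_integral_eq_lintegral_ofReal, h3]
      · refine ENNReal.ofReal_le_one.2 ?_
        have := Real.smoothTransition.nonneg ((k + 1) * (u y - β))
        have := Real.smoothTransition.le_one ((k + 1) * (u y - α))
        linarith
      · exact (hcont.integrableOn_Icc).mono_set Ioo_subset_Icc_self
      · exact ae_of_all _ fun t ↦ stepDeriv_nonneg _ _
    calc ∫⁻ t in Ioo α β, ENNReal.ofReal (stepDeriv k (u y - t) * h y)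
        = ∫⁻ t in Ioo α β, ENNReal.ofReal (stepDeriv k (u y - t)) * ENNReal.ofReal (h y) := by
          simp_rw [ENNReal.ofReal_mul (stepDeriv_nonneg _ _)]
      _ = (∫⁻ t in Ioo α β, ENNReal.ofReal (stepDeriv k (u y - t))) * ENNReal.ofReal (h y) := by
          rw [lintegral_mul_const]
          exact hcont.measurable.ennreal_ofReal
      _ ≤ 1 * ENNReal.ofReal (h y) := by gcongr
      _ = _ := one_mul _
  have hfat : ∫⁻ t in Ioo α β, liminf (fun k ↦ Q k t) atTop ≤ ENNReal.ofReal (∫ y, h y) :=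
    (lintegral_liminf_le hQm).trans
      ((liminf_le_liminf (Eventually.of_forall hint)).trans (by simp))
  have hI : volume (Ioo α β) = ENNReal.ofReal (β - α) := Real.volume_Ioo
  have hne : (volume.restrict (Ioo α β)) ≠ 0 := by
    rw [Ne, Measure.restrict_eq_zero, hI, ENNReal.ofReal_eq_zero]
    linarith
  have hnull : (volume.restrict (Ioo α β)) {t | ¬ (p t ∧ t ∈ Ioo α β)} = 0 := by
    have h1 : ∀ᵐ t ∂(volume.restrict (Ioo α β)), p t := ae_restrict_of_ae hp
    exact h1.and (ae_restrict_mem measurableSet_Ioo)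
  obtain ⟨t, ht, hle⟩ := exists_notMem_null_le_laverage hne
    (Measurable.liminf hQm).aemeasurable hnull
  simp only [mem_ofPred_eq, not_not] at ht
  refine ⟨t, ht.2, ht.1, fun V hV hVc hVh ↦ ?_⟩
  rw [laverage_eq, Measure.restrict_apply_univ, hI] at hle
  have hle2 : liminf (fun k ↦ Q k t) atTop ≤ ENNReal.ofReal ((β - α)⁻¹ * ∫ y, h y) := by
    refine hle.trans ?_
    rw [mul_comm, ENNReal.ofReal_mul' (inv_nonneg.2 (by linarith)),
      ENNReal.ofReal_inv_of_pos (by linarith), div_eq_mul_inv]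
    gcongr
  have hlim := tendsto_integral_stepDeriv (v := fun y ↦ u y - t) (hu.sub contDiff_const) hV hVc
  have hset : {y | 0 < u y - t} = {y | t < u y} := by
    ext y; simp
  rw [hset] at hlim
  have hfd : ∀ y, fderiv ℝ (fun y ↦ u y - t) y = fderiv ℝ u y := fun y ↦ fderiv_sub_const t
  simp_rw [hfd] at hlim
  have hpos : 0 ≤ (β - α)⁻¹ * ∫ y, h y :=
    mul_nonneg (inv_nonneg.2 (by linarith)) (integral_nonneg h0)
  rw [← ENNReal.ofReal_le_ofReal_iff hpos]
  refine le_trans ?_ hle2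
  rw [← (ENNReal.tendsto_ofReal hlim).liminf_eq]
  refine liminf_le_liminf (Eventually.of_forall fun k ↦ ?_)
  have hci : Integrable fun y ↦ stepDeriv k (u y - t) * h y := by
    have := continuous_stepDeriv k
    have := hu.continuous
    exact Continuous.integrable_of_hasCompactSupport (by fun_prop) hc.mul_left
  rw [hQ]
  dsimp only
  rw [← ofReal_integral_eq_lintegral_ofReal hci
    (ae_of_all _ fun y ↦ mul_nonneg (stepDeriv_nonneg _ _) (h0 y)), ← integral_neg]
  refine ENNReal.ofReal_le_ofReal (integral_mono ?_ hci fun y ↦ ?_)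
  · have h1 := continuous_stepDeriv k
    have h2 := hu.continuous
    have h3 : Continuous fun y ↦ fderiv ℝ u y (V y) :=
      (hu.continuous_fderiv (by simp)).clm_apply hV.continuous
    exact Continuous.integrable_of_hasCompactSupport (by fun_prop)
      (hVc.mono fun y hy h ↦ hy (by simp [h]))
  · have := mul_le_mul_of_nonneg_left (hVh y) (stepDeriv_nonneg k (u y - t))
    dsimp only
    linarith

/-- Almost every small linear perturbation of a smooth function is regular at almost every
level: the exceptional pairs form the image of a null set under a smooth map. -/
lemma exists_ae_regular {u : EuclideanSpace ℝ (Fin d) → ℝ} (hu : ContDiff ℝ ∞ u) {r : ℝ}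
    (hr : 0 < r) : ∃ a : EuclideanSpace ℝ (Fin d), ‖a‖ ≤ r ∧ ∀ᵐ t : ℝ,
      ∀ y, u y + inner ℝ a y = t → fderiv ℝ (fun y ↦ u y + inner ℝ a y) y ≠ 0 := by
  -- the pair `(a, t)` is exceptional exactly if it is of the form
  -- `(-∇u(y), u(y) - ⟪∇u(y), y⟫)`; the image is taken in `ℝ^d × ℝ`, where `ℝ^d × {0}` is null
  set gr : EuclideanSpace ℝ (Fin d) → EuclideanSpace ℝ (Fin d) := fun y ↦
    (InnerProductSpace.toDual ℝ (EuclideanSpace ℝ (Fin d))).symm (fderiv ℝ u y) with hgr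
  have hgrs : ContDiff ℝ ∞ gr :=
    (LinearIsometryEquiv.contDiff _).comp (hu.fderiv_right (by simp))
  set Φ : EuclideanSpace ℝ (Fin d) × ℝ → EuclideanSpace ℝ (Fin d) × ℝ := fun q ↦
    (-gr q.1, u q.1 - inner ℝ (gr q.1) q.1) with hΦ
  have hΦs : ContDiff ℝ ∞ Φ := by
    have h1 : ContDiff ℝ ∞ (fun q : EuclideanSpace ℝ (Fin d) × ℝ ↦ gr q.1) := hgrs.comp contDiff_fst
    exact h1.neg.prodMk ((hu.comp contDiff_fst).sub (h1.inner ℝ contDiff_fst))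
  have hnull : (volume.prod volume) (Φ '' (univ ×ˢ {0})) = 0 := by
    refine addHaar_image_eq_zero_of_differentiableOn_of_addHaar_eq_zero
      ((volume : Measure (EuclideanSpace ℝ (Fin d))).prod (volume : Measure ℝ))
      (hΦs.differentiable (by simp)).differentiableOn ?_
    rw [Measure.prod_prod]; simp
  have h1 := Measure.measure_ae_null_of_prod_null hnull
  have hball : (volume : Measure (EuclideanSpace ℝ (Fin d))) (Metric.ball 0 r) ≠ 0 :=
    (Metric.measure_ball_pos _ _ hr).ne'
  have h2 : ∃ a ∈ Metric.ball (0 : EuclideanSpace ℝ (Fin d)) r,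
      (volume : Measure ℝ) (Prod.mk a ⁻¹' (Φ '' (univ ×ˢ {0}))) = 0 := by
    by_contra! hcon
    refine hball (measure_mono_null (fun a ha ↦ ?_) h1)
    exact hcon a ha
  obtain ⟨a, ha, hat⟩ := h2
  refine ⟨a, (mem_ball_zero_iff.1 ha).le, ?_⟩
  refine measure_mono_null (fun t ht ↦ ?_) hat
  simp only [mem_compl_iff, mem_ofPred_eq, not_forall, not_not] at ht
  obtain ⟨y, hy, hD⟩ := ht
  have h3 : fderiv ℝ (fun y ↦ u y + inner ℝ a y) y =
      fderiv ℝ u y + innerSL ℝ a :=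
    ((hu.differentiable (by simp) y).hasFDerivAt.add (innerSL ℝ a).hasFDerivAt).fderiv
  have h4 : gr y = -a := by
    rw [hgr]
    dsimp only
    rw [eq_neg_of_add_eq_zero_left (h3.symm.trans hD), map_neg]
    congr 1
    rw [LinearIsometryEquiv.symm_apply_eq]
    ext z; simp
  refine ⟨(y, 0), by simp, ?_⟩
  simp only [hΦ, h4, neg_neg, inner_neg_left, sub_neg_eq_add, hy]

end Superlevel

/-! ### Mollification of a set -/

section Mollify

variable {d : ℕ}

open scoped Convolution

/-- Convolution with an even kernel is symmetric. -/
lemma integral_convolution_indicator_mul {φ h : EuclideanSpace ℝ (Fin d) → ℝ}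
    {A : Set (EuclideanSpace ℝ (Fin d))} (hA : MeasurableSet A) (hφ : Integrable φ)
    (heven : ∀ y, φ (-y) = φ y) (hh : Integrable h) :
    ∫ y, (φ ⋆[ContinuousLinearMap.lsmul ℝ ℝ, volume] (A.indicator 1 : _ → ℝ)) y * h y =
      ∫ z in A, (φ ⋆[ContinuousLinearMap.lsmul ℝ ℝ, volume] h) z := by
  have h1 : ∀ y, (φ ⋆[ContinuousLinearMap.lsmul ℝ ℝ, volume] (A.indicator 1 : _ → ℝ)) y * h y =
      ∫ z, φ (z - y) * h y * A.indicator 1 z := by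
    intro y
    rw [convolution_eq_swap, ← integral_mul_const]
    congr 1
    ext z
    simp only [ContinuousLinearMap.lsmul_apply, smul_eq_mul]
    rw [← heven (y - z), neg_sub]
    ring
  have h2 : ∀ z, A.indicator (φ ⋆[ContinuousLinearMap.lsmul ℝ ℝ, volume] h) z =
      ∫ y, φ (z - y) * h y * A.indicator 1 z := by
    intro z
    rw [integral_mul_const]
    by_cases hz : z ∈ A
    · simp only [indicator_of_mem hz, Pi.one_apply, mul_one]
      rw [convolution_eq_swap]
      rfl
    · simp [indicator_of_notMem hz]
  simp_rw [h1]
  rw [← integral_indicator hA]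
  simp_rw [h2]
  refine integral_integral_swap ?_
  have h3 : Integrable (fun p : EuclideanSpace ℝ (Fin d) × EuclideanSpace ℝ (Fin d) ↦
      φ (p.1 - p.2) * h p.2) (volume.prod volume) := by
    have := hh.convolution_integrand (ContinuousLinearMap.lsmul ℝ ℝ) hφ
    refine this.congr (ae_of_all _ fun p ↦ ?_)
    simp [mul_comm]
  have h4 := h3.swap.indicator (measurable_snd hA)
  refine h4.congr (ae_of_all _ fun p ↦ ?_)
  by_cases hp : p.2 ∈ A <;> simp [indicator, hp, Function.uncurry]

/-- Divergence commutes with convolution. -/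
lemma ediv_convolution {φ : EuclideanSpace ℝ (Fin d) → ℝ}
    {V : EuclideanSpace ℝ (Fin d) → EuclideanSpace ℝ (Fin d)} (hφ : Integrable φ)
    (hV : ContDiff ℝ 1 V) (hVc : HasCompactSupport V) (y : EuclideanSpace ℝ (Fin d)) :
    ediv (φ ⋆[ContinuousLinearMap.lsmul ℝ ℝ, volume] V) y =
      (φ ⋆[ContinuousLinearMap.lsmul ℝ ℝ, volume] (ediv V)) y := by
  have hci : ∀ i : Fin d, HasCompactSupport fun z ↦ V z i := fun i ↦
    hVc.mono fun z hz h ↦ hz (by simp [h])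
  have hfd : ∀ i : Fin d, Continuous fun z ↦
      fderiv ℝ (fun z ↦ V z i) z (EuclideanSpace.single i 1) := fun i ↦
    ((contDiff_coord hV i).continuous_fderiv (by simp)).clm_apply continuous_const
  have hfc : ∀ i : Fin d, HasCompactSupport fun z ↦
      fderiv ℝ (fun z ↦ V z i) z (EuclideanSpace.single i 1) := fun i ↦
    ((hci i).fderiv (𝕜 := ℝ)).mono fun z hz h ↦ hz (by simp [h])
  have hex : ∀ {F : Type} [NormedAddCommGroup F] [NormedSpace ℝ F]
      {u : EuclideanSpace ℝ (Fin d) → F}, Continuous u → HasCompactSupport u → ∀ x,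
      Integrable (fun t ↦ φ t • u (x - t)) := by
    intro F _ _ u hu huc x
    exact (huc.convolutionExists_right (ContinuousLinearMap.lsmul ℝ ℝ)
      hφ.locallyIntegrable hu) x
  have h1 : ∀ i : Fin d, (fun z ↦ (φ ⋆[ContinuousLinearMap.lsmul ℝ ℝ, volume] V) z i) =
      (φ ⋆[ContinuousLinearMap.lsmul ℝ ℝ, volume] (fun z ↦ V z i)) := by
    intro i
    ext z
    have := (EuclideanSpace.proj (𝕜 := ℝ) i).integral_comp_comm (hex hV.continuous hVc z)
    exact this.symm
  rw [ediv]
  have h2 : ∀ i : Fin d,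
      fderiv ℝ (fun z ↦ (φ ⋆[ContinuousLinearMap.lsmul ℝ ℝ, volume] V) z i) y
        (EuclideanSpace.single i 1) =
      ∫ t, φ t • fderiv ℝ (fun z ↦ V z i) (y - t) (EuclideanSpace.single i 1) := by
    intro i
    rw [h1, ((hci i).hasFDerivAt_convolution_right (ContinuousLinearMap.lsmul ℝ ℝ)
      hφ.locallyIntegrable (contDiff_coord hV i) y).fderiv]
    rw [convolution_precompR_apply _ hφ.locallyIntegrable ((hci i).fderiv (𝕜 := ℝ))
      ((contDiff_coord hV i).continuous_fderiv (by simp))]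
    rfl
  simp_rw [h2]
  rw [← integral_finsetSum _ fun i _ ↦ hex (hfd i) (hfc i) y]
  simp only [convolution, ContinuousLinearMap.lsmul_apply, ediv, Finset.smul_sum]

/-- Averages do not increase the length of vectors. -/
lemma SmoothMetric.nrm_integral_smul_le (g : SmoothMetric d) {φ : EuclideanSpace ℝ (Fin d) → ℝ}
    {U : EuclideanSpace ℝ (Fin d) → EuclideanSpace ℝ (Fin d)} {y : EuclideanSpace ℝ (Fin d)}
    {M : ℝ} (hφ : Integrable φ) (h0 : ∀ t, 0 ≤ φ t) (h1 : ∫ t, φ t = 1)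
    (hU : Integrable fun t ↦ φ t • U t) (hM : ∀ t, φ t ≠ 0 → g.nrm y (U t) ≤ M) :
    g.nrm y (∫ t, φ t • U t) ≤ M := by
  set v := ∫ t, φ t • U t with hv
  have h2 : g.nrm y v ^ 2 ≤ g.nrm y v * M := by
    rw [SmoothMetric.sq_nrm]
    nth_rewrite 2 [hv]
    rw [← (g.form y v).integral_comp_comm hU]
    calc ∫ t, g.form y v (φ t • U t) ≤ ∫ t, φ t * (g.nrm y v * M) := by
          refine integral_mono ((g.form y v).integrable_comp hU) (hφ.mul_const _) fun t ↦ ?_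
          dsimp only
          rw [map_smul, smul_eq_mul]
          by_cases ht : φ t = 0
          · simp [ht]
          refine mul_le_mul_of_nonneg_left ?_ (h0 t)
          exact (le_abs_self _).trans ((g.abs_form_le y v _).trans
            (mul_le_mul_of_nonneg_left (hM t ht) (g.nrm_nonneg _ _)))
      _ = g.nrm y v * M := by rw [integral_mul_const, h1, one_mul]
  rcases (g.nrm_nonneg y v).eq_or_lt with h | h
  · have : ∃ t, φ t ≠ 0 := by
      by_contra! hc
      simp [hc] at h1
    obtain ⟨t, ht⟩ := this
    rw [← h]
    exact (g.nrm_nonneg _ _).trans (hM t ht)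
  · nlinarith

/-- Uniformly on compact sets, transporting short vectors to nearby points hardly changes their
weighted length. -/
lemma SmoothMetric.exists_transport_le (g : SmoothMetric d) {ρ χ : EuclideanSpace ℝ (Fin d) → ℝ}
    (hρ : Continuous ρ) (hρ0 : ∀ y, 0 < ρ y) (hχ : Continuous χ) (hχ0 : ∀ y, 0 ≤ χ y) {s κ : ℝ}
    (hs : ∀ y, s < ‖y‖ → χ y = 0) (hκ : 0 < κ) :
    ∃ ε, 0 < ε ∧ ∀ y y' v, ‖y - y'‖ < ε → g.nrm y' v ≤ 1 →
      g.nrm y (((ρ y)⁻¹ * (ρ y' * χ y')) • v) ≤ χ y + κ := by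
  obtain ⟨C, hC, hCv⟩ := g.exists_norm_le
    (isCompact_closedBall (0 : EuclideanSpace ℝ (Fin d)) s)
  set B := Metric.closedBall (0 : EuclideanSpace ℝ (Fin d)) (s + 1)
  set K := B ×ˢ B ×ˢ Metric.closedBall (0 : EuclideanSpace ℝ (Fin d)) C
  have hK : IsCompact K := (isCompact_closedBall _ _).prod
    ((isCompact_closedBall _ _).prod (isCompact_closedBall _ _))
  set Ψ : EuclideanSpace ℝ (Fin d) × EuclideanSpace ℝ (Fin d) × EuclideanSpace ℝ (Fin d) → ℝ :=
    fun q ↦ (ρ q.1)⁻¹ * (ρ q.2.1 * χ q.2.1) * g.nrm q.1 q.2.2 - χ q.1 with hΨ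
  have hΨc : Continuous Ψ := by
    have h1 : Continuous fun q : EuclideanSpace ℝ (Fin d) × EuclideanSpace ℝ (Fin d) ×
        EuclideanSpace ℝ (Fin d) ↦ g.nrm q.1 q.2.2 :=
      (((g.contDiff.continuous.comp continuous_fst).clm_apply
        (by fun_prop)).clm_apply (by fun_prop)).sqrt
    have h2 : Continuous fun y ↦ (ρ y)⁻¹ := hρ.inv₀ fun y ↦ (hρ0 y).ne'
    exact (((h2.comp continuous_fst).mul (by fun_prop)).mul h1).sub (by fun_prop)
  obtain ⟨ε, hε, h⟩ := Metric.uniformContinuousOn_iff.1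
    (hK.uniformContinuousOn_of_continuous hΨc.continuousOn) κ hκ
  refine ⟨min ε 1, by positivity, fun y y' v hy hv ↦ ?_⟩
  have hnn : 0 ≤ (ρ y)⁻¹ * (ρ y' * χ y') :=
    mul_nonneg (inv_nonneg.2 (hρ0 y).le) (mul_nonneg (hρ0 y').le (hχ0 y'))
  rw [nrm_smul, abs_of_nonneg hnn]
  by_cases hy' : s < ‖y'‖
  · rw [hs y' hy']
    simp only [mul_zero, zero_mul]
    linarith [hχ0 y]
  rw [not_lt] at hy'
  have hvC : v ∈ Metric.closedBall (0 : EuclideanSpace ℝ (Fin d)) C := by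
    rw [mem_closedBall_zero_iff]
    refine (hCv y' (by simpa using hy') v).trans ?_
    nlinarith
  have hyB : y ∈ B := by
    rw [mem_closedBall_zero_iff]
    have h1 := norm_add_le (y - y') y'
    rw [sub_add_cancel] at h1
    have := hy.trans_le (min_le_right ε 1)
    linarith
  have hyB' : y' ∈ B := by
    rw [mem_closedBall_zero_iff]; linarith
  have h1 := h (y, y', v) ⟨hyB, hyB', hvC⟩ (y', y', v) ⟨hyB', hyB', hvC⟩ (by
    simp only [Prod.dist_eq, dist_self]
    rw [max_eq_left dist_nonneg, dist_eq_norm]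
    exact hy.trans_le (min_le_left ε 1))
  rw [Real.dist_eq] at h1
  have h2 := (abs_lt.1 h1).2
  simp only [hΨ] at h2
  have h3 : (ρ y')⁻¹ * (ρ y' * χ y') * g.nrm y' v - χ y' ≤ 0 := by
    rw [← mul_assoc, inv_mul_cancel₀ (hρ0 y').ne', one_mul]
    nlinarith [hχ0 y']
  linarith

/-- Mollifying the set `A` gives smooth functions whose weighted total variation is nearly bounded
by the flux of a field through the boundary of `A`: mollification is moved from `A` to the
field. -/
lemma SmoothMetric.exists_mollification (g : SmoothMetric d)
    {ρ χ : EuclideanSpace ℝ (Fin d) → ℝ} (hρ : ContDiff ℝ ∞ ρ) (hρ0 : ∀ y, 0 < ρ y)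
    {A : Set (EuclideanSpace ℝ (Fin d))} (hA : MeasurableSet A) (hχ : ContDiff ℝ ∞ χ)
    (hχ0 : ∀ y, 0 ≤ χ y) {s s' κ : ℝ} (hs : ∀ y, s < ‖y‖ → χ y = 0) (hss : s < s') (hκ : 0 < κ) :
    ∃ m : ℕ → EuclideanSpace ℝ (Fin d) → ℝ, (∀ j, ContDiff ℝ ∞ (m j)) ∧
      (∀ j y, m j y ∈ Icc 0 1) ∧
      (∀ᵐ y, Tendsto (fun j ↦ m j y) atTop (𝓝 (A.indicator 1 y))) ∧
      ∀ᶠ j in atTop, ∃ Y : EuclideanSpace ℝ (Fin d) → EuclideanSpace ℝ (Fin d),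
        ContDiff ℝ ∞ Y ∧ tsupport Y ⊆ Metric.closedBall 0 s' ∧
        (∀ y, g.nrm y (Y y) ≤ χ y + κ) ∧
        ∫ y, ρ y * χ y * g.dualNrm y (fderiv ℝ (m j) y) ≤
          -(∫ y in A, ediv (fun z ↦ ρ z • Y z) y) + κ := by
  set φ : ℕ → ContDiffBump (0 : EuclideanSpace ℝ (Fin d)) := fun j ↦
    ⟨((j : ℝ) + 1)⁻¹ / 2, ((j : ℝ) + 1)⁻¹, by positivity, half_lt_self (by positivity)⟩ with hφ
  have hind : LocallyIntegrable (A.indicator 1 : EuclideanSpace ℝ (Fin d) → ℝ) :=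
    (locallyIntegrable_const (1 : ℝ)).indicator hA
  set m : ℕ → EuclideanSpace ℝ (Fin d) → ℝ := fun j ↦
    (φ j).normed volume ⋆[ContinuousLinearMap.lsmul ℝ ℝ, volume] (A.indicator 1) with hm
  have hms : ∀ j, ContDiff ℝ ∞ (m j) := fun j ↦
    (φ j).hasCompactSupport_normed.contDiff_convolution_left _ (φ j).contDiff_normed hind
  have hrOut : Tendsto (fun j ↦ (φ j).rOut) atTop (𝓝 0) := by
    have := tendsto_one_div_add_atTop_nhds_zero_nat (𝕜 := ℝ)
    simpa [hφ] using this
  refine ⟨m, hms, fun j y ↦ ?_, ?_, ?_⟩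
  · have h1 : ∀ t, 0 ≤ (A.indicator 1 : EuclideanSpace ℝ (Fin d) → ℝ) t := fun t ↦
      indicator_nonneg (fun _ _ ↦ zero_le_one) t
    have h2 : ∀ t, (A.indicator 1 : EuclideanSpace ℝ (Fin d) → ℝ) t ≤ 1 := fun t ↦
      indicator_le_self' (fun _ _ ↦ zero_le_one) t
    refine ⟨integral_nonneg fun t ↦ mul_nonneg ((φ j).nonneg_normed t) (h1 _), ?_⟩
    rw [← (φ j).integral_normed (μ := volume)]
    refine integral_mono_of_nonneg (ae_of_all _ fun t ↦
      mul_nonneg ((φ j).nonneg_normed t) (h1 _)) (φ j).integrable_normed (ae_of_all _ fun t ↦ ?_)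
    exact mul_le_of_le_one_right ((φ j).nonneg_normed t) (h2 _)
  · refine ContDiffBump.ae_convolution_tendsto_right_of_locallyIntegrable (K := 2) hrOut
      (Eventually.of_forall fun j ↦ ?_) hind
    simp only [hφ]; linarith
  set I := ∫ y, ρ y * χ y with hI
  have hχc : HasCompactSupport χ := HasCompactSupport.of_support_subset_isCompact
    (isCompact_closedBall (0 : EuclideanSpace ℝ (Fin d)) s) fun y hy ↦ by
      by_contra h
      rw [mem_closedBall_zero_iff, not_le] at h
      exact hy (hs y h)
  have hI0 : 0 ≤ I := integral_nonneg fun y ↦ mul_nonneg (hρ0 y).le (hχ0 y)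
  obtain ⟨κ₁, hκ₁, hκI⟩ : ∃ κ₁, 0 < κ₁ ∧ κ₁ * I ≤ κ :=
    ⟨κ / (I + 1), by positivity, by
      rw [div_mul_eq_mul_div, div_le_iff₀ (by positivity)]; nlinarith⟩
  obtain ⟨ε, hε, hεt⟩ := g.exists_transport_le hρ.continuous hρ0 hχ.continuous hχ0 hs hκ
  filter_upwards [hrOut.eventually_lt_const (lt_min hε (sub_pos.2 hss))] with j hj
  -- the field that almost realises the weighted total variation of `m j`
  set X : EuclideanSpace ℝ (Fin d) → EuclideanSpace ℝ (Fin d) := fun y ↦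
    g.unitGrad κ₁ y (fderiv ℝ (m j) y) with hX
  have hXs : ContDiff ℝ ∞ X := g.contDiff_unitGrad hκ₁ ((hms j).fderiv_right (by simp))
  set V : EuclideanSpace ℝ (Fin d) → EuclideanSpace ℝ (Fin d) := fun y ↦ (ρ y * χ y) • X y with hV
  have hVs : ContDiff ℝ ∞ V := (hρ.mul hχ).smul hXs
  have hVc : HasCompactSupport V := hχc.mul_left.smul_right
  set W : EuclideanSpace ℝ (Fin d) → EuclideanSpace ℝ (Fin d) :=
    (φ j).normed volume ⋆[ContinuousLinearMap.lsmul ℝ ℝ, volume] V with hW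
  have hφi := (φ j).integrable_normed (μ := volume)
  have hWs : ContDiff ℝ ∞ W :=
    hVc.contDiff_convolution_right _ hφi.locallyIntegrable hVs
  have hφ0 : ∀ t, (φ j).normed volume t ≠ 0 → ‖t‖ < (φ j).rOut := fun t ht ↦ by
    have : t ∈ Function.support ((φ j).normed volume) := ht
    rw [(φ j).support_normed_eq] at this
    simpa using this
  have hint : ∀ y, Integrable fun t ↦ (φ j).normed volume t • V (y - t) := fun y ↦
    (hVc.convolutionExists_right (ContinuousLinearMap.lsmul ℝ ℝ)
      hφi.locallyIntegrable hVs.continuous) y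
  refine ⟨fun y ↦ (ρ y)⁻¹ • W y, (hρ.inv fun y ↦ (hρ0 y).ne').smul hWs, ?_, fun y ↦ ?_, ?_⟩
  · refine closure_minimal (fun y hy ↦ ?_) Metric.isClosed_closedBall
    by_contra h
    rw [mem_closedBall_zero_iff, not_le] at h
    refine hy ?_
    have : W y = 0 := by
      refine integral_eq_zero_of_ae (ae_of_all _ fun t ↦ ?_)
      by_cases ht : (φ j).normed volume t = 0
      · simp [ht]
      have h1 := hφ0 t ht
      have h2 := norm_sub_norm_le y t
      have h3 := hj.trans_le (min_le_right _ _)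
      simp [hV, hs (y - t) (by linarith)]
    simp [this]
  · have h1 : (ρ y)⁻¹ • W y =
        ∫ t, (φ j).normed volume t • ((ρ y)⁻¹ • V (y - t)) := by
      simp_rw [smul_comm _ (ρ y)⁻¹]
      rw [integral_smul]
      rfl
    change g.nrm y ((ρ y)⁻¹ • W y) ≤ _
    rw [h1]
    refine g.nrm_integral_smul_le hφi (fun t ↦ (φ j).nonneg_normed t) (φ j).integral_normed ?_
      fun t ht ↦ ?_
    · simp_rw [smul_comm _ (ρ y)⁻¹]
      exact (hint y).smul (ρ y)⁻¹
    · rw [hV, smul_smul]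
      refine hεt y (y - t) _ ?_ (g.nrm_unitGrad_le)
      rw [sub_sub_cancel]
      exact (hφ0 t ht).trans (hj.trans_le (min_le_left _ _))
  · have h1 : (fun z ↦ ρ z • (ρ z)⁻¹ • W z) = W := by
      ext1 z
      rw [smul_smul, mul_inv_cancel₀ (hρ0 z).ne', one_smul]
    have h2 : ∀ y, ediv W y = ((φ j).normed volume ⋆[ContinuousLinearMap.lsmul ℝ ℝ, volume]
        (ediv V)) y := ediv_convolution hφi (hVs.of_le (by simp)) hVc
    simp_rw [h1, h2]
    rw [← integral_convolution_indicator_mul hA hφi (fun y ↦ (φ j).normed_neg y)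
      (integrable_ediv (hVs.of_le (by simp)) hVc)]
    have h3 := integral_mul_ediv ((hms j).of_le (by simp) : ContDiff ℝ 1 (m j))
      (hVs.of_le (by simp)) hVc
    have h4 : ∫ y, ((φ j).normed volume ⋆[ContinuousLinearMap.lsmul ℝ ℝ, volume]
        (A.indicator 1)) y * ediv V y = -∫ y, fderiv ℝ (m j) y (V y) := h3
    rw [h4, neg_neg]
    have hfc : Continuous (fun y ↦ fderiv ℝ (m j) y) := (hms j).continuous_fderiv (by simp)
    have hi1 : Integrable fun y ↦ fderiv ℝ (m j) y (V y) :=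
      (hfc.clm_apply hVs.continuous).integrable_of_hasCompactSupport
      (hVc.mono fun y hy h ↦ hy (by simp [h]))
    have hi2 : Integrable fun y ↦ ρ y * χ y :=
      (hρ.continuous.mul hχ.continuous).integrable_of_hasCompactSupport hχc.mul_left
    have hi3 : Integrable fun y ↦ ρ y * χ y * g.dualNrm y (fderiv ℝ (m j) y) :=
      ((hρ.continuous.mul hχ.continuous).mul (g.continuous_dualNrm
        ((hms j).fderiv_right (by simp)))).integrable_of_hasCompactSupport hχc.mul_left.mul_right
    calc ∫ y, ρ y * χ y * g.dualNrm y (fderiv ℝ (m j) y)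
        ≤ ∫ y, (fderiv ℝ (m j) y (V y) + κ₁ * (ρ y * χ y)) := by
          refine integral_mono hi3 (hi1.add (hi2.const_mul _)) fun y ↦ ?_
          have := g.dualNrm_le_apply_unitGrad (y := y) (l := fderiv ℝ (m j) y) hκ₁
          have h5 : 0 ≤ ρ y * χ y := mul_nonneg (hρ0 y).le (hχ0 y)
          have := mul_le_mul_of_nonneg_left this h5
          simp only [hV, map_smul, smul_eq_mul, hX]
          linarith
      _ = (∫ y, fderiv ℝ (m j) y (V y)) + κ₁ * I := by
          rw [integral_add hi1 (hi2.const_mul _), integral_const_mul]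
      _ ≤ _ := by linarith

end Mollify

/-! ### Smoothing a set near its smooth boundary -/

section Sigmoid

variable {d : ℕ}

/-- The regular part of the zero set of a `C¹` function is a null set: nearby translates of it in a
direction of increase are disjoint. -/
lemma volume_regular_zero_set {f : EuclideanSpace ℝ (Fin d) → ℝ} (hf : ContDiff ℝ 1 f) :
    volume {y | f y = 0 ∧ fderiv ℝ f y ≠ 0} = 0 := by
  refine measure_null_of_locally_null _ fun y hy ↦ ?_
  obtain ⟨e, he⟩ : ∃ e, fderiv ℝ f y e ≠ 0 := by
    by_contra! h
    exact hy.2 (ContinuousLinearMap.ext h)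
  have hopen : {z | fderiv ℝ f z e ≠ 0} ∈ 𝓝 y :=
    (((hf.continuous_fderiv one_ne_zero).clm_apply continuous_const).continuousAt).eventually_ne he
  obtain ⟨r, hr, hball⟩ := Metric.nhds_basis_closedBall.mem_iff.1 hopen
  have hdf := hf.differentiable one_ne_zero
  refine ⟨Metric.closedBall y r ∩ {z | f z = 0}, ?_, ?_⟩
  · rw [mem_nhdsWithin_iff_exists_mem_nhds_inter]
    refine ⟨Metric.closedBall y r, Metric.closedBall_mem_nhds y hr, fun z hz ↦ ⟨hz.1, hz.2.1⟩⟩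
  refine Measure.addHaar_eq_zero_of_disjoint_translates volume
    (fun n : ℕ ↦ ((n : ℝ) + 1)⁻¹ • e) ?_ ?_ ?_
  · refine Metric.isBounded_closedBall (x := 0) (r := ‖e‖) |>.subset ?_
    rintro _ ⟨n, rfl⟩
    rw [mem_closedBall_zero_iff, norm_smul, Real.norm_of_nonneg (by positivity)]
    refine mul_le_of_le_one_left (norm_nonneg _) (inv_le_one_of_one_le₀ ?_)
    have : (0 : ℝ) ≤ n := by positivity
    linarith
  · intro n k hnk
    rw [Function.onFun, Set.disjoint_left]
    rintro x ⟨_, rfl, z, hz, hx⟩ ⟨_, rfl, z', hz', hx'⟩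
    set τ : ℝ := ((n : ℝ) + 1)⁻¹ - ((k : ℝ) + 1)⁻¹ with hτ
    have hτ0 : τ ≠ 0 := by
      rw [hτ, sub_ne_zero, Ne, inv_inj, add_left_inj, Nat.cast_inj]
      exact hnk
    have hzz : z' - z = τ • e := by
      dsimp only at hx hx'
      rw [hτ, sub_smul, sub_eq_sub_iff_add_eq_add, add_comm z', hx', ← hx, add_comm]
    obtain ⟨q, hq, hfq⟩ := domain_mvt (f := f) (f' := fderiv ℝ f)
      (s := Metric.closedBall y r) (x := z) (y := z')
      (fun q _ ↦ (hdf q).hasFDerivAt.hasFDerivWithinAt) (convex_closedBall y r) hz.1 hz'.1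
    have hq' : q ∈ Metric.closedBall y r := (convex_closedBall y r).segment_subset hz.1 hz'.1 hq
    rw [show f z' = 0 from hz'.2, show f z = 0 from hz.2, hzz, map_smul, sub_zero,
      smul_eq_mul, eq_comm, mul_eq_zero] at hfq
    exact hfq.elim hτ0 (hball hq')
  · exact Metric.isClosed_closedBall.measurableSet.inter
      (isClosed_eq hf.continuous continuous_const).measurableSet

/-- The derivative of the sigmoid function at `x` is at most `2 / x ^ 2`. -/
lemma sq_mul_sigmoid_mul_le (x : ℝ) : x ^ 2 * (Real.sigmoid x * (1 - Real.sigmoid x)) ≤ 2 := by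
  have key : ∀ x : ℝ, 0 ≤ x → x ^ 2 * (Real.sigmoid x * (1 - Real.sigmoid x)) ≤ 2 := by
    intro x hx
    rw [← Real.sigmoid_neg]
    have h1 : Real.sigmoid (-x) ≤ Real.exp (-x) := by
      rw [← Real.sigmoid_mul_rexp_neg]
      exact mul_le_of_le_one_left (Real.exp_pos _).le (Real.sigmoid_le_one x)
    have h2 : Real.sigmoid x * Real.sigmoid (-x) ≤ Real.exp (-x) :=
      (mul_le_of_le_one_left (Real.sigmoid_nonneg _) (Real.sigmoid_le_one x)).trans h1
    have h3 := Real.quadratic_le_exp_of_nonneg hx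
    calc x ^ 2 * (Real.sigmoid x * Real.sigmoid (-x)) ≤ x ^ 2 * Real.exp (-x) := by gcongr
      _ ≤ (2 * Real.exp x) * Real.exp (-x) := by gcongr; nlinarith
      _ = 2 := by rw [mul_assoc, ← Real.exp_add]; simp
  rcases le_total 0 x with h | h
  · exact key x h
  · have := key (-x) (by linarith)
    rw [Real.sigmoid_neg] at this
    linarith

lemma contDiff_sigmoid_comp {f : EuclideanSpace ℝ (Fin d) → ℝ} (hf : ContDiff ℝ ∞ f) (L : ℝ) :
    ContDiff ℝ ∞ (fun y ↦ Real.sigmoid (L * f y)) :=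
  (contDiff_sigmoid.of_le le_top).comp (contDiff_const.mul hf)

lemma hasFDerivAt_sigmoid_comp {f : EuclideanSpace ℝ (Fin d) → ℝ} (hf : ContDiff ℝ ∞ f) (L : ℝ)
    (y : EuclideanSpace ℝ (Fin d)) :
    HasFDerivAt (fun y ↦ Real.sigmoid (L * f y))
      ((L * (Real.sigmoid (L * f y) * (1 - Real.sigmoid (L * f y)))) • fderiv ℝ f y) y := by
  have h1 := ((hf.differentiable (by simp) y).hasFDerivAt).const_mul L
  have h2 := (Real.hasDerivAt_sigmoid (L * f y)).comp_hasFDerivAt y h1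
  rw [smul_smul] at h2
  rw [mul_comm L]
  exact h2

lemma tendsto_sigmoid_mul {x : ℝ} (hx : x ≠ 0) :
    Tendsto (fun j : ℕ ↦ Real.sigmoid (((j : ℝ) + 1) * x)) atTop
      (𝓝 (indicator (Ioi 0) 1 x)) := by
  have hj : Tendsto (fun j : ℕ ↦ (j : ℝ) + 1) atTop atTop :=
    tendsto_natCast_atTop_atTop.atTop_add tendsto_const_nhds
  rcases lt_or_gt_of_ne hx with h | h
  · rw [indicator_of_notMem (by simpa using h.le)]
    exact Real.tendsto_sigmoid_atBot.comp (hj.atTop_mul_const_of_neg h)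
  · rw [indicator_of_mem (by exact h)]
    exact Real.tendsto_sigmoid_atTop.comp (hj.atTop_mul_const h)

/-- If a field `V'` calibrates the layer just above the boundary of a superlevel set, then the
outward flux of `V` is bounded by that of `-V'`. -/
lemma integral_ediv_le_of_calibrated {v : EuclideanSpace ℝ (Fin d) → ℝ}
    {V V' : EuclideanSpace ℝ (Fin d) → EuclideanSpace ℝ (Fin d)} (hv : ContDiff ℝ ∞ v)
    (hV : ContDiff ℝ ∞ V) (hVc : HasCompactSupport V) (hV' : ContDiff ℝ ∞ V')
    (hVc' : HasCompactSupport V') {δ : ℝ} (hδ : 0 < δ)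
    (h : ∀ y, 0 ≤ v y → v y ≤ δ → -fderiv ℝ v y (V y) ≤ fderiv ℝ v y (V' y)) :
    ∫ y in {y | 0 < v y}, ediv V y ≤ -∫ y in {y | 0 < v y}, ediv V' y := by
  refine le_of_tendsto_of_tendsto (tendsto_integral_stepDeriv hv hV hVc)
    (tendsto_integral_stepDeriv hv hV' hVc').neg ?_
  have h1 := (tendsto_one_div_add_atTop_nhds_zero_nat (𝕜 := ℝ)).eventually_le_const hδ
  filter_upwards [h1] with k hk
  have hi : ∀ V : EuclideanSpace ℝ (Fin d) → EuclideanSpace ℝ (Fin d), ContDiff ℝ ∞ V →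
      HasCompactSupport V → Integrable fun y ↦ stepDeriv k (v y) * fderiv ℝ v y (V y) := by
    intro V hV hVc
    have h1 := continuous_stepDeriv k
    have h2 := hv.continuous
    have h3 : Continuous fun y ↦ fderiv ℝ v y (V y) :=
      (hv.continuous_fderiv (by simp)).clm_apply hV.continuous
    exact Continuous.integrable_of_hasCompactSupport (by fun_prop)
      (hVc.mono fun y hy h ↦ hy (by simp [h]))
  rw [neg_neg, ← integral_neg]
  refine integral_mono (hi V hV hVc).neg (hi V' hV' hVc') fun y ↦ ?_
  dsimp only
  by_cases hy : v y ∈ Icc 0 ((k + 1 : ℝ)⁻¹)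
  · rw [← mul_neg]
    refine mul_le_mul_of_nonneg_left (h y hy.1 (hy.2.trans ?_)) (stepDeriv_nonneg _ _)
    rwa [one_div] at hk
  · simp [stepDeriv_eq_zero hy]

lemma abs_setIntegral_sub_le {h : EuclideanSpace ℝ (Fin d) → ℝ}
    {S A B : Set (EuclideanSpace ℝ (Fin d))} (hh : Integrable h) (hS : MeasurableSet S)
    (hA : MeasurableSet A) (hB : MeasurableSet B) (hBf : volume B ≠ ⊤) {C : ℝ}
    (hC : ∀ y, |h y| ≤ C) (hB0 : ∀ y ∉ B, h y = 0) :
    |(∫ y in S, h y) - ∫ y in A, h y| ≤ C * volume.real (symmDiff S A ∩ B) := by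
  rw [← integral_indicator hS, ← integral_indicator hA,
    ← integral_sub (hh.indicator hS) (hh.indicator hA)]
  have h1 : ∀ y, |S.indicator h y - A.indicator h y| ≤
      (symmDiff S A ∩ B).indicator (fun _ ↦ C) y := by
    intro y
    have hC0 := (abs_nonneg _).trans (hC y)
    by_cases h2 : y ∈ B
    · have := hC y
      by_cases h3 : y ∈ S <;> by_cases h4 : y ∈ A <;>
        simp [indicator, h2, h3, h4, Set.mem_symmDiff, this]
    · have := hB0 y h2
      have h5 : y ∉ symmDiff S A ∩ B := fun h ↦ h2 h.2
      rw [indicator_of_notMem h5]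
      by_cases h3 : y ∈ S <;> by_cases h4 : y ∈ A <;> simp [indicator, h3, h4, this]
  have hm : MeasurableSet (symmDiff S A ∩ B) := (hS.symmDiff hA).inter hB
  have hf : volume (symmDiff S A ∩ B) ≠ ⊤ := measure_ne_top_of_subset inter_subset_right hBf
  refine (abs_integral_le_integral_abs).trans ?_
  refine (integral_mono_of_nonneg (ae_of_all _ fun y ↦ abs_nonneg _)
    ((integrable_indicator_iff hm).2 (integrableOn_const hf)) (ae_of_all _ h1)).trans ?_
  rw [integral_indicator hm, setIntegral_const, smul_eq_mul, mul_comm]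

/-- A perturbation of a large multiple of a covector is still calibrated by the regularised unit
gradient of that covector. -/
lemma SmoothMetric.calibrated_add (g : SmoothMetric d) {y Z : EuclideanSpace ℝ (Fin d)}
    {l e : EuclideanSpace ℝ (Fin d) →L[ℝ] ℝ} {θ M c C : ℝ} (hθ : 0 < θ) (hM : 0 ≤ M)
    (hC : 0 < C) (hZ : g.nrm y Z ≤ 1) (hl : g.dualNrm y l ≤ (1 + θ / 2) * l Z)
    (hc : c ≤ g.dualNrm y l) (he : g.dualNrm y e ≤ C) (hMc : (2 + θ) ^ 2 * C ≤ θ * (M * c)) :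
    g.dualNrm y (M • l + e) ≤ (1 + θ) * (M • l + e) Z ∧ 0 < (M • l + e) Z := by
  have h1 : g.dualNrm y (M • l + e) ≤ M * g.dualNrm y l + C := by
    refine g.dualNrm_add_le.trans ?_
    rw [dualNrm_smul, abs_of_nonneg hM]
    linarith
  have h2 : -C ≤ e Z := by
    have := neg_le_of_abs_le (g.abs_apply_le y e Z)
    have h3 := mul_le_mul he hZ (g.nrm_nonneg _ _) hC.le
    linarith
  have h3 : (M • l + e) Z = M * l Z + e Z := by simp
  have h4 : M * c ≤ M * g.dualNrm y l := mul_le_mul_of_nonneg_left hc hM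
  have h5 : M * g.dualNrm y l ≤ (1 + θ / 2) * (M * l Z) := by
    have := mul_le_mul_of_nonneg_left hl hM
    linarith
  have h6 : (2 + θ) ^ 2 * C ≤ θ * ((1 + θ / 2) * (M * l Z)) :=
    hMc.trans (mul_le_mul_of_nonneg_left (h4.trans h5) hθ.le)
  have h7 : (2 + θ) * C * 2 ≤ θ * (M * l Z) := by
    have : (2 + θ) * ((2 + θ) * C * 2) ≤ (2 + θ) * (θ * (M * l Z)) := by linarith
    exact le_of_mul_le_mul_left this (by linarith)
  rw [h3]
  have h8 : C < M * l Z := by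
    have h9 : θ * C < θ * (M * l Z) := by nlinarith
    exact lt_of_mul_lt_mul_left h9 hθ.le
  constructor
  · nlinarith
  · linarith

end Sigmoid

/-! ### Calibrated smooth approximants -/

section Approximants

variable {d : ℕ}

/-- Near the zero set of a function that is regular there, the regularised unit gradient calibrates
the level sets. -/
lemma SmoothMetric.exists_calibration (g : SmoothMetric d) {f : EuclideanSpace ℝ (Fin d) → ℝ}
    (hf : ContDiff ℝ ∞ f) {K : Set (EuclideanSpace ℝ (Fin d))} (hK : IsCompact K)
    (hf0 : ∀ y ∈ K, f y = 0 → fderiv ℝ f y ≠ 0) {θ : ℝ} (hθ : 0 < θ) :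
    ∃ κ c, 0 < κ ∧ 0 < c ∧ ∀ y ∈ K, |f y| ≤ c → c ≤ g.dualNrm y (fderiv ℝ f y) ∧
      g.dualNrm y (fderiv ℝ f y) ≤
        (1 + θ) * fderiv ℝ f y (g.unitGrad κ y (fderiv ℝ f y)) := by
  have hfs : ContDiff ℝ ∞ (fderiv ℝ f) := hf.fderiv_right (by simp)
  have hcont : Continuous fun y ↦ |f y| + g.dualNrm y (fderiv ℝ f y) :=
    hf.continuous.abs.add (g.continuous_dualNrm hfs)
  obtain ⟨m, hm, h⟩ := hK.exists_forall_le' hcont.continuousOn (a := 0) (fun y hy ↦ by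
    have h1 := g.dualNrm_nonneg y (fderiv ℝ f y)
    by_cases h0 : f y = 0
    · have := g.dualNrm_pos (y := y) (hf0 y hy h0)
      positivity
    · positivity)
  refine ⟨θ * (m / 2) / (1 + θ), m / 2, by positivity, by positivity, fun y hy hfy ↦ ?_⟩
  have h1 : m / 2 ≤ g.dualNrm y (fderiv ℝ f y) := by linarith [h y hy]
  refine ⟨h1, g.dualNrm_le_mul_apply_unitGrad (by positivity) h1 hθ ?_⟩
  rw [div_mul_cancel₀ _ (by positivity)]

lemma SmoothMetric.apply_unitGrad_nonneg (g : SmoothMetric d) {κ : ℝ}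
    {y : EuclideanSpace ℝ (Fin d)} {l : EuclideanSpace ℝ (Fin d) →L[ℝ] ℝ} :
    0 ≤ l (g.unitGrad κ y l) := by
  rw [unitGrad, map_smul, smul_eq_mul]
  exact mul_nonneg (by positivity) (g.apply_grad_nonneg y l)

/-- Where the steep sigmoid profile `σ (L f)` is away from its limit values, it is calibrated by the
same field as `f`, and this persists under bounded perturbations of the differential. -/
lemma SmoothMetric.exists_sigmoid_calibrated (g : SmoothMetric d) {θ τ c C : ℝ} (hθ : 0 < θ)
    (hτ : 0 < τ) (hτ1 : τ ≤ 1) (hc : 0 < c) (hC : 0 < C) :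
    ∃ L₀ : ℝ, ∀ L, L₀ ≤ L → ∀ (x : ℝ) (y Z : EuclideanSpace ℝ (Fin d))
      (l e : EuclideanSpace ℝ (Fin d) →L[ℝ] ℝ), g.nrm y Z ≤ 1 →
      (|x| ≤ c → c ≤ g.dualNrm y l ∧ g.dualNrm y l ≤ (1 + θ / 2) * l Z) →
      g.dualNrm y e ≤ C → |Real.sigmoid (L * x) - 1 / 2| ≤ 1 / 2 - τ / 4 →
      g.dualNrm y ((L * (Real.sigmoid (L * x) * (1 - Real.sigmoid (L * x)))) • l + e) ≤
        (1 + θ) * ((L * (Real.sigmoid (L * x) * (1 - Real.sigmoid (L * x)))) • l + e) Z ∧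
      0 < ((L * (Real.sigmoid (L * x) * (1 - Real.sigmoid (L * x)))) • l + e) Z := by
  refine ⟨max (4 / (τ * c)) (8 * ((2 + θ) ^ 2 * C) / (θ * τ * c)),
    fun L hL x y Z l e hZ hx he hσ ↦ ?_⟩
  have hL1 := (le_max_left _ _).trans hL
  have hL2 := (le_max_right _ _).trans hL
  rw [div_le_iff₀ (by positivity)] at hL1 hL2
  have hL0 : 0 < L := by
    by_contra! h
    have : L * (τ * c) ≤ 0 := mul_nonpos_of_nonpos_of_nonneg h (by positivity)
    linarith
  set σ := Real.sigmoid (L * x)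
  rw [abs_le] at hσ
  have hσ2 : τ / 8 ≤ σ * (1 - σ) := by
    nlinarith [mul_nonneg (show 0 ≤ σ - τ / 4 by linarith) (show 0 ≤ 1 - τ / 4 - σ by linarith)]
  have hxc : |x| ≤ c := by
    have h1 := sq_mul_sigmoid_mul_le (L * x)
    have h2 : (L * x) ^ 2 * (τ / 8) ≤ 2 := (mul_le_mul_of_nonneg_left hσ2 (sq_nonneg _)).trans h1
    have h3 : (L * |x| * τ) ^ 2 ≤ 4 ^ 2 := by
      rw [mul_pow, mul_pow, sq_abs]
      nlinarith [mul_nonneg (sq_nonneg (L * x)) hτ.le]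
    have h4 : L * |x| * τ ≤ 4 := le_of_sq_le_sq h3 (by norm_num)
    have h5 : (L * τ) * |x| ≤ (L * τ) * c := by linarith
    exact le_of_mul_le_mul_left h5 (by positivity)
  obtain ⟨h1, h2⟩ := hx hxc
  refine g.calibrated_add hθ (mul_nonneg hL0.le (by linarith)) hC hZ h2 h1 he ?_
  have h3 : L * (τ / 8) * c ≤ L * (σ * (1 - σ)) * c := by gcongr
  nlinarith

/-- Dominated convergence for uniformly bounded factors. -/
lemma tendsto_integral_mul_of_ae {h u : EuclideanSpace ℝ (Fin d) → ℝ}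
    {w : ℕ → EuclideanSpace ℝ (Fin d) → ℝ} (hh : Integrable h)
    (hw : ∀ j, AEStronglyMeasurable (w j) volume) (hw1 : ∀ j y, |w j y| ≤ 1)
    (hlim : ∀ᵐ y, h y ≠ 0 → Tendsto (fun j ↦ w j y) atTop (𝓝 (u y))) :
    Tendsto (fun j ↦ ∫ y, h y * w j y) atTop (𝓝 (∫ y, h y * u y)) := by
  refine tendsto_integral_of_dominated_convergence (fun y ↦ ‖h y‖)
    (fun j ↦ hh.aestronglyMeasurable.mul (hw j)) hh.norm (fun j ↦ ae_of_all _ fun y ↦ ?_) ?_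
  · rw [norm_mul]
    exact mul_le_of_le_one_right (norm_nonneg _) (hw1 j y)
  · filter_upwards [hlim] with y hy
    by_cases h0 : h y = 0
    · simp [h0]
    · exact (hy h0).const_mul _

/-- Smooth approximants of the indicator function of `A`: mollifications in the inner ball, glued in
the annulus to the profiles `σ ((j + 1) f)`, where `f` defines `A` there. Their weighted total
variation is nearly bounded by the flux of a field through the boundary of `A`. -/
lemma SmoothMetric.exists_approximants (g : SmoothMetric d)
    {ρ f ζ : EuclideanSpace ℝ (Fin d) → ℝ} (hρ : ContDiff ℝ ∞ ρ) (hρ0 : ∀ y, 0 < ρ y)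
    {A : Set (EuclideanSpace ℝ (Fin d))} (hA : MeasurableSet A) (hf : ContDiff ℝ ∞ f)
    {r₁ s₂ s₃ r₂ : ℝ} (hr₁ : 0 < r₁) (h12 : r₁ < s₂) (h23 : s₂ < s₃) (h3r : s₃ < r₂)
    (hAf : ∀ᵐ y, r₁ ≤ ‖y‖ → ‖y‖ ≤ r₂ → (y ∈ A ↔ 0 < f y))
    (hf0 : ∀ y, r₁ ≤ ‖y‖ → ‖y‖ ≤ r₂ → f y = 0 → fderiv ℝ f y ≠ 0)
    (hζ : ContDiff ℝ ∞ ζ) (hζ01 : ∀ y, ζ y ∈ Icc 0 1) (hζ1 : ∀ y, ‖y‖ ≤ s₂ → ζ y = 1)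
    (hζ0 : ∀ y, s₃ ≤ ‖y‖ → ζ y = 0)
    {Z : EuclideanSpace ℝ (Fin d) → EuclideanSpace ℝ (Fin d)} (hZ : ContDiff ℝ ∞ Z)
    (hZ1 : ∀ y, g.nrm y (Z y) ≤ 1) (hfZ : ∀ y, 0 ≤ fderiv ℝ f y (Z y)) {θ c : ℝ} (hθ : 0 < θ)
    (hc : 0 < c) (hcal : ∀ y, r₁ ≤ ‖y‖ → ‖y‖ ≤ r₂ → |f y| ≤ c →
      g.dualNrm y (fderiv ℝ f y) ≤ (1 + θ) * fderiv ℝ f y (Z y)) {ε : ℝ} (hε : 0 < ε) :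
    ∃ w : ℕ → EuclideanSpace ℝ (Fin d) → ℝ, (∀ j, ContDiff ℝ ∞ (w j)) ∧
      (∀ j y, s₂ ≤ ‖y‖ → w j y = Real.sigmoid (((j : ℝ) + 1) * f y)) ∧
      Tendsto (fun j ↦ ∫ y in Metric.closedBall 0 r₂, |w j y - A.indicator 1 y|) atTop (𝓝 0) ∧
      ∀ᶠ j in atTop, ∃ Y : EuclideanSpace ℝ (Fin d) → EuclideanSpace ℝ (Fin d),
        ContDiff ℝ ∞ Y ∧ tsupport Y ⊆ Metric.closedBall 0 s₃ ∧
        (∀ y, g.nrm y (Y y) ≤ (1 + θ) * ζ y + ε) ∧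
        ∫ y, ρ y * ζ y * g.dualNrm y (fderiv ℝ (w j) y) ≤
          -(∫ y in A, ediv (fun z ↦ ρ z • Y z) y) + ε := by
  -- the cutoff separating the two kinds of approximation
  let χb : ContDiffBump (0 : EuclideanSpace ℝ (Fin d)) := ⟨r₁, s₂, hr₁, h12⟩
  set χ : EuclideanSpace ℝ (Fin d) → ℝ := fun y ↦ χb y
  have hχ : ContDiff ℝ ∞ χ := χb.contDiff
  have hχ0 : ∀ y, 0 ≤ χ y := fun y ↦ χb.nonneg
  have hχle : ∀ y, χ y ≤ 1 := fun y ↦ χb.le_one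
  have hχin : ∀ y, ‖y‖ ≤ r₁ → χ y = 1 := fun y hy ↦
    χb.one_of_mem_closedBall (by simpa using hy)
  have hχout : ∀ y, s₂ ≤ ‖y‖ → χ y = 0 := fun y hy ↦ χb.zero_of_le_dist (by simpa using hy)
  have hχc : HasCompactSupport χ := χb.hasCompactSupport
  have hχζ : ∀ y, χ y * ζ y = χ y := fun y ↦ by
    rcases le_total ‖y‖ s₂ with h | h
    · rw [hζ1 y h, mul_one]
    · rw [hχout y h, zero_mul]
  obtain ⟨m, hms, hm01, hmlim, hmev⟩ := g.exists_mollification hρ hρ0 hA hχ hχ0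
    (s := s₂) (s' := s₃) (κ := ε / 5) (fun y hy ↦ hχout y hy.le) h23 (by positivity)
  set σ : ℕ → EuclideanSpace ℝ (Fin d) → ℝ := fun j y ↦ Real.sigmoid (((j : ℝ) + 1) * f y) with hσ
  have hσs : ∀ j, ContDiff ℝ ∞ (σ j) := fun j ↦ contDiff_sigmoid_comp hf _
  have hσ01 : ∀ j y, σ j y ∈ Icc 0 1 := fun j y ↦
    ⟨Real.sigmoid_nonneg _, Real.sigmoid_le_one _⟩
  have hσlim : ∀ᵐ y, r₁ ≤ ‖y‖ → ‖y‖ ≤ r₂ →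
      Tendsto (fun j ↦ σ j y) atTop (𝓝 (A.indicator 1 y)) := by
    have h0 : ∀ᵐ y, ¬ (f y = 0 ∧ fderiv ℝ f y ≠ 0) := by
      rw [ae_iff]
      simpa using volume_regular_zero_set (hf.of_le (by simp))
    filter_upwards [hAf, h0] with y h1 h2 h3 h4
    have h5 : f y ≠ 0 := fun h ↦ h2 ⟨h, hf0 y h3 h4 h⟩
    have h6 := tendsto_sigmoid_mul h5
    convert h6 using 2
    simp [indicator, h1 h3 h4]
  set w : ℕ → EuclideanSpace ℝ (Fin d) → ℝ := fun j y ↦ χ y * m j y + (1 - χ y) * σ j y with hw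
  have hws : ∀ j, ContDiff ℝ ∞ (w j) := fun j ↦
    (hχ.mul (hms j)).add ((contDiff_const.sub hχ).mul (hσs j))
  have hind01 : ∀ y, (A.indicator 1 y : ℝ) ∈ Icc 0 1 := fun y ↦ by
    by_cases h : y ∈ A <;> simp [h]
  have hw01 : ∀ j y, w j y ∈ Icc 0 1 := fun j y ↦ by
    have h1 := hm01 j y
    have h2 := hσ01 j y
    have h3 := hχ0 y
    have h4 := hχle y
    constructor
    · exact add_nonneg (mul_nonneg h3 h1.1) (mul_nonneg (by linarith) h2.1)
    · have := mul_le_mul_of_nonneg_left h1.2 h3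
      have := mul_le_mul_of_nonneg_left h2.2 (show 0 ≤ 1 - χ y by linarith)
      simp only [hw]
      linarith
  refine ⟨w, hws, fun j y hy ↦ by simp [hw, hχout y hy, hσ], ?_, ?_⟩
  · have h1 := tendsto_integral_mul_of_ae
      (h := (Metric.closedBall (0 : EuclideanSpace ℝ (Fin d)) r₂).indicator fun _ ↦ 1)
      (u := fun _ ↦ 0) (w := fun j y ↦ |w j y - A.indicator 1 y|)
      ((integrable_indicator_iff Metric.isClosed_closedBall.measurableSet).2
        (integrableOn_const (isCompact_closedBall _ _).measure_ne_top))
      (fun j ↦ by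
        have h2 : Measurable fun y ↦ |w j y - (A.indicator 1 y : ℝ)| :=
          ((hws j).continuous.measurable.sub (measurable_one.indicator hA)).norm
        exact h2.aestronglyMeasurable)
      (fun j y ↦ by
        rw [abs_abs, abs_le]
        have := hw01 j y
        have := hind01 y
        simp only [mem_Icc] at *
        constructor <;> linarith) ?_
    · simp only [mul_zero, integral_zero] at h1
      refine h1.congr fun j ↦ ?_
      rw [← integral_indicator Metric.isClosed_closedBall.measurableSet]
      congr 1
      ext y
      by_cases hy : y ∈ Metric.closedBall (0 : EuclideanSpace ℝ (Fin d)) r₂ <;>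
        simp only [indicator, hy, if_true, if_false, one_mul, zero_mul]
    · filter_upwards [hmlim, hσlim] with y hy1 hy2 hy3
      have hyr : ‖y‖ ≤ r₂ := by
        by_contra h
        exact hy3 (indicator_of_notMem (by simpa using h) _)
      have h2 : Tendsto (fun j ↦ w j y) atTop (𝓝 (A.indicator 1 y)) := by
        rcases le_total ‖y‖ r₁ with h | h
        · simpa [hw, hχin y h] using hy1
        · have := (hy1.const_mul (χ y)).add ((hy2 h hyr).const_mul (1 - χ y))
          convert this using 2
          ring
      simpa using (h2.sub_const (A.indicator 1 y)).abs
  -- the errors of the gluing and of the calibration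
  have hK : IsCompact (Metric.closedBall (0 : EuclideanSpace ℝ (Fin d)) r₂) :=
    isCompact_closedBall _ _
  have hχD : ContDiff ℝ ∞ (fderiv ℝ χ) := hχ.fderiv_right (by simp)
  have hDχ0 : ∀ y, fderiv ℝ χ y ≠ 0 → r₁ ≤ ‖y‖ ∧ ‖y‖ ≤ r₂ := by
    intro y hy
    constructor
    · by_contra! h
      refine hy ?_
      have : χ =ᶠ[𝓝 y] fun _ ↦ 1 := by
        filter_upwards [(continuous_norm.continuousAt (x := y)).eventually_lt_const h] with z hz
        exact hχin z hz.le
      rw [this.fderiv_eq, fderiv_const_apply]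
    · by_contra! h
      refine hy ?_
      have : χ =ᶠ[𝓝 y] fun _ ↦ 0 := by
        filter_upwards [(continuous_norm.continuousAt (x := y)).eventually_const_lt h] with z hz
        exact hχout z (by linarith)
      rw [this.fderiv_eq, fderiv_const_apply]
  have hq1i : Continuous fun y ↦ ρ y * g.dualNrm y (fderiv ℝ χ y) :=
    hρ.continuous.mul (g.continuous_dualNrm hχD)
  have hq1c : HasCompactSupport fun y ↦ ρ y * g.dualNrm y (fderiv ℝ χ y) :=
    (hχc.fderiv (𝕜 := ℝ)).mono fun y hy h ↦ hy (by simp [h, dualNrm])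
  have hq1 := tendsto_integral_mul_of_ae (h := fun y ↦ ρ y * g.dualNrm y (fderiv ℝ χ y))
    (u := fun _ ↦ 0) (w := fun j y ↦ |m j y - σ j y|)
    (hq1i.integrable_of_hasCompactSupport hq1c)
    (fun j ↦ (((hms j).continuous.sub (hσs j).continuous).abs).aestronglyMeasurable)
    (fun j y ↦ by
      rw [abs_abs, abs_le]
      have h1 := hm01 j y
      have h2 := hσ01 j y
      simp only [mem_Icc] at h1 h2
      constructor <;> linarith) (by
      filter_upwards [hmlim, hσlim] with y hy1 hy2 hy3
      have h1 : fderiv ℝ χ y ≠ 0 := fun h ↦ hy3 (by simp [h, dualNrm])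
      have h2 := hDχ0 y h1
      simpa using (hy1.sub (hy2 h2.1 h2.2)).abs)
  simp only [mul_zero, integral_zero] at hq1
  set V : EuclideanSpace ℝ (Fin d) → EuclideanSpace ℝ (Fin d) := fun y ↦
    (ρ y * (ζ y * (1 - χ y))) • Z y with hV
  have hVs : ContDiff ℝ ∞ V := (hρ.mul (hζ.mul (contDiff_const.sub hχ))).smul hZ
  have hV0 : ∀ y, ¬ (r₁ ≤ ‖y‖ ∧ ‖y‖ ≤ s₃) → V y = 0 := by
    intro y hy
    rw [not_and_or, not_le, not_le] at hy
    rcases hy with h | h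
    · simp [hV, hχin y h.le]
    · simp [hV, hζ0 y h.le]
  have hVt : tsupport V ⊆ {y | r₁ ≤ ‖y‖ ∧ ‖y‖ ≤ s₃} := by
    refine closure_minimal (fun y hy ↦ ?_) ?_
    · by_contra h
      exact hy (hV0 y h)
    · exact (isClosed_le continuous_const continuous_norm).inter
        (isClosed_le continuous_norm continuous_const)
  have hVc : HasCompactSupport V := HasCompactSupport.of_support_subset_isCompact
    (isCompact_closedBall (0 : EuclideanSpace ℝ (Fin d)) s₃) fun y hy ↦ by
      simpa using (hVt (subset_tsupport _ hy)).2
  have hq2 := tendsto_integral_mul_of_ae (u := A.indicator 1) (w := σ)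
    (integrable_ediv (hVs.of_le (by simp)) hVc)
    (fun j ↦ (hσs j).continuous.aestronglyMeasurable)
    (fun j y ↦ by
      rw [abs_le]
      have h2 := hσ01 j y
      constructor <;> linarith [h2.1, h2.2]) (by
      filter_upwards [hσlim] with y hy1 hy2
      have h1 := hVt (support_ediv_subset hy2)
      exact hy1 h1.1 (h1.2.trans h3r.le))
  have hq2' : ∫ y, ediv V y * A.indicator 1 y = ∫ y in A, ediv V y := by
    rw [← integral_indicator hA]
    congr 1
    ext y
    by_cases hy : y ∈ A <;> simp [hy]
  rw [hq2'] at hq2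
  obtain ⟨Cf, hCf⟩ : ∃ Cf, ∀ y ∈ Metric.closedBall (0 : EuclideanSpace ℝ (Fin d)) r₂,
      ‖g.dualNrm y (fderiv ℝ f y)‖ ≤ Cf := hK.exists_bound_of_continuousOn
    (g.continuous_dualNrm (hf.fderiv_right (by simp))).continuousOn
  have hζc : HasCompactSupport ζ := HasCompactSupport.of_support_subset_isCompact
    (isCompact_closedBall (0 : EuclideanSpace ℝ (Fin d)) s₃) fun y hy ↦ by
      by_contra h
      rw [mem_closedBall_zero_iff, not_le] at h
      exact hy (hζ0 y h.le)
  have hiζ : Integrable fun y ↦ ρ y * ζ y :=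
    (hρ.continuous.mul hζ.continuous).integrable_of_hasCompactSupport hζc.mul_left
  set I := ∫ y, ρ y * ζ y with hI
  have hq3 : Tendsto (fun j : ℕ ↦ 2 * Cf / c ^ 2 * (1 / ((j : ℝ) + 1)) * I) atTop (𝓝 0) := by
    have := (tendsto_one_div_add_atTop_nhds_zero_nat (𝕜 := ℝ)).const_mul (2 * Cf / c ^ 2)
    simpa using this.mul_const I
  have hq2e := ((hq2.const_mul (1 + θ)).neg).eventually_lt_const
    (u := -((1 + θ) * ∫ y in A, ediv V y) + ε / 5) (by linarith)
  filter_upwards [hmev, hq1.eventually_lt_const (show 0 < ε / 5 by positivity), hq2e,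
    hq3.eventually_lt_const (show 0 < ε / 5 by positivity)]
    with j ⟨Y, hYs, hYt, hYn, hYe⟩ hj1 hj2 hj3
  have hρY : ContDiff ℝ ∞ (fun z ↦ ρ z • Y z) := hρ.smul hYs
  have hYc : HasCompactSupport (fun z ↦ ρ z • Y z) :=
    HasCompactSupport.of_support_subset_isCompact
      (isCompact_closedBall (0 : EuclideanSpace ℝ (Fin d)) s₃) fun y hy ↦
        hYt (subset_tsupport _ fun h ↦ hy (by simp [h]))
  refine ⟨fun y ↦ Y y + ((1 + θ) * (ζ y * (1 - χ y))) • Z y,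
    hYs.add ((contDiff_const.mul (hζ.mul (contDiff_const.sub hχ))).smul hZ), ?_, fun y ↦ ?_, ?_⟩
  · refine closure_minimal (fun y hy ↦ ?_) Metric.isClosed_closedBall
    by_contra h
    have h1 : Y y = 0 := by
      by_contra h2
      exact h (hYt (subset_tsupport _ h2))
    rw [mem_closedBall_zero_iff, not_le] at h
    exact hy (by simp [h1, hζ0 y h.le])
  · refine g.nrm_add_le.trans ?_
    have h1 := hYn y
    have h2 : 0 ≤ ζ y * (1 - χ y) := mul_nonneg (hζ01 y).1 (by linarith [hχle y])
    rw [nrm_smul, abs_of_nonneg (by positivity)]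
    have h3 := mul_le_mul_of_nonneg_left (hZ1 y)
      (show 0 ≤ (1 + θ) * (ζ y * (1 - χ y)) by positivity)
    have h4 := hχζ y
    have h5 := mul_nonneg hθ.le (hχ0 y)
    nlinarith
  · have h1 : ∀ y, ρ y * ζ y * g.dualNrm y (fderiv ℝ (w j) y) ≤
        ρ y * χ y * g.dualNrm y (fderiv ℝ (m j) y) +
        (1 + θ) * fderiv ℝ (σ j) y (V y) +
        (2 * Cf / c ^ 2 * (1 / ((j : ℝ) + 1))) * (ρ y * ζ y) +
        ρ y * g.dualNrm y (fderiv ℝ χ y) * |m j y - σ j y| := by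
      intro y
      have hρy := (hρ0 y).le
      have hζy := (hζ01 y).1
      have hd := g.dualNrm_nonneg y
      have hcs : 0 ≤ 1 - χ y := by linarith [hχle y]
      have e1 : fderiv ℝ (w j) y = χ y • fderiv ℝ (m j) y + (1 - χ y) • fderiv ℝ (σ j) y +
          (m j y - σ j y) • fderiv ℝ χ y := by
        have a1 := (hχ.differentiable (by simp) y).hasFDerivAt
        have a2 := ((hms j).differentiable (by simp) y).hasFDerivAt
        have a3 := ((hσs j).differentiable (by simp) y).hasFDerivAt
        have := (a1.mul a2).add ((a1.const_sub 1).mul a3)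
        rw [HasFDerivAt.fderiv (f := w j) this]
        ext z
        simp
        ring
      have e2 : g.dualNrm y (fderiv ℝ (w j) y) ≤ χ y * g.dualNrm y (fderiv ℝ (m j) y) +
          (1 - χ y) * g.dualNrm y (fderiv ℝ (σ j) y) +
          |m j y - σ j y| * g.dualNrm y (fderiv ℝ χ y) := by
        rw [e1]
        refine g.dualNrm_add_le.trans (add_le_add (g.dualNrm_add_le.trans (le_of_eq ?_)) ?_)
        · rw [dualNrm_smul, dualNrm_smul, abs_of_nonneg (hχ0 y), abs_of_nonneg hcs]
        · rw [dualNrm_smul]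
      have e3 : ρ y * ζ y * ((1 - χ y) * g.dualNrm y (fderiv ℝ (σ j) y)) ≤
          (1 + θ) * fderiv ℝ (σ j) y (V y) +
          (2 * Cf / c ^ 2 * (1 / ((j : ℝ) + 1))) * (ρ y * ζ y) := by
        by_cases hy : r₁ ≤ ‖y‖ ∧ ‖y‖ ≤ r₂
        · set L : ℝ := (j : ℝ) + 1 with hL
          have hL0 : 0 < L := by positivity
          set M := L * (Real.sigmoid (L * f y) * (1 - Real.sigmoid (L * f y))) with hM
          have hσ1 := hσ01 j y
          have hM0 : 0 ≤ M := mul_nonneg hL0.le (mul_nonneg hσ1.1 (by linarith [hσ1.2]))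
          have b1 : fderiv ℝ (σ j) y = M • fderiv ℝ f y := (hasFDerivAt_sigmoid_comp hf L y).fderiv
          have b0 : g.dualNrm y (fderiv ℝ f y) ≤ Cf :=
            (Real.le_norm_self _).trans (hCf y (by simpa using hy.2))
          have b2 : g.dualNrm y (fderiv ℝ (σ j) y) ≤ (1 + θ) * fderiv ℝ (σ j) y (Z y) +
              2 * Cf / c ^ 2 * (1 / L) := by
            rw [b1, dualNrm_smul, abs_of_nonneg hM0]
            simp only [smul_apply, smul_eq_mul]
            have b4 : 0 ≤ 2 * Cf / c ^ 2 * (1 / L) := by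
              have := (hd (fderiv ℝ f y)).trans b0
              positivity
            by_cases hfc : |f y| ≤ c
            · have := mul_le_mul_of_nonneg_left (hcal y hy.1 hy.2 hfc) hM0
              linarith
            · have b3 : M ≤ 2 / c ^ 2 * (1 / L) := by
                have h5 := sq_mul_sigmoid_mul_le (L * f y)
                have h6 : c ^ 2 ≤ f y ^ 2 := by
                  rw [← sq_abs (f y)]
                  exact pow_le_pow_left₀ hc.le (not_le.1 hfc).le 2
                have h7 : L * M * c ^ 2 ≤ 2 := by
                  refine le_trans ?_ h5
                  calc L * M * c ^ 2 ≤ L * M * f y ^ 2 :=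
                        mul_le_mul_of_nonneg_left h6 (by positivity)
                    _ = _ := by rw [hM]; ring
                rw [div_mul_div_comm, mul_one, le_div_iff₀ (by positivity)]
                linarith
              have b5 := mul_le_mul b3 b0 (hd _) (by positivity)
              have b6 : 0 ≤ (1 + θ) * (M * fderiv ℝ f y (Z y)) :=
                mul_nonneg (by linarith) (mul_nonneg hM0 (hfZ y))
              calc M * g.dualNrm y (fderiv ℝ f y) ≤ 2 / c ^ 2 * (1 / L) * Cf := b5
                _ = 2 * Cf / c ^ 2 * (1 / L) := by ring
                _ ≤ _ := by linarith
          have b7 : 0 ≤ ρ y * ζ y * (1 - χ y) := by positivity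
          have b8 := mul_le_mul_of_nonneg_left b2 b7
          have b9 : (2 * Cf / c ^ 2 * (1 / L)) * (ρ y * ζ y * (1 - χ y)) ≤
              (2 * Cf / c ^ 2 * (1 / L)) * (ρ y * ζ y) := by
            refine mul_le_mul_of_nonneg_left ?_ ?_
            · exact mul_le_of_le_one_right (by positivity) (by linarith [hχ0 y])
            · have := (hd (fderiv ℝ f y)).trans b0
              positivity
          simp only [hV, map_smul, smul_eq_mul]
          linarith
        · have hz : ζ y * (1 - χ y) = 0 := by
            rw [not_and_or, not_le, not_le] at hy
            rcases hy with h | h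
            · simp [hχin y h.le]
            · simp [hζ0 y (by linarith)]
          have hVy : V y = 0 := by simp [hV, hz]
          have hz2 : ρ y * ζ y * ((1 - χ y) * g.dualNrm y (fderiv ℝ (σ j) y)) = 0 := by
            rw [show ρ y * ζ y * ((1 - χ y) * g.dualNrm y (fderiv ℝ (σ j) y)) =
              ρ y * (ζ y * (1 - χ y)) * g.dualNrm y (fderiv ℝ (σ j) y) by ring, hz]
            ring
          rw [hz2, hVy, map_zero, mul_zero, zero_add]
          have : 0 ≤ Cf := (norm_nonneg _).trans (hCf 0 (by
            rw [mem_closedBall_zero_iff, norm_zero]; linarith))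
          positivity
      have e4 : ρ y * ζ y * (|m j y - σ j y| * g.dualNrm y (fderiv ℝ χ y)) ≤
          ρ y * g.dualNrm y (fderiv ℝ χ y) * |m j y - σ j y| := by
        have b1 : 0 ≤ ρ y * g.dualNrm y (fderiv ℝ χ y) * |m j y - σ j y| :=
          mul_nonneg (mul_nonneg hρy (hd _)) (abs_nonneg _)
        have b2 := mul_le_of_le_one_right b1 (hζ01 y).2
        linarith
      have e5 : ρ y * ζ y * (χ y * g.dualNrm y (fderiv ℝ (m j) y)) =
          ρ y * χ y * g.dualNrm y (fderiv ℝ (m j) y) := by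
        rw [← hχζ y]
        have := hχζ y
        calc _ = ρ y * (χ y * ζ y * ζ y) * g.dualNrm y (fderiv ℝ (m j) y) := by ring
          _ = ρ y * (χ y * ζ y) * g.dualNrm y (fderiv ℝ (m j) y) := by rw [this, this]
      have e6 := mul_le_mul_of_nonneg_left e2 (mul_nonneg hρy hζy)
      rw [mul_add, mul_add, e5] at e6
      linarith
    have i1 : Integrable fun y ↦ ρ y * χ y * g.dualNrm y (fderiv ℝ (m j) y) :=
      ((hρ.continuous.mul hχ.continuous).mul (g.continuous_dualNrm
        ((hms j).fderiv_right (by simp)))).integrable_of_hasCompactSupport hχc.mul_left.mul_right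
    have i2 : Integrable fun y ↦ fderiv ℝ (σ j) y (V y) :=
      (((hσs j).continuous_fderiv (by simp)).clm_apply
        hVs.continuous).integrable_of_hasCompactSupport
        (hVc.mono fun y hy h ↦ hy (by simp [h]))
    have i3 : Integrable fun y ↦ ρ y * g.dualNrm y (fderiv ℝ χ y) * |m j y - σ j y| :=
      (hq1i.mul ((hms j).continuous.sub (hσs j).continuous).abs).integrable_of_hasCompactSupport
        hq1c.mul_right
    have i0 : Integrable fun y ↦ ρ y * ζ y * g.dualNrm y (fderiv ℝ (w j) y) :=
      ((hρ.continuous.mul hζ.continuous).mul (g.continuous_dualNrm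
        ((hws j).fderiv_right (by simp)))).integrable_of_hasCompactSupport hζc.mul_left.mul_right
    have i12 : Integrable fun y ↦ ρ y * χ y * g.dualNrm y (fderiv ℝ (m j) y) +
        (1 + θ) * fderiv ℝ (σ j) y (V y) := i1.add (i2.const_mul (1 + θ))
    have i4 := hiζ.const_mul (2 * Cf / c ^ 2 * (1 / ((j : ℝ) + 1)))
    have i124 : Integrable fun y ↦ ρ y * χ y * g.dualNrm y (fderiv ℝ (m j) y) +
        (1 + θ) * fderiv ℝ (σ j) y (V y) +
        (2 * Cf / c ^ 2 * (1 / ((j : ℝ) + 1))) * (ρ y * ζ y) := i12.add i4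
    have h2 := integral_mono i0 (i124.add i3) h1
    simp only [Pi.add_apply] at h2
    rw [integral_add i124 i3, integral_add i12 i4, integral_add i1 (i2.const_mul (1 + θ)),
      integral_const_mul, integral_const_mul] at h2
    have h3 := integral_mul_ediv ((hσs j).of_le (by simp) : ContDiff ℝ 1 (σ j))
      (hVs.of_le (by simp)) hVc
    have h4 : ∫ y, ediv V y * σ j y = ∫ y, σ j y * ediv V y := by
      congr 1; ext y; ring
    rw [h4, h3] at hj2
    have h5 : ∫ y in A, ediv (fun z ↦ ρ z • (Y z + ((1 + θ) * (ζ z * (1 - χ z))) • Z z)) y =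
        (∫ y in A, ediv (fun z ↦ ρ z • Y z) y) + (1 + θ) * ∫ y in A, ediv V y := by
      rw [← integral_const_mul, ← integral_add
        (integrable_ediv (hρY.of_le (by simp)) hYc).integrableOn
        ((integrable_ediv (hVs.of_le (by simp)) hVc).integrableOn.const_mul _)]
      congr 1
      ext y
      have e1 : (fun z ↦ ρ z • (Y z + ((1 + θ) * (ζ z * (1 - χ z))) • Z z)) =
          fun z ↦ ρ z • Y z + (1 + θ) • V z := by
        ext1 z
        simp only [hV, smul_add, smul_smul]
        ring_nf
      rw [e1]
      have d1 := (hρY.differentiable (by simp)) y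
      have d2 := (hVs.differentiable (by simp)) y
      have := ediv_add d1 (d2.const_smul (1 + θ))
      have h6 := ediv_const_smul (1 + θ) d2
      exact this.trans (congrArg _ h6)
    rw [h5]
    linarith

end Approximants

/-! ### Smoothing a set in a Euclidean ball -/

section Smoothing

variable {d : ℕ}

lemma contDiff_smul_field {k : EuclideanSpace ℝ (Fin d) → ℝ}
    {W : EuclideanSpace ℝ (Fin d) → EuclideanSpace ℝ (Fin d)} (hk : ContDiff ℝ ∞ k)
    (hW : ContDiff ℝ ∞ W) : ContDiff ℝ ∞ (fun z ↦ k z • W z) := hk.smul hW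

lemma hasCompactSupport_smul_field (k : EuclideanSpace ℝ (Fin d) → ℝ)
    {W : EuclideanSpace ℝ (Fin d) → EuclideanSpace ℝ (Fin d)} (hW : HasCompactSupport W) :
    HasCompactSupport (fun z ↦ k z • W z) := hW.mono fun y hy h ↦ hy (by simp [h])

/-- Cutting a weighted field into two parts. -/
lemma setIntegral_ediv_split {ρ ζ : EuclideanSpace ℝ (Fin d) → ℝ} (hρ : ContDiff ℝ ∞ ρ)
    (hζ : ContDiff ℝ ∞ ζ) {W : EuclideanSpace ℝ (Fin d) → EuclideanSpace ℝ (Fin d)}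
    (hW : ContDiff ℝ ∞ W) (hWc : HasCompactSupport W) (S : Set (EuclideanSpace ℝ (Fin d))) :
    ∫ y in S, ediv (fun z ↦ ρ z • W z) y = (∫ y in S, ediv (fun z ↦ (ρ z * ζ z) • W z) y) +
      ∫ y in S, ediv (fun z ↦ (ρ z * (1 - ζ z)) • W z) y := by
  have h1 : ContDiff ℝ ∞ (fun z ↦ (ρ z * ζ z) • W z) := contDiff_smul_field (hρ.mul hζ) hW
  have h2 : ContDiff ℝ ∞ (fun z ↦ (ρ z * (1 - ζ z)) • W z) :=
    contDiff_smul_field (hρ.mul (contDiff_const.sub hζ)) hW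
  rw [← integral_add
    (integrable_ediv (h1.of_le (by simp)) (hasCompactSupport_smul_field _ hWc)).integrableOn
    (integrable_ediv (h2.of_le (by simp)) (hasCompactSupport_smul_field _ hWc)).integrableOn]
  congr 1
  ext y
  have e1 : (fun z ↦ ρ z • W z) = fun z ↦ (ρ z * ζ z) • W z + (ρ z * (1 - ζ z)) • W z := by
    ext1 z
    rw [← add_smul]
    congr 1
    ring
  rw [e1]
  exact ediv_add (h1.differentiable (by simp) y) (h2.differentiable (by simp) y)

/-- A small tilt of a function hardly changes its weighted total variation. -/
lemma SmoothMetric.integral_dualNrm_tilt_le (g : SmoothMetric d)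
    {ρ ζ u₀ : EuclideanSpace ℝ (Fin d) → ℝ} (hρ : ContDiff ℝ ∞ ρ) (hρ0 : ∀ y, 0 < ρ y)
    (hζ : ContDiff ℝ ∞ ζ) (hζ01 : ∀ y, ζ y ∈ Icc 0 1) (hζc : HasCompactSupport ζ)
    (hu₀ : ContDiff ℝ ∞ u₀) {B : Set (EuclideanSpace ℝ (Fin d))} (hζB : ∀ y ∉ B, ζ y = 0)
    {C δ : ℝ} (hC : 0 ≤ C) (hdual : ∀ y ∈ B, ∀ l, g.dualNrm y l ≤ C * ‖l‖)
    {a : EuclideanSpace ℝ (Fin d)} (ha : ‖a‖ ≤ δ) :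
    ∫ y, ρ y * ζ y * g.dualNrm y (fderiv ℝ (fun y ↦ u₀ y + inner ℝ a y) y) ≤
      (∫ y, ρ y * ζ y * g.dualNrm y (fderiv ℝ u₀ y)) + C * δ * ∫ y, ρ y * ζ y := by
  have hDu : ∀ y, fderiv ℝ (fun y ↦ u₀ y + inner ℝ a y) y = fderiv ℝ u₀ y + innerSL ℝ a :=
    fun y ↦
    ((hu₀.differentiable (by simp) y).hasFDerivAt.add (innerSL ℝ a).hasFDerivAt).fderiv
  have hus : ContDiff ℝ ∞ fun y ↦ u₀ y + inner ℝ a y :=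
    hu₀.add (contDiff_const.inner ℝ contDiff_id)
  have i0 : Integrable fun y ↦
      ρ y * ζ y * g.dualNrm y (fderiv ℝ (fun y ↦ u₀ y + inner ℝ a y) y) :=
    ((hρ.continuous.mul hζ.continuous).mul (g.continuous_dualNrm
      (hus.fderiv_right (by simp)))).integrable_of_hasCompactSupport hζc.mul_left.mul_right
  have i1 : Integrable fun y ↦ ρ y * ζ y * g.dualNrm y (fderiv ℝ u₀ y) :=
    ((hρ.continuous.mul hζ.continuous).mul (g.continuous_dualNrm
      (hu₀.fderiv_right (by simp)))).integrable_of_hasCompactSupport hζc.mul_left.mul_right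
  have i2 : Integrable fun y ↦ C * δ * (ρ y * ζ y) :=
    ((hρ.continuous.mul hζ.continuous).integrable_of_hasCompactSupport hζc.mul_left).const_mul _
  rw [← integral_const_mul, ← integral_add i1 i2]
  refine integral_mono i0 (i1.add i2) fun y ↦ ?_
  dsimp only
  rw [hDu]
  have h3 : 0 ≤ ρ y * ζ y := mul_nonneg (hρ0 y).le (hζ01 y).1
  by_cases hy : y ∈ B
  · have h4 : g.dualNrm y (innerSL ℝ a) ≤ C * δ := by
      refine (hdual y hy _).trans ?_
      rw [innerSL_apply_norm]
      exact mul_le_mul_of_nonneg_left ha hC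
    have h5 := g.dualNrm_add_le (y := y) (l := fderiv ℝ u₀ y) (l' := innerSL ℝ a)
    have h6 := mul_le_mul_of_nonneg_left (h5.trans (add_le_add_right h4 _)) h3
    rw [mul_add] at h6
    linarith
  · rw [hζB y hy]
    simp

/-- The flux of a field bounded by `ξ` through the part of a level set near which that level set is
calibrated. -/
lemma SmoothMetric.outer_flux_le (g : SmoothMetric d)
    {ρ ζ ξ v : EuclideanSpace ℝ (Fin d) → ℝ} (hρ : ContDiff ℝ ∞ ρ) (hρ0 : ∀ y, 0 < ρ y)
    (hζ : ContDiff ℝ ∞ ζ) (hζ01 : ∀ y, ζ y ∈ Icc 0 1) (hξ : ContDiff ℝ ∞ ξ)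
    (hξ01 : ∀ y, ξ y ∈ Icc 0 1) (hξc : HasCompactSupport ξ) (hv : ContDiff ℝ ∞ v)
    {Z W : EuclideanSpace ℝ (Fin d) → EuclideanSpace ℝ (Fin d)} (hZ : ContDiff ℝ ∞ Z)
    (hW : ContDiff ℝ ∞ W) (hWc : HasCompactSupport W) (hWn : ∀ y, g.nrm y (W y) ≤ ξ y)
    {θ δ : ℝ} (hδ : 0 < δ) (hcal : ∀ y, ζ y ≠ 1 → ξ y ≠ 0 → |v y| ≤ δ →
      g.dualNrm y (fderiv ℝ v y) ≤ (1 + θ) * fderiv ℝ v y (Z y)) :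
    ∫ y in {y | 0 < v y}, ediv (fun z ↦ (ρ z * (1 - ζ z)) • W z) y ≤
      -((1 + θ) * ∫ y in {y | 0 < v y}, ediv (fun z ↦ (ρ z * ((1 - ζ z) * ξ z)) • Z z) y) := by
  have hV₃s : ContDiff ℝ ∞ (fun z ↦ (ρ z * ((1 - ζ z) * ξ z)) • Z z) :=
    contDiff_smul_field (hρ.mul ((contDiff_const.sub hζ).mul hξ)) hZ
  have hV₃c : HasCompactSupport (fun z ↦ (ρ z * ((1 - ζ z) * ξ z)) • Z z) :=
    hξc.mono fun y hy h ↦ hy (by simp [h])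
  have hV₃e : ∀ y, ediv (fun z ↦ (1 + θ) • ((ρ z * ((1 - ζ z) * ξ z)) • Z z)) y =
      (1 + θ) * ediv (fun z ↦ (ρ z * ((1 - ζ z) * ξ z)) • Z z) y := fun y ↦
    ediv_const_smul _ (hV₃s.differentiable (by simp) y)
  rw [← integral_const_mul]
  simp_rw [← hV₃e]
  have hV₂s : ContDiff ℝ ∞ (fun z ↦ (ρ z * (1 - ζ z)) • W z) :=
    contDiff_smul_field (hρ.mul (contDiff_const.sub hζ)) hW
  refine integral_ediv_le_of_calibrated hv hV₂s (hasCompactSupport_smul_field _ hWc)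
    (contDiff_smul_field contDiff_const hV₃s) (hasCompactSupport_smul_field _ hV₃c) hδ
    fun y hy1 hy2 ↦ ?_
  simp only [map_smul, smul_eq_mul]
  have h1 := neg_le_of_abs_le (g.abs_apply_le y (fderiv ℝ v y) (W y))
  have hd := g.dualNrm_nonneg y (fderiv ℝ v y)
  have h2 : g.dualNrm y (fderiv ℝ v y) * g.nrm y (W y) ≤ g.dualNrm y (fderiv ℝ v y) * ξ y :=
    mul_le_mul_of_nonneg_left (hWn y) hd
  have h3 : 0 ≤ ρ y * (1 - ζ y) := mul_nonneg (hρ0 y).le (by linarith [(hζ01 y).2])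
  by_cases hy3 : ζ y = 1
  · simp [hy3]
  by_cases hy4 : ξ y = 0
  · rw [hy4] at h2 ⊢
    have : -fderiv ℝ v y (W y) ≤ 0 := by linarith
    have := mul_le_mul_of_nonneg_left this h3
    linarith
  · have h4 := hcal y hy3 hy4 (by rw [abs_of_nonneg hy1]; exact hy2)
    have h5 := mul_le_mul_of_nonneg_right h4 (hξ01 y).1
    have h6 : -fderiv ℝ v y (W y) ≤ (1 + θ) * fderiv ℝ v y (Z y) * ξ y := by linarith
    have h7 := mul_le_mul_of_nonneg_left h6 h3
    linarith

/-- The flux of a field of length at most one through the part of a level set selected by the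
cutoff `ζ`. -/
lemma SmoothMetric.inner_flux_le (g : SmoothMetric d)
    {ρ ζ u v : EuclideanSpace ℝ (Fin d) → ℝ} (hρ : ContDiff ℝ ∞ ρ) (hρ0 : ∀ y, 0 < ρ y)
    (hζ : ContDiff ℝ ∞ ζ) (hζ01 : ∀ y, ζ y ∈ Icc 0 1) {r t C : ℝ} (hζ0 : ∀ y, r ≤ ‖y‖ → ζ y = 0)
    (hu : Continuous u) (hv : Continuous v) (hvu : ∀ y, ‖y‖ ≤ r → v y = u y - t)
    {W : EuclideanSpace ℝ (Fin d) → EuclideanSpace ℝ (Fin d)}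
    (hW : ContDiff ℝ ∞ W) (hWc : HasCompactSupport W) (hWn : ∀ y, g.nrm y (W y) ≤ 1)
    (htlev : ∀ V : EuclideanSpace ℝ (Fin d) → EuclideanSpace ℝ (Fin d),
      ContDiff ℝ ∞ V → HasCompactSupport V →
      (∀ y, -fderiv ℝ u y (V y) ≤ ρ y * ζ y * g.dualNrm y (fderiv ℝ u y)) →
      ∫ y in {y | t < u y}, ediv V y ≤ C) :
    ∫ y in {y | 0 < v y}, ediv (fun z ↦ (ρ z * ζ z) • W z) y ≤ C := by
  have e1 : ∫ y in {y | 0 < v y}, ediv (fun z ↦ (ρ z * ζ z) • W z) y =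
      ∫ y in {y | t < u y}, ediv (fun z ↦ (ρ z * ζ z) • W z) y := by
    rw [← integral_indicator (measurableSet_superlevel hv 0),
      ← integral_indicator (measurableSet_superlevel hu t)]
    congr 1
    ext y
    by_cases h0 : ediv (fun z ↦ (ρ z * ζ z) • W z) y = 0
    · simp [indicator, h0]
    · have h1 : tsupport (fun z ↦ (ρ z * ζ z) • W z) ⊆ Metric.closedBall 0 r := by
        refine closure_minimal (fun z hz ↦ ?_) Metric.isClosed_closedBall
        by_contra h
        rw [mem_closedBall_zero_iff, not_le] at h
        exact hz (by simp [hζ0 z h.le])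
      have h2 : ‖y‖ ≤ r := by simpa using h1 (support_ediv_subset h0)
      simp [indicator, hvu y h2]
  rw [e1]
  refine htlev _ (contDiff_smul_field (hρ.mul hζ) hW) (hasCompactSupport_smul_field _ hWc)
    fun y ↦ ?_
  have h1 := neg_le_of_abs_le (g.abs_apply_le y (fderiv ℝ u y) (W y))
  have h2 : g.dualNrm y (fderiv ℝ u y) * g.nrm y (W y) ≤ g.dualNrm y (fderiv ℝ u y) :=
    mul_le_of_le_one_right (g.dualNrm_nonneg _ _) (hWn y)
  have h3 : 0 ≤ ρ y * ζ y := mul_nonneg (hρ0 y).le (hζ01 y).1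
  simp only [map_smul, smul_eq_mul]
  have h4 := mul_le_mul_of_nonneg_left (show -fderiv ℝ u y (W y) ≤
    g.dualNrm y (fderiv ℝ u y) by linarith) h3
  linarith

set_option maxHeartbeats 800000 in
/-- Smoothing of a set `A` in a ball of `ℝ^d`, when `A` has a regular defining function `f` in the
annulus `r₁ ≤ |y| ≤ r₂`. The smooth set `{v > 0}` agrees with `A` where `s ≤ |y| ≤ r₂`, it is close
to `A` in volume, and the fluxes through its boundary of all fields bounded by `ξ` are nearly
bounded by the flux of one field `Y` through the boundary of `A`. -/
theorem SmoothMetric.exists_smooth_superlevel (g : SmoothMetric d)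
    {ρ f ξ : EuclideanSpace ℝ (Fin d) → ℝ} (hρ : ContDiff ℝ ∞ ρ) (hρ0 : ∀ y, 0 < ρ y)
    {A : Set (EuclideanSpace ℝ (Fin d))} (hA : MeasurableSet A) (hf : ContDiff ℝ ∞ f)
    {r₁ s r' r₂ : ℝ} (hr₁ : 0 < r₁) (h1s : r₁ < s) (hsr : s < r') (hrr : r' ≤ r₂)
    (hAf : ∀ᵐ y, r₁ ≤ ‖y‖ → ‖y‖ ≤ r₂ → (y ∈ A ↔ 0 < f y))
    (hf0 : ∀ y, r₁ ≤ ‖y‖ → ‖y‖ ≤ r₂ → f y = 0 → fderiv ℝ f y ≠ 0)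
    (hξ : ContDiff ℝ ∞ ξ) (hξ01 : ∀ y, ξ y ∈ Icc 0 1) (hξ1 : ∀ y, ‖y‖ ≤ s → ξ y = 1)
    (hξ0 : ∀ y, r' ≤ ‖y‖ → ξ y = 0) {κ : ℝ} (hκ : 0 < κ) :
    ∃ v : EuclideanSpace ℝ (Fin d) → ℝ, ContDiff ℝ ∞ v ∧
      (∀ y, ‖y‖ ≤ r₂ → v y = 0 → fderiv ℝ v y ≠ 0) ∧
      (∀ y, s ≤ ‖y‖ → ‖y‖ ≤ r₂ → (0 < v y ↔ 0 < f y)) ∧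
      volume.real (symmDiff {y | 0 < v y} A ∩ Metric.closedBall 0 r₂) ≤ κ ∧
      ∃ Y : EuclideanSpace ℝ (Fin d) → EuclideanSpace ℝ (Fin d),
        ContDiff ℝ ∞ Y ∧ tsupport Y ⊆ Metric.closedBall 0 r' ∧
        (∀ y, g.nrm y (Y y) ≤ ξ y + κ) ∧
        ∀ W : EuclideanSpace ℝ (Fin d) → EuclideanSpace ℝ (Fin d), ContDiff ℝ ∞ W →
          HasCompactSupport W → (∀ y, g.nrm y (W y) ≤ ξ y) →
          ∫ y in {y | 0 < v y}, ediv (fun z ↦ ρ z • W z) y ≤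
            (∫ y in A, ediv (fun z ↦ ρ z • Y z) y) + κ := by
  -- the constants
  obtain ⟨θ, hθ, hθ16, hθκ⟩ : ∃ θ : ℝ, 0 < θ ∧ θ ≤ 1 / 16 ∧ θ ≤ κ / 16 :=
    ⟨min (1 / 16) (κ / 16), by positivity, min_le_left _ _, min_le_right _ _⟩
  set lam : ℝ := (1 - θ - θ)⁻¹ with hlam
  have hlam0 : 0 < lam := inv_pos.2 (by linarith)
  have hlam1 : 1 ≤ lam := (one_le_inv₀ (by linarith)).2 (by linarith)
  have hlam2 : lam ≤ 2 := inv_le_of_inv_le₀ (by norm_num) (by linarith)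
  have hlamθ : lam * (1 + θ) ≤ 1 + κ / 2 := by
    rw [hlam, inv_mul_le_iff₀ (by linarith)]
    nlinarith
  set ε := κ / 6 with hε
  have hε0 : 0 < ε := by positivity
  have hr₂ : 0 < r₂ := by linarith
  -- the two inner cutoffs
  let ζb : ContDiffBump (0 : EuclideanSpace ℝ (Fin d)) :=
    ⟨r₁ + (s - r₁) / 3, r₁ + 2 * (s - r₁) / 3, by linarith, by linarith⟩
  let ηb : ContDiffBump (0 : EuclideanSpace ℝ (Fin d)) :=
    ⟨r₁ + 2 * (s - r₁) / 3, s, by linarith, by linarith⟩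
  set ζ : EuclideanSpace ℝ (Fin d) → ℝ := fun y ↦ ζb y with hζdef
  set η : EuclideanSpace ℝ (Fin d) → ℝ := fun y ↦ ηb y with hηdef
  obtain ⟨s₂, hs₂⟩ : ∃ s₂, s₂ = r₁ + (s - r₁) / 3 := ⟨_, rfl⟩
  obtain ⟨s₃, hs₃⟩ : ∃ s₃, s₃ = r₁ + 2 * (s - r₁) / 3 := ⟨_, rfl⟩
  have hζ : ContDiff ℝ ∞ ζ := ζb.contDiff
  have hη : ContDiff ℝ ∞ η := ηb.contDiff
  have hζ01 : ∀ y, ζ y ∈ Icc 0 1 := fun y ↦ ⟨ζb.nonneg, ζb.le_one⟩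
  have hη01 : ∀ y, η y ∈ Icc 0 1 := fun y ↦ ⟨ηb.nonneg, ηb.le_one⟩
  have hζ1 : ∀ y, ‖y‖ ≤ s₂ → ζ y = 1 := fun y hy ↦
    ζb.one_of_mem_closedBall (by simpa [hs₂] using hy)
  have hζ0 : ∀ y, s₃ ≤ ‖y‖ → ζ y = 0 := fun y hy ↦ ζb.zero_of_le_dist (by simpa [hs₃] using hy)
  have hη1 : ∀ y, ‖y‖ ≤ s₃ → η y = 1 := fun y hy ↦
    ηb.one_of_mem_closedBall (by simpa [hs₃] using hy)
  have hη0 : ∀ y, s ≤ ‖y‖ → η y = 0 := fun y hy ↦ ηb.zero_of_le_dist (by simpa using hy)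
  have hs12 : r₁ < s₂ := by linarith
  have hs23 : s₂ < s₃ := by linarith
  have hs3 : s₃ < s := by linarith
  clear_value ζ η
  have hζc : HasCompactSupport ζ := HasCompactSupport.of_support_subset_isCompact
    (isCompact_closedBall (0 : EuclideanSpace ℝ (Fin d)) s₃) fun y hy ↦ by
      by_contra h
      rw [mem_closedBall_zero_iff, not_le] at h
      exact hy (hζ0 y h.le)
  have hηc : HasCompactSupport η := HasCompactSupport.of_support_subset_isCompact
    (isCompact_closedBall (0 : EuclideanSpace ℝ (Fin d)) s) fun y hy ↦ by
      by_contra h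
      rw [mem_closedBall_zero_iff, not_le] at h
      exact hy (hη0 y h.le)
  have hξt : tsupport ξ ⊆ Metric.closedBall 0 r' := by
    refine closure_minimal (fun y hy ↦ ?_) Metric.isClosed_closedBall
    by_contra h
    rw [mem_closedBall_zero_iff, not_le] at h
    exact hy (hξ0 y h.le)
  have hξc : HasCompactSupport ξ := (isCompact_closedBall _ _).of_isClosed_subset
    (isClosed_tsupport _) hξt
  have hξζ : ∀ y, ζ y ≠ 0 → ξ y = 1 := fun y hy ↦ hξ1 y (by
    by_contra! h
    exact hy (hζ0 y (by linarith)))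
  -- the calibrating field
  set B := Metric.closedBall (0 : EuclideanSpace ℝ (Fin d)) r₂ with hB
  have hBc : IsCompact B := isCompact_closedBall _ _
  have hBm : MeasurableSet B := Metric.isClosed_closedBall.measurableSet
  have hmemB : ∀ {y}, y ∈ B ↔ ‖y‖ ≤ r₂ := fun {y} ↦ mem_closedBall_zero_iff
  obtain ⟨κ₁, c, hκ₁, hc, hcal⟩ := g.exists_calibration hf
    (K := B ∩ {y | r₁ ≤ ‖y‖}) (hBc.inter_right (isClosed_le continuous_const continuous_norm))
    (fun y hy ↦ hf0 y hy.2 (hmemB.1 hy.1)) (θ := θ / 2) (by positivity)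
  set Z : EuclideanSpace ℝ (Fin d) → EuclideanSpace ℝ (Fin d) := fun y ↦
    g.unitGrad κ₁ y (fderiv ℝ f y) with hZdef
  have hZ : ContDiff ℝ ∞ Z := g.contDiff_unitGrad hκ₁ (hf.fderiv_right (by simp))
  have hZ1 : ∀ y, g.nrm y (Z y) ≤ 1 := fun y ↦ g.nrm_unitGrad_le
  have hfZ : ∀ y, 0 ≤ fderiv ℝ f y (Z y) := fun y ↦ g.apply_unitGrad_nonneg
  obtain ⟨w, hws, hwσ, hwlim, hwev⟩ := g.exists_approximants hρ hρ0 hA hf hr₁ hs12 hs23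
    (show s₃ < r₂ by linarith) hAf hf0 hζ hζ01 hζ1 hζ0 hZ hZ1 hfZ hθ hc
    (fun y h1 h2 h3 ↦ (hcal y ⟨hmemB.2 h2, h1⟩ h3).2.trans (by nlinarith [hfZ y])) hε0
  obtain ⟨Cg, hCg, hdual⟩ := g.exists_dualNrm_le hBc
  obtain ⟨Mη, hMη⟩ := (hη.continuous_fderiv (by simp)).bounded_above_of_compact_support
    (hηc.fderiv (𝕜 := ℝ))
  have hMη0 : 0 ≤ Mη := (norm_nonneg _).trans (hMη 0)
  obtain ⟨L₀, hL₀⟩ := g.exists_sigmoid_calibrated hθ hθ (by linarith : θ ≤ 1) hc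
    (show 0 < Cg * (Mη + 1) by positivity)
  set V₃ : EuclideanSpace ℝ (Fin d) → EuclideanSpace ℝ (Fin d) := fun y ↦
    (ρ y * ((1 - ζ y) * ξ y)) • Z y with hV₃
  have hV₃s : ContDiff ℝ ∞ V₃ := contDiff_smul_field (hρ.mul ((contDiff_const.sub hζ).mul hξ)) hZ
  have hV₃c : HasCompactSupport V₃ := hξc.mono fun y hy h ↦ hy (by simp [hV₃, h])
  have hV₃ξ : tsupport V₃ ⊆ tsupport ξ := closure_mono fun y hy ↦ fun h ↦ hy (by simp [hV₃, h])
  have hV₃t : tsupport V₃ ⊆ B := hV₃ξ.trans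
    (hξt.trans (Metric.closedBall_subset_closedBall hrr))
  obtain ⟨C₃, hC₃⟩ := (continuous_ediv (hV₃s.of_le (by simp))).bounded_above_of_compact_support
    (hasCompactSupport_ediv hV₃c)
  have hC₃0 : 0 ≤ C₃ := (norm_nonneg _).trans (hC₃ 0)
  -- the approximant, steep and close to `A`
  obtain ⟨q, hq0, hqκ, hqC⟩ : ∃ q, 0 < q ∧ q ≤ κ ∧ C₃ * q ≤ ε :=
    ⟨min κ (ε / (C₃ + 1)), by positivity, min_le_left _ _, by
      refine (mul_le_mul_of_nonneg_left (min_le_right _ _) hC₃0).trans ?_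
      rw [← mul_div_assoc, div_le_iff₀ (by positivity)]
      nlinarith⟩
  have hjL : ∀ᶠ j : ℕ in atTop, L₀ ≤ (j : ℝ) + 1 := by
    filter_upwards [tendsto_natCast_atTop_atTop.eventually_ge_atTop L₀] with j hj
    linarith
  obtain ⟨j, ⟨Yin, hYs, hYt, hYn, hYe⟩, hjq, hjL⟩ := (hwev.and
    ((hwlim.eventually_lt_const (show 0 < θ / 2 * q by positivity)).and hjL)).exists
  replace hws := hws j
  replace hwσ := hwσ j
  set u₀ := w j with hu₀
  clear_value u₀
  -- the tilt and the level
  set I := ∫ y, ρ y * ζ y with hI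
  have hI0 : 0 ≤ I := integral_nonneg fun y ↦ mul_nonneg (hρ0 y).le (hζ01 y).1
  obtain ⟨δ₀, hδ₀, hδ1, hδr, hδI⟩ : ∃ δ₀ : ℝ, 0 < δ₀ ∧ δ₀ ≤ 1 ∧ δ₀ * r₂ ≤ θ / 2 ∧
      Cg * δ₀ * I ≤ ε := by
    refine ⟨min 1 (min (θ / 2 / r₂) (ε / (Cg * (I + 1)))), by positivity, min_le_left _ _, ?_, ?_⟩
    · have := (min_le_right 1 (min (θ / 2 / r₂) (ε / (Cg * (I + 1))))).trans (min_le_left _ _)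
      rwa [le_div_iff₀ hr₂] at this
    · have h := (min_le_right 1 (min (θ / 2 / r₂) (ε / (Cg * (I + 1))))).trans (min_le_right _ _)
      rw [le_div_iff₀ (by positivity)] at h
      have : 0 ≤ min 1 (min (θ / 2 / r₂) (ε / (Cg * (I + 1)))) := by positivity
      nlinarith
  obtain ⟨a, ha, hreg⟩ := exists_ae_regular hws hδ₀
  set u : EuclideanSpace ℝ (Fin d) → ℝ := fun y ↦ u₀ y + inner ℝ a y with hu
  have hus : ContDiff ℝ ∞ u := hws.add (contDiff_const.inner ℝ contDiff_id)
  have hDu : ∀ y, fderiv ℝ u y = fderiv ℝ u₀ y + innerSL ℝ a := fun y ↦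
    ((hws.differentiable (by simp) y).hasFDerivAt.add (innerSL ℝ a).hasFDerivAt).fderiv
  set h : EuclideanSpace ℝ (Fin d) → ℝ := fun y ↦ ρ y * ζ y * g.dualNrm y (fderiv ℝ u y) with hh
  have hhc : Continuous h := (hρ.continuous.mul hζ.continuous).mul
    (g.continuous_dualNrm (hus.fderiv_right (by simp)))
  have hhs : HasCompactSupport h := hζc.mul_left.mul_right
  have hh0 : ∀ y, 0 ≤ h y := fun y ↦
    mul_nonneg (mul_nonneg (hρ0 y).le (hζ01 y).1) (g.dualNrm_nonneg _ _)
  obtain ⟨t, ht, htreg, htlev⟩ := exists_level_integral_ediv_le hus hhc hh0 hhs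
    (show θ < 1 - θ by linarith) hreg
  rw [← hlam] at htlev
  have hba : ∀ y, ‖y‖ ≤ r₂ → |t - 1 / 2 - inner ℝ a y| ≤ 1 / 2 - θ / 2 := by
    intro y hy
    have h1 : |inner ℝ a y| ≤ θ / 2 := (abs_real_inner_le_norm a y).trans
      ((mul_le_mul ha hy (norm_nonneg _) hδ₀.le).trans hδr)
    rw [abs_le] at h1 ⊢
    constructor <;> linarith [ht.1, ht.2]
  -- `{v > 0}` is `{u > t}` where `η = 1`, and `{f > 0}` where `η = 0` and `u₀ = σ ((j + 1) f)`
  set v : EuclideanSpace ℝ (Fin d) → ℝ := fun y ↦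
    u₀ y - 1 / 2 - η y * (t - 1 / 2 - inner ℝ a y) with hv
  have hbs : ContDiff ℝ ∞ (fun y ↦ t - 1 / 2 - inner ℝ a y) :=
    contDiff_const.sub (contDiff_const.inner ℝ contDiff_id)
  have hvs : ContDiff ℝ ∞ v := (hws.sub contDiff_const).sub (hη.mul hbs)
  have hvu : ∀ y, ‖y‖ ≤ s₃ → v y = u y - t := fun y hy ↦ by
    simp only [hv, hu, hη1 y hy]; ring
  -- outside the mollified region `u₀` is so steep that tilt and cutoff do not spoil calibration
  have hout : ∀ y, s₂ < ‖y‖ → ‖y‖ ≤ r₂ → |v y| ≤ θ / 4 →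
      g.dualNrm y (fderiv ℝ v y) ≤ (1 + θ) * fderiv ℝ v y (Z y) ∧ 0 < fderiv ℝ v y (Z y) := by
    intro y hy1 hy2 hvy
    set L : ℝ := (j : ℝ) + 1
    have e1 : HasFDerivAt u₀ ((L * (Real.sigmoid (L * f y) * (1 - Real.sigmoid (L * f y)))) •
        fderiv ℝ f y) y := by
      refine (hasFDerivAt_sigmoid_comp hf L y).congr_of_eventuallyEq ?_
      filter_upwards [(continuous_norm.continuousAt (x := y)).eventually_const_lt hy1] with z hz
      exact hwσ z hz.le
    have e2 := (hη.differentiable (by simp) y).hasFDerivAt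
    have e3 : HasFDerivAt (fun y ↦ t - 1 / 2 - inner ℝ a y) (-innerSL ℝ a) y :=
      (innerSL ℝ a).hasFDerivAt.const_sub (t - 1 / 2)
    have e4 := (e1.sub_const (1 / 2)).sub (e2.mul e3)
    set b := t - 1 / 2 - inner ℝ a y with hb
    have hby := hba y hy2
    rw [← hb] at hby
    have e5 : fderiv ℝ v y = (L * (Real.sigmoid (L * f y) * (1 - Real.sigmoid (L * f y)))) •
        fderiv ℝ f y + (η y • innerSL ℝ a - b • fderiv ℝ η y) := by
      rw [HasFDerivAt.fderiv (f := v) e4, smul_neg]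
      abel
    rw [e5]
    have hηy := hη01 y
    refine hL₀ L hjL (f y) y (Z y) _ _ (hZ1 y) (fun h ↦ hcal y ⟨hmemB.2 hy2, by
      simp only [mem_ofPred_eq]; linarith⟩ h) ?_ ?_
    · refine (hdual y (hmemB.2 hy2) _).trans ?_
      refine mul_le_mul_of_nonneg_left ?_ hCg.le
      refine (norm_sub_le _ _).trans ?_
      rw [norm_smul, norm_smul, innerSL_apply_norm, Real.norm_of_nonneg hηy.1, Real.norm_eq_abs]
      have h1 : η y * ‖a‖ ≤ 1 * 1 :=
        mul_le_mul hηy.2 (ha.trans hδ1) (norm_nonneg _) zero_le_one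
      have h2 : |b| * ‖fderiv ℝ η y‖ ≤ 1 * Mη :=
        mul_le_mul (by linarith) (hMη y) (norm_nonneg _) zero_le_one
      linarith
    · rw [← hwσ y hy1.le]
      have h1 : u₀ y - 1 / 2 = v y + η y * b := by simp only [hv, hb]; ring
      rw [h1]
      refine (abs_add_le _ _).trans ?_
      rw [abs_mul, abs_of_nonneg hηy.1]
      have : η y * |b| ≤ 1 * (1 / 2 - θ / 2) :=
        mul_le_mul hηy.2 hby (abs_nonneg _) zero_le_one
      linarith
  have hS : MeasurableSet {y | 0 < v y} := measurableSet_superlevel hvs.continuous 0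
  -- Chebyshev's inequality: on the symmetric difference `u₀` differs from the indicator of `A`
  -- by at least `θ / 2`
  have hvol : volume.real (symmDiff {y | 0 < v y} A ∩ B) ≤ q := by
    have hi : IntegrableOn (fun y ↦ |u₀ y - A.indicator 1 y|) B := by
      refine Integrable.abs ((hws.continuous.continuousOn.integrableOn_compact hBc).sub ?_)
      exact (integrableOn_const (C := (1 : ℝ)) hBc.measure_ne_top).indicator hA
    have h1 := mul_meas_ge_le_integral_of_nonneg (μ := volume.restrict B)
      (f := fun y ↦ |u₀ y - A.indicator 1 y|) (ae_of_all _ fun y ↦ abs_nonneg _) hi (θ / 2)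
    have h2 : volume.real (symmDiff {y | 0 < v y} A ∩ B) ≤
        (volume.restrict B).real {y | θ / 2 ≤ |u₀ y - A.indicator 1 y|} := by
      rw [measureReal_restrict_apply' hBm]
      refine measureReal_mono (fun y hy ↦ ⟨?_, hy.2⟩)
        (measure_ne_top_of_subset inter_subset_right hBc.measure_ne_top)
      have h3 := hba y (hmemB.1 hy.2)
      have hηy := hη01 y
      have h4 : |η y * (t - 1 / 2 - inner ℝ a y)| ≤ 1 / 2 - θ / 2 := by
        rw [abs_mul, abs_of_nonneg hηy.1]
        exact (mul_le_of_le_one_left (abs_nonneg _) hηy.2).trans h3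
      rw [abs_le] at h4
      simp only [mem_ofPred_eq, le_abs]
      rcases hy.1 with ⟨h5, h6⟩ | ⟨h5, h6⟩
      · rw [indicator_of_notMem h6]
        simp only [mem_ofPred_eq, hv] at h5
        left; linarith
      · rw [indicator_of_mem h5]
        simp only [mem_ofPred_eq, hv, not_lt] at h6
        simp only [Pi.one_apply]
        right; linarith
    have h3 := h1.trans hjq.le
    exact h2.trans (le_of_mul_le_mul_left h3 (by positivity))
  refine ⟨v, hvs, fun y hy hvy ↦ ?_, fun y hy1 hy2 ↦ ?_, hvol.trans hqκ, ?_⟩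
  · rcases lt_or_ge ‖y‖ s₃ with hy3 | hy3
    · have e1 : v =ᶠ[𝓝 y] fun z ↦ u z - t := by
        filter_upwards [(continuous_norm.continuousAt (x := y)).eventually_lt_const hy3] with z hz
        exact hvu z hz.le
      rw [e1.fderiv_eq, fderiv_sub_const]
      refine htreg y ?_
      have := hvu y hy3.le
      rw [hvy] at this
      simp only [hu] at this
      linarith
    · intro h0
      have := (hout y (by linarith) hy (by rw [hvy, abs_zero]; positivity)).2
      simp [h0] at this
  · have h1 : v y = Real.sigmoid (((j : ℝ) + 1) * f y) - Real.sigmoid 0 := by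
      simp only [hv, hη0 y hy1, hwσ y (by linarith), Real.sigmoid_zero]
      ring
    rw [h1, sub_pos, Real.sigmoid_lt_iff]
    exact mul_pos_iff_of_pos_left (by positivity)
  have hρY : ContDiff ℝ ∞ (fun z ↦ ρ z • Yin z) := contDiff_smul_field hρ hYs
  have hYc : HasCompactSupport (fun z ↦ ρ z • Yin z) :=
    HasCompactSupport.of_support_subset_isCompact
      (isCompact_closedBall (0 : EuclideanSpace ℝ (Fin d)) s₃) fun y hy ↦
        hYt (subset_tsupport _ fun h ↦ hy (by simp [h]))
  have hY₁s : ContDiff ℝ ∞ (fun y ↦ (-lam) • Yin y) :=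
    contDiff_smul_field contDiff_const hYs
  have hY₂s : ContDiff ℝ ∞ (fun y ↦ (-((1 + θ) * ((1 - ζ y) * ξ y))) • Z y) :=
    contDiff_smul_field (contDiff_const.mul ((contDiff_const.sub hζ).mul hξ)).neg hZ
  refine ⟨fun y ↦ (-lam) • Yin y + (-((1 + θ) * ((1 - ζ y) * ξ y))) • Z y,
    hY₁s.add hY₂s, ?_, fun y ↦ ?_, ?_⟩
  · refine closure_minimal (fun y hy ↦ ?_) Metric.isClosed_closedBall
    by_contra h
    have h1 : Yin y = 0 := by
      by_contra h2
      exact h (Metric.closedBall_subset_closedBall (by linarith) (hYt (subset_tsupport _ h2)))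
    rw [mem_closedBall_zero_iff, not_le] at h
    exact hy (by simp [h1, hξ0 y h.le])
  · refine g.nrm_add_le.trans ?_
    have h2 : 0 ≤ (1 - ζ y) * ξ y := mul_nonneg (by linarith [(hζ01 y).2]) (hξ01 y).1
    have h6 : 0 ≤ (1 + θ) * ((1 - ζ y) * ξ y) := by positivity
    rw [nrm_smul, nrm_smul, abs_neg, abs_neg, abs_of_pos hlam0, abs_of_nonneg h6]
    have h3 := mul_le_mul_of_nonneg_left (hZ1 y) h6
    have h4 := mul_le_mul_of_nonneg_left (hYn y) hlam0.le
    have h5 : ζ y + (1 - ζ y) * ξ y = ξ y := by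
      by_cases hz : ζ y = 0
      · simp [hz]
      · simp [hξζ y hz]
    have h7 : (1 + θ) * ((1 - ζ y) * ξ y) ≤ lam * ((1 + θ) * ((1 - ζ y) * ξ y)) :=
      le_mul_of_one_le_left h6 hlam1
    have h8 : lam * (1 + θ) * ξ y ≤ (1 + κ / 2) * ξ y :=
      mul_le_mul_of_nonneg_right hlamθ (hξ01 y).1
    have h9 : κ / 2 * ξ y ≤ κ / 2 := mul_le_of_le_one_right (by positivity) (hξ01 y).2
    have h10 : lam * ε ≤ κ / 3 := by
      have := mul_le_mul_of_nonneg_right hlam2 hε0.le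
      linarith
    have h11 : lam * (1 + θ) * ξ y =
        lam * ((1 + θ) * ζ y) + lam * ((1 + θ) * ((1 - ζ y) * ξ y)) := by
      have := congrArg (fun x ↦ lam * (1 + θ) * x) h5
      linarith
    linarith
  intro W hW hWc hWn
  -- splitting of the flux into an inner and an outer part
  have hin := g.inner_flux_le hρ hρ0 hζ hζ01 hζ0 hus.continuous hvs.continuous hvu hW hWc
    (fun y ↦ (hWn y).trans (hξ01 y).2) htlev
  have hhi := g.integral_dualNrm_tilt_le hρ hρ0 hζ hζ01 hζc hws (B := B)
    (fun y hy ↦ hζ0 y (by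
      rw [hmemB, not_le] at hy
      linarith)) hCg.le hdual ha
  have hout2 := g.outer_flux_le hρ hρ0 hζ hζ01 hξ hξ01 hξc hvs hZ hW hWc hWn
    (show 0 < θ / 4 by positivity) (fun y hy1 hy2 hy3 ↦ (hout y
      (not_le.1 fun h ↦ hy1 (hζ1 y h))
      (not_lt.1 fun h ↦ hy2 (hξ0 y (by linarith))) hy3).1)
  have hint : ∀ V : EuclideanSpace ℝ (Fin d) → EuclideanSpace ℝ (Fin d), ContDiff ℝ ∞ V →
      HasCompactSupport V → Integrable (ediv V) := fun V h1 h2 ↦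
    integrable_ediv (h1.of_le (by simp)) h2
  have hcmp := abs_setIntegral_sub_le (hint V₃ hV₃s hV₃c) hS hA hBm hBc.measure_ne_top hC₃
    (fun y hy ↦ by
      by_contra h0
      exact hy (hV₃t (support_ediv_subset h0)))
  have hcmp2 := (abs_le.1 (hcmp.trans ((mul_le_mul_of_nonneg_left hvol hC₃0).trans hqC))).1
  have hYeq : ∫ y in A, ediv (fun z ↦ ρ z •
      ((-lam) • Yin z + (-((1 + θ) * ((1 - ζ z) * ξ z))) • Z z)) y =
      -(lam * ∫ y in A, ediv (fun z ↦ ρ z • Yin z) y) - (1 + θ) * ∫ y in A, ediv V₃ y := by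
    have i1 : IntegrableOn (fun y ↦ -(lam * ediv (fun z ↦ ρ z • Yin z) y)) A :=
      ((hint _ hρY hYc).integrableOn.const_mul lam).neg
    rw [← integral_const_mul, ← integral_const_mul, ← integral_neg, ← integral_sub
      i1 ((hint V₃ hV₃s hV₃c).integrableOn.const_mul _)]
    congr 1
    ext y
    have e1 : (fun z ↦ ρ z • ((-lam) • Yin z + (-((1 + θ) * ((1 - ζ z) * ξ z))) • Z z)) =
        fun z ↦ (-lam) • (ρ z • Yin z) + (-(1 + θ)) • V₃ z := by
      ext1 z
      simp only [hV₃, smul_add, smul_smul]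
      ring_nf
    rw [e1]
    have d1 := (hρY.differentiable (by simp)) y
    have d2 := (hV₃s.differentiable (by simp)) y
    refine (ediv_add (d1.const_smul (-lam)) (d2.const_smul (-(1 + θ)))).trans ?_
    have h6 := ediv_const_smul (-lam) d1
    have h7 := ediv_const_smul (-(1 + θ)) d2
    refine (congrArg₂ _ h6 h7).trans ?_
    ring
  rw [setIntegral_ediv_split hρ hζ hW hWc, hYeq]
  have f1 := mul_le_mul_of_nonneg_left (hhi.trans (add_le_add hYe hδI)) hlam0.le
  have f2 : lam * ε ≤ 2 * ε := mul_le_mul_of_nonneg_right hlam2 hε0.le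
  have f3 := mul_le_mul_of_nonneg_left hcmp2 (show 0 ≤ 1 + θ by linarith)
  have f4 : θ * ε ≤ 1 / 16 * ε := mul_le_mul_of_nonneg_right hθ16 hε0.le
  linarith

end Smoothing

/-! ### Perimeter and fluxes -/

section Perimeter

variable {n : ℕ} {N : Type*} [MetricSpace N] [ChartedSpace (EuclideanSpace ℝ (Fin (n + 1))) N]
  {X Y : ∀ x : N, TangentSpace (𝓡 (n + 1)) x}
  [IsManifold (𝓡 (n + 1)) ∞ N]

lemma contMDiff_field_add
    (hX : ContMDiff (𝓡 (n + 1)) (𝓡 (n + 1)).tangent ∞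
      (fun x ↦ (⟨x, X x⟩ : TangentBundle (𝓡 (n + 1)) N)))
    (hY : ContMDiff (𝓡 (n + 1)) (𝓡 (n + 1)).tangent ∞
      (fun x ↦ (⟨x, Y x⟩ : TangentBundle (𝓡 (n + 1)) N))) :
    ContMDiff (𝓡 (n + 1)) (𝓡 (n + 1)).tangent ∞
      (fun x ↦ (⟨x, X x + Y x⟩ : TangentBundle (𝓡 (n + 1)) N)) :=
  ContMDiff.add_section hX hY

lemma contMDiff_field_const_smul (a : ℝ)
    (hX : ContMDiff (𝓡 (n + 1)) (𝓡 (n + 1)).tangent ∞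
      (fun x ↦ (⟨x, X x⟩ : TangentBundle (𝓡 (n + 1)) N))) :
    ContMDiff (𝓡 (n + 1)) (𝓡 (n + 1)).tangent ∞
      (fun x ↦ (⟨x, a • X x⟩ : TangentBundle (𝓡 (n + 1)) N)) :=
  ContMDiff.const_smul_section hX

variable [Bundle.RiemannianBundle (fun x : N ↦ TangentSpace (𝓡 (n + 1)) x)]
  [MeasurableSpace N] [BorelSpace N] {F G : Set N}

lemma integral_divergence_le_perimeter (hF : perimeter n F ≠ ⊤)
    (hX : ContMDiff (𝓡 (n + 1)) (𝓡 (n + 1)).tangent ∞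
      (fun x ↦ (⟨x, X x⟩ : TangentBundle (𝓡 (n + 1)) N))) (hX1 : ∀ x, ‖X x‖ ≤ 1) :
    ∫ x in F, divergence X x ∂(vol n N) ≤ (perimeter n F).toReal := by
  have h : ENNReal.ofReal (∫ x in F, divergence X x ∂(vol n N)) ≤ perimeter n F :=
    le_iSup_of_le X (le_iSup_of_le hX (le_iSup_of_le hX1 le_rfl))
  exact ENNReal.ofReal_le_iff_le_toReal hF |>.1 h

lemma perimeter_le {C : ℝ}
    (h : ∀ X : ∀ x : N, TangentSpace (𝓡 (n + 1)) x, ContMDiff (𝓡 (n + 1)) (𝓡 (n + 1)).tangent ∞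
      (fun x ↦ (⟨x, X x⟩ : TangentBundle (𝓡 (n + 1)) N)) → (∀ x, ‖X x‖ ≤ 1) →
      ∫ x in F, divergence X x ∂(vol n N) ≤ C) : perimeter n F ≤ ENNReal.ofReal C :=
  iSup_le fun X ↦ iSup_le fun hX ↦ iSup_le fun hX1 ↦ ENNReal.ofReal_le_ofReal (h X hX hX1)

variable [IsContMDiffRiemannianBundle (𝓡 (n + 1)) ∞ (EuclideanSpace ℝ (Fin (n + 1)))
      (fun x : N ↦ TangentSpace (𝓡 (n + 1)) x)]

lemma integral_divergence_le_mul_perimeter (hF : perimeter n F ≠ ⊤)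
    (hX : ContMDiff (𝓡 (n + 1)) (𝓡 (n + 1)).tangent ∞
      (fun x ↦ (⟨x, X x⟩ : TangentBundle (𝓡 (n + 1)) N))) {a : ℝ} (ha : 0 < a)
    (hXa : ∀ x, ‖X x‖ ≤ a) :
    ∫ x in F, divergence X x ∂(vol n N) ≤ a * (perimeter n F).toReal := by
  have h := integral_divergence_le_perimeter hF (contMDiff_field_const_smul a⁻¹ hX) (fun x ↦ by
    rw [norm_smul, Real.norm_of_nonneg (by positivity), inv_mul_le_iff₀ ha, mul_one]
    exact hXa x)
  simp_rw [divergence_const_smul a⁻¹ hX] at h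
  rwa [integral_const_mul, inv_mul_le_iff₀ ha] at h

lemma abs_setIntegral_sub_le_of_symmDiff {Ω : Type*} [MeasurableSpace Ω] {μ : Measure Ω}
    [IsFiniteMeasure μ] {h : Ω → ℝ} {F G : Set Ω} (hh : Integrable h μ)
    (hF : NullMeasurableSet F μ) (hG : NullMeasurableSet G μ) {M : ℝ} (hM : ∀ x, |h x| ≤ M) :
    |(∫ x in G, h x ∂μ) - ∫ x in F, h x ∂μ| ≤ M * μ.real (symmDiff G F) := by
  have hm : NullMeasurableSet (symmDiff G F) μ := (hG.diff hF).union (hF.diff hG)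
  rw [← integral_indicator₀ hG, ← integral_indicator₀ hF,
    ← integral_sub (hh.indicator₀ hG) (hh.indicator₀ hF)]
  refine (abs_integral_le_integral_abs).trans ?_
  refine (integral_mono_of_nonneg (g := (symmDiff G F).indicator fun _ ↦ M)
    (ae_of_all _ fun y ↦ abs_nonneg _)
    ((integrable_const M).indicator₀ hm) (ae_of_all _ fun x ↦ ?_)).trans ?_
  · have h1 := hM x
    have h0 := (abs_nonneg _).trans h1
    by_cases h3 : x ∈ G <;> by_cases h4 : x ∈ F <;>
      simp [indicator, h3, h4, Set.mem_symmDiff, h1]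
  · rw [integral_indicator₀ hm, setIntegral_const, smul_eq_mul, mul_comm]

variable [IsRiemannianManifold (𝓡 (n + 1)) N] [CompactSpace N]

/-- Lower semicontinuity of the perimeter with respect to convergence in volume. -/
lemma exists_perimeter_ge (hF : IsCaccioppoli n F) {δ : ℝ} (hδ : 0 < δ) :
    ∃ ε, 0 < ε ∧ ∀ G : Set N, IsCaccioppoli n G → (vol n N).real (symmDiff G F) ≤ ε →
      (perimeter n F).toReal - δ ≤ (perimeter n G).toReal := by
  obtain ⟨X, hX, hX1, h⟩ : ∃ X : ∀ x : N, TangentSpace (𝓡 (n + 1)) x,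
      ∃ _ : ContMDiff (𝓡 (n + 1)) (𝓡 (n + 1)).tangent ∞
        (fun x ↦ (⟨x, X x⟩ : TangentBundle (𝓡 (n + 1)) N)), ∃ _ : ∀ x, ‖X x‖ ≤ 1,
      (perimeter n F).toReal - δ / 2 ≤ ∫ x in F, divergence X x ∂(vol n N) := by
    by_contra! hcon
    have h1 : perimeter n F ≤ ENNReal.ofReal ((perimeter n F).toReal - δ / 2) :=
      perimeter_le fun X hX hX1 ↦ (hcon X hX hX1).le
    rw [ENNReal.le_ofReal_iff_toReal_le hF.2] at h1
    · linarith
    · have h2 := hcon (fun _ ↦ 0) (Bundle.contMDiff_zeroSection ℝ _) (fun x ↦ by simp)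
      have h3 : ∀ x : N, divergence (fun x : N ↦ (0 : TangentSpace (𝓡 (n + 1)) x)) x = 0 :=
        fun x ↦ divergence_eq_zero_of_eventually (Eventually.of_forall fun _ ↦ rfl)
      simp_rw [h3] at h2
      simp only [integral_zero] at h2
      exact h2.le
  obtain ⟨M, hM⟩ := isCompact_univ.exists_bound_of_continuousOn
    (continuous_divergence hX).continuousOn
  refine ⟨δ / 2 / (|M| + 1), by positivity, fun G hG hGF ↦ ?_⟩
  have h1 := abs_setIntegral_sub_le_of_symmDiff (integrable_divergence hX) hF.1 hG.1
    (M := |M|) (fun x ↦ (hM x (mem_univ x)).trans (le_abs_self M))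
  have h2 := integral_divergence_le_perimeter hG.2 hX hX1
  rw [le_div_iff₀ (by positivity)] at hGF
  have h3 := (abs_le.1 h1).1
  have h4 : 0 ≤ (vol n N).real (symmDiff G F) := measureReal_nonneg
  nlinarith

end Perimeter

/-! ### A defining function near a smooth boundary -/

section DefiningFunction

variable {n : ℕ} {N : Type*} [MetricSpace N] [ChartedSpace (EuclideanSpace ℝ (Fin (n + 1))) N]
  [IsManifold (𝓡 (n + 1)) ∞ N] {c : OpenPartialHomeomorph N (EuclideanSpace ℝ (Fin (n + 1)))}
  {E : Set N}

lemma mem_iff_of_isPreconnected {α : Type*} [TopologicalSpace α] {S E : Set α}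
    (hS : IsPreconnected S) (h : ∀ x ∈ S, x ∉ frontier E) {x y : α} (hx : x ∈ S) (hy : y ∈ S) :
    x ∈ E ↔ y ∈ E := by
  have key : ∀ {x y : α}, x ∈ S → y ∈ S → x ∈ E → y ∈ E := by
    intro x y hx hy hxE
    by_contra hyE
    have hint : ∀ z ∈ S, z ∈ E → z ∈ interior E := fun z hz hzE ↦ by
      by_contra h1
      exact h z hz ⟨subset_closure hzE, h1⟩
    have hext : ∀ z ∈ S, z ∉ E → z ∈ (closure E)ᶜ := fun z hz hzE h1 ↦
      h z hz ⟨h1, fun h2 ↦ hzE (interior_subset h2)⟩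
    obtain ⟨z, -, hz1, hz2⟩ := hS (interior E) (closure E)ᶜ isOpen_interior
      isClosed_closure.isOpen_compl (fun z hz ↦ by
        by_cases hzE : z ∈ E
        · exact Or.inl (hint z hz hzE)
        · exact Or.inr (hext z hz hzE)) ⟨x, hx, hint x hx hxE⟩ ⟨y, hy, hext y hy hyE⟩
    exact hz2 (subset_closure (interior_subset hz1))
  exact ⟨key hx hy, key hy hx⟩

lemma exists_apply_pos {G : Type*} [NormedAddCommGroup G] [NormedSpace ℝ G] {l : G →L[ℝ] ℝ}
    (hl : l ≠ 0) : ∃ e, 0 < l e := by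
  by_contra! hcon
  refine hl (ContinuousLinearMap.ext fun e ↦ le_antisymm (hcon e) ?_)
  have := hcon (-e)
  rw [map_neg] at this
  simpa using this

/-- At a zero of `T`, the values of `T` are positive in any direction of increase. -/
lemma eventually_pos_of_fderiv_pos {G : Type*} [NormedAddCommGroup G] [NormedSpace ℝ G]
    {T : G → ℝ} {z e : G} (hT : DifferentiableAt ℝ T z) (h0 : T z = 0) (he : 0 < fderiv ℝ T z e) :
    ∀ᶠ s in 𝓝[>] (0 : ℝ), 0 < T (z + s • e) := by
  have hline : HasDerivAt (fun s : ℝ ↦ T (z + s • e)) (fderiv ℝ T z e) 0 := by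
    have h1 : HasDerivAt (fun s : ℝ ↦ z + s • e) e 0 := by
      simpa using ((hasDerivAt_id (0 : ℝ)).smul_const e).const_add z
    have h2 : HasFDerivAt T (fderiv ℝ T z) (z + (0 : ℝ) • e) := by
      simpa using hT.hasFDerivAt
    exact h2.comp_hasDerivAt 0 h1
  have := (hasDerivAt_iff_tendsto_slope.1 hline).eventually_const_lt he
  have h2 : ∀ᶠ s in 𝓝[>] (0 : ℝ), 0 < slope (fun s : ℝ ↦ T (z + s • e)) 0 s :=
    this.filter_mono (nhdsWithin_mono _ fun s hs ↦ ne_of_gt hs)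
  filter_upwards [h2, self_mem_nhdsWithin] with s hs1 hs2
  rw [slope_def_field] at hs1
  simp only [zero_smul, add_zero, h0, sub_zero] at hs1
  exact (div_pos_iff_of_pos_right hs2).1 hs1

lemma fderiv_nonneg_of_eventually_nonneg {G : Type*} [NormedAddCommGroup G] [NormedSpace ℝ G]
    {T : G → ℝ} {z e : G} (hT : DifferentiableAt ℝ T z) (h0 : T z = 0)
    (h : ∀ᶠ s in 𝓝[>] (0 : ℝ), 0 ≤ T (z + s • e)) : 0 ≤ fderiv ℝ T z e := by
  by_contra! hneg
  have h1 := eventually_pos_of_fderiv_pos (T := fun z ↦ -T z) (e := e) hT.neg (by simp [h0])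
    (by rw [fderiv_fun_neg]; simpa using hneg)
  obtain ⟨s, hs1, hs2⟩ := (h.and h1).exists
  linarith

/-- Local defining functions of a subset of `ℝ^d` add up, after multiplication by cutoffs, to a
defining function near a compact set: at a boundary point their differentials are nonnegative
multiples of each other. -/
lemma exists_defining_of_local {d : ℕ} {P : EuclideanSpace ℝ (Fin d) → Prop}
    {K : Set (EuclideanSpace ℝ (Fin d))} (hK : IsCompact K)
    (hloc : ∀ y ∈ K, ∃ V : Set (EuclideanSpace ℝ (Fin d)), IsOpen V ∧ y ∈ V ∧
      ∃ f : EuclideanSpace ℝ (Fin d) → ℝ, ContDiffOn ℝ ∞ f V ∧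
        (∀ z ∈ V, P z ↔ 0 < f z) ∧ ∀ z ∈ V, f z = 0 → fderiv ℝ f z ≠ 0) :
    ∃ f : EuclideanSpace ℝ (Fin d) → ℝ, ContDiff ℝ ∞ f ∧
      ∀ z ∈ K, (P z ↔ 0 < f z) ∧ (f z = 0 → fderiv ℝ f z ≠ 0) := by
  have hcut : ∀ y ∈ K, ∃ T : EuclideanSpace ℝ (Fin d) → ℝ, ∃ U ∈ 𝓝 y, ContDiff ℝ ∞ T ∧
      (∀ z, P z → 0 ≤ T z) ∧ (∀ z, ¬ P z → T z ≤ 0) ∧ (∀ z ∈ U, P z → 0 < T z) ∧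
      ∀ z ∈ U, T z = 0 → ∃ e, 0 < fderiv ℝ T z e ∧ ∀ᶠ s in 𝓝[>] (0 : ℝ), P (z + s • e) := by
    intro y hy
    obtain ⟨V, hV, hyV, f, hf, hPf, hf0⟩ := hloc y hy
    obtain ⟨r, hr, hrV⟩ := Metric.nhds_basis_closedBall.mem_iff.1 (hV.mem_nhds hyV)
    let b : ContDiffBump y := ⟨r / 2, r, by positivity, by linarith⟩
    have hbV : ∀ z, b z ≠ 0 → z ∈ V := fun z hz ↦ by
      have : z ∈ Function.support b := hz
      rw [b.support_eq] at this
      exact hrV (Metric.ball_subset_closedBall this)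
    have hT : ContDiff ℝ ∞ (fun z ↦ b z * f z) := by
      refine contDiff_iff_contDiffAt.2 fun z ↦ ?_
      by_cases hz : z ∈ Metric.closedBall y r
      · exact b.contDiffAt.mul (hf.contDiffAt (hV.mem_nhds (hrV hz)))
      · have : (fun z ↦ b z * f z) =ᶠ[𝓝 z] fun _ ↦ 0 := by
          filter_upwards [Metric.isClosed_closedBall.isOpen_compl.mem_nhds hz] with q hq
          have : b q = 0 := by
            by_contra h
            have h1 : q ∈ Function.support b := h
            rw [b.support_eq] at h1
            exact hq (Metric.ball_subset_closedBall h1)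
          simp [this]
        exact contDiffAt_const.congr_of_eventuallyEq this
    have hTf : ∀ z ∈ Metric.ball y (r / 2), (fun z ↦ b z * f z) =ᶠ[𝓝 z] f := fun z hz ↦ by
      filter_upwards [b.eventuallyEq_one_of_mem_ball hz] with q hq
      simp [hq]
    have hsub : Metric.ball y (r / 2) ⊆ V := fun z hz ↦
      hrV (Metric.ball_subset_closedBall (Metric.ball_subset_ball (by linarith) hz))
    refine ⟨fun z ↦ b z * f z, Metric.ball y (r / 2), Metric.ball_mem_nhds _ (by positivity),
      hT, fun z hz ↦ ?_, fun z hz ↦ ?_, fun z hz hP ↦ ?_, fun z hz h0 ↦ ?_⟩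
    · by_cases h : b z = 0
      · simp [h]
      · exact mul_nonneg b.nonneg ((hPf z (hbV z h)).1 hz).le
    · by_cases h : b z = 0
      · simp [h]
      · exact mul_nonpos_of_nonneg_of_nonpos b.nonneg
          (not_lt.1 fun h2 ↦ hz ((hPf z (hbV z h)).2 h2))
    · exact ((hPf z (hsub hz)).1 hP).trans_eq (hTf z hz).eq_of_nhds.symm
    · have h1 : fderiv ℝ (fun z ↦ b z * f z) z ≠ 0 := by
        rw [(hTf z hz).fderiv_eq]
        exact hf0 z (hsub hz) ((hTf z hz).eq_of_nhds.symm.trans h0)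
      obtain ⟨e, he⟩ := exists_apply_pos h1
      refine ⟨e, he, ?_⟩
      have h2 := eventually_pos_of_fderiv_pos (hT.differentiable (by simp) z) h0 he
      have h3 : ∀ᶠ s in 𝓝[>] (0 : ℝ), z + s • e ∈ Metric.ball y (r / 2) := by
        have : ContinuousAt (fun s : ℝ ↦ z + s • e) 0 := by fun_prop
        exact (this.eventually_mem (Metric.isOpen_ball.mem_nhds (by simpa using hz))).filter_mono
          nhdsWithin_le_nhds
      filter_upwards [h2, h3] with s hs1 hs2
      refine (hPf _ (hsub hs2)).2 ?_
      exact hs1.trans_eq (hTf _ hs2).eq_of_nhds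
  choose! T U hU hTs hTp hTn hTU hTe using hcut
  obtain ⟨t, htK, hcov⟩ := hK.elim_nhds_subcover U hU
  refine ⟨fun z ↦ ∑ y ∈ t, T y z, ContDiff.sum fun y hy ↦ hTs y (htK y hy), fun z hz ↦ ?_⟩
  obtain ⟨y₁, hy₁, hz₁⟩ := mem_iUnion₂.1 (hcov hz)
  have hpos : P z → 0 < ∑ y ∈ t, T y z := fun hP ↦
    Finset.sum_pos' (fun y hy ↦ hTp y (htK y hy) z hP) ⟨y₁, hy₁, hTU y₁ (htK y₁ hy₁) z hz₁ hP⟩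
  have hneg : ¬ P z → ∑ y ∈ t, T y z ≤ 0 := fun hP ↦
    Finset.sum_nonpos fun y hy ↦ hTn y (htK y hy) z hP
  refine ⟨⟨hpos, fun h ↦ by_contra fun hP ↦ (hneg hP).not_gt h⟩, fun h0 hD ↦ ?_⟩
  have hP : ¬ P z := fun hP ↦ (hpos hP).ne' h0
  have hall : ∀ y ∈ t, T y z = 0 :=
    (Finset.sum_eq_zero_iff_of_nonpos fun y hy ↦ hTn y (htK y hy) z hP).1 h0
  obtain ⟨e, he, hPe⟩ := hTe y₁ (htK y₁ hy₁) z hz₁ (hall y₁ hy₁)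
  have hd : ∀ y ∈ t, DifferentiableAt ℝ (T y) z := fun y hy ↦
    (hTs y (htK y hy)).differentiable (by simp) z
  have h1 : fderiv ℝ (fun z ↦ ∑ y ∈ t, T y z) z e = ∑ y ∈ t, fderiv ℝ (T y) z e := by
    rw [fderiv_fun_sum hd]
    simp
  have h2 : 0 < ∑ y ∈ t, fderiv ℝ (T y) z e :=
    Finset.sum_pos' (fun y hy ↦ fderiv_nonneg_of_eventually_nonneg (hd y hy) (hall y hy)
      (hPe.mono fun s hs ↦ hTp y (htK y hy) _ hs)) ⟨y₁, hy₁, he⟩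
  rw [← h1, hD] at h2
  simp at h2

/-- On the positive side of a regular level set that carries the boundary of `E`, membership in
`E` is locally constant up to the level set: one moves in a direction of increase and then inside
a small ball. -/
lemma exists_side {h : EuclideanSpace ℝ (Fin (n + 1)) → ℝ}
    {V : Set (EuclideanSpace ℝ (Fin (n + 1)))} (hV : IsOpen V) (hVt : V ⊆ c.target)
    (hh : ContDiffOn ℝ ∞ h V) {y₀ : EuclideanSpace ℝ (Fin (n + 1))} (hy₀ : y₀ ∈ V)
    (h0 : h y₀ = 0) (hD : fderiv ℝ h y₀ ≠ 0)
    (hE : ∀ z ∈ V, c.symm z ∈ frontier E → h z = 0) :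
    ∃ P : Prop, ∀ᶠ z in 𝓝 y₀, 0 < h z → (c.symm z ∈ E ↔ P) := by
  obtain ⟨e, he⟩ := exists_apply_pos hD
  have hdiff : ∀ z ∈ V, DifferentiableAt ℝ h z := fun z hz ↦
    (hh.differentiableOn (by simp)).differentiableAt (hV.mem_nhds hz)
  have hcont : ContinuousAt (fun z ↦ fderiv ℝ h z e) y₀ :=
    ((hh.continuousOn_fderiv_of_isOpen hV (by simp)).clm_apply
      continuousOn_const).continuousAt (hV.mem_nhds hy₀)
  obtain ⟨r, hr, hball⟩ := Metric.mem_nhds_iff.1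
    ((hcont.eventually_const_lt he).and (hV.mem_nhds hy₀))
  -- the values increase along `e` inside the ball of radius `r`
  have hmono : ∀ z ∈ Metric.ball y₀ r, ∀ s : ℝ, 0 ≤ s → z + s • e ∈ Metric.ball y₀ r →
      h z ≤ h (z + s • e) := by
    intro z hz s hs hzs
    obtain ⟨q, hq, hfq⟩ := domain_mvt (f := h) (f' := fderiv ℝ h)
      (s := Metric.ball y₀ r) (x := z) (y := z + s • e)
      (fun q hq ↦ (hdiff q (hball hq).2).hasFDerivAt.hasFDerivWithinAt) (convex_ball y₀ r) hz hzs
    have hq' := (hball ((convex_ball y₀ r).segment_subset hz hzs hq)).1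
    rw [add_sub_cancel_left, map_smul, smul_eq_mul] at hfq
    have := mul_nonneg hs (le_of_lt hq')
    linarith
  obtain ⟨τ, hτ0, hτr, hτh⟩ : ∃ τ : ℝ, 0 < τ ∧ τ * ‖e‖ < r / 2 ∧ 0 < h (y₀ + τ • e) := by
    have hpos := eventually_pos_of_fderiv_pos (hdiff y₀ hy₀) h0 he
    have hsmall : ∀ᶠ s in 𝓝[>] (0 : ℝ), s * ‖e‖ < r / 2 := by
      have : ContinuousAt (fun s : ℝ ↦ s * ‖e‖) 0 := by fun_prop
      exact (this.eventually_lt_const (by simpa using half_pos hr)).filter_mono nhdsWithin_le_nhds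
    obtain ⟨τ, h1, h2, h3⟩ := (hpos.and (hsmall.and self_mem_nhdsWithin)).exists
    exact ⟨τ, h3, h2, h1⟩
  have hτe : ‖τ • e‖ < r / 2 := by rwa [norm_smul, Real.norm_of_nonneg hτ0.le]
  set y₁ := y₀ + τ • e with hy₁
  have hy₁b : dist y₁ y₀ < r / 2 := by rwa [hy₁, dist_eq_norm, add_sub_cancel_left]
  have hy₁V : y₁ ∈ V := (hball (by rw [Metric.mem_ball]; linarith)).2
  obtain ⟨δ, hδ, hδh⟩ := Metric.mem_nhds_iff.1
    ((hdiff y₁ hy₁V).continuousAt.eventually_const_lt hτh)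
  refine ⟨c.symm y₁ ∈ E, ?_⟩
  filter_upwards [Metric.ball_mem_nhds y₀ (show 0 < min δ (r / 2) by positivity)] with z hz hzpos
  rw [Metric.mem_ball, lt_min_iff] at hz
  have hconn : ∀ a b : EuclideanSpace ℝ (Fin (n + 1)), segment ℝ a b ⊆ V →
      (∀ q ∈ segment ℝ a b, 0 < h q) → (c.symm a ∈ E ↔ c.symm b ∈ E) := by
    intro a b hab hpos
    refine mem_iff_of_isPreconnected (S := c.symm '' segment ℝ a b) ?_ ?_
      (mem_image_of_mem _ (left_mem_segment ℝ a b)) (mem_image_of_mem _ (right_mem_segment ℝ a b))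
    · exact (convex_segment a b).isPreconnected.image _
        (c.continuousOn_symm.mono (hab.trans hVt))
    · rintro _ ⟨q, hq, rfl⟩ hqE
      exact (hpos q hq).ne' (hE q (hab hq) hqE)
  have hzr : z ∈ Metric.ball y₀ r := by rw [Metric.mem_ball]; linarith
  have hzτ : z + τ • e ∈ Metric.ball y₀ r := by
    rw [Metric.mem_ball, dist_eq_norm]
    have h1 := norm_add_le (z - y₀) (τ • e)
    rw [← dist_eq_norm] at h1
    rw [show z + τ • e - y₀ = z - y₀ + τ • e by abel]
    linarith
  have hseg1 : segment ℝ z (z + τ • e) ⊆ Metric.ball y₀ r :=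
    (convex_ball y₀ r).segment_subset hzr hzτ
  have hzδ : z + τ • e ∈ Metric.ball y₁ δ := by
    rw [Metric.mem_ball, hy₁, dist_add_right]
    exact hz.1
  rw [hconn z (z + τ • e) (fun q hq ↦ (hball (hseg1 hq)).2) ?_]
  · refine hconn _ _ ?_ fun q hq ↦ hδh
      ((convex_ball y₁ δ).segment_subset hzδ (Metric.mem_ball_self hδ) hq)
    exact ((convex_ball y₀ r).segment_subset hzτ (by
      rw [Metric.mem_ball]; linarith)).trans fun q hq ↦ (hball hq).2
  · intro q hq
    have hq' := hseg1 hq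
    rw [segment_eq_image'] at hq
    obtain ⟨s, hs, rfl⟩ := hq
    simp only [add_sub_cancel_left, smul_smul] at hq' ⊢
    exact hzpos.trans_le (hmono z hzr _ (mul_nonneg hs.1 hτ0.le) hq')

lemma fderiv_comp_symm_ne_zero (hc : c ∈ IsManifold.maximalAtlas (𝓡 (n + 1)) ∞ N) {h : N → ℝ}
    {y : EuclideanSpace ℝ (Fin (n + 1))} (hy : y ∈ c.target)
    (hh : MDifferentiableAt (𝓡 (n + 1)) 𝓘(ℝ, ℝ) h (c.symm y))
    (hD : mfderiv (𝓡 (n + 1)) 𝓘(ℝ, ℝ) h (c.symm y) ≠ 0) :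
    fderiv ℝ (h ∘ c.symm) y ≠ 0 := by
  intro h0
  refine hD (ContinuousLinearMap.ext fun w ↦ ?_)
  have h1 := (mdifferentiable_of_mem_maximalAtlas hc).mdifferentiableAt_symm hy
  have h2 : fderiv ℝ (h ∘ c.symm) y = (mfderiv (𝓡 (n + 1)) 𝓘(ℝ, ℝ) h (c.symm y)).comp
      (chartFrame c y) := by
    rw [← mfderiv_eq_fderiv]
    exact mfderiv_comp y hh h1
  have h3 := chartFrame_chartCoframe hc hy w
  rw [← h3]
  have h4 := congrArg (fun L ↦ L (chartCoframe c (c.symm y) w)) (h2.symm.trans h0)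
  exact h4

/-- A local defining function for `E` at a smooth boundary point, in a chart. -/
lemma exists_local_defining (hc : c ∈ IsManifold.maximalAtlas (𝓡 (n + 1)) ∞ N) (hEo : IsOpen E)
    (hEbd : frontier (closure E)ᶜ = frontier E) {W : Set N}
    (hsmooth : IsSmoothHypersurfaceOn n (frontier E) W)
    {y₀ : EuclideanSpace ℝ (Fin (n + 1))} (hy₀ : y₀ ∈ c.target) (hW : c.symm y₀ ∈ W) :
    ∃ V : Set (EuclideanSpace ℝ (Fin (n + 1))), IsOpen V ∧ y₀ ∈ V ∧
      ∃ f : EuclideanSpace ℝ (Fin (n + 1)) → ℝ, ContDiffOn ℝ ∞ f V ∧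
        (∀ z ∈ V, c.symm z ∈ E ↔ 0 < f z) ∧ ∀ z ∈ V, f z = 0 → fderiv ℝ f z ≠ 0 := by
  by_cases hin : c.symm y₀ ∈ E
  · exact ⟨c.target ∩ c.symm ⁻¹' E, c.isOpen_inter_preimage_symm hEo, ⟨hy₀, hin⟩,
      fun _ ↦ 1, contDiffOn_const, fun z hz ↦ by simpa using hz.2, fun z _ h ↦ by simp at h⟩
  by_cases hout : c.symm y₀ ∉ closure E
  · exact ⟨c.target ∩ c.symm ⁻¹' (closure E)ᶜ,
      c.isOpen_inter_preimage_symm isClosed_closure.isOpen_compl, ⟨hy₀, hout⟩,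
      fun _ ↦ -1, contDiffOn_const, fun z hz ↦ by
        have : c.symm z ∉ E := fun h ↦ hz.2 (subset_closure h)
        simp only [this, false_iff]; norm_num, fun z _ h ↦ by simp at h⟩
  rw [not_not] at hout
  have hfr : ∀ x, x ∈ frontier E ↔ x ∈ closure E ∧ x ∉ E := fun x ↦ by
    rw [frontier, hEo.interior_eq]; rfl
  obtain ⟨U, hUo, hxU, k, hk, hkD, hkU⟩ := hsmooth (c.symm y₀) ⟨(hfr _).2 ⟨hout, hin⟩, hW⟩
  set V₀ := c.target ∩ c.symm ⁻¹' U with hV₀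
  have hV₀o : IsOpen V₀ := c.isOpen_inter_preimage_symm hUo
  set h := k ∘ c.symm with hh
  have hhs : ContDiffOn ℝ ∞ h V₀ := by
    have := hk.comp ((contMDiffOn_symm_of_mem_maximalAtlas hc).mono inter_subset_left)
      (show V₀ ⊆ c.symm ⁻¹' U from inter_subset_right)
    exact this.contDiffOn
  have hDh : ∀ z ∈ V₀, fderiv ℝ h z ≠ 0 := fun z hz ↦ by
    refine fderiv_comp_symm_ne_zero hc hz.1 ?_ (hkD _ hz.2)
    exact ((hk _ hz.2).contMDiffAt (hUo.mem_nhds hz.2)).mdifferentiableAt (by simp)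
  have hzero : ∀ z ∈ V₀, c.symm z ∈ frontier E ↔ h z = 0 := fun z hz ↦ by
    have : c.symm z ∈ frontier E ∩ U ↔ c.symm z ∈ {y ∈ U | k y = 0} := by rw [hkU]
    simpa [hz.2.out, hh] using this
  have hy₀V : y₀ ∈ V₀ := ⟨hy₀, hxU⟩
  have hh0 : h y₀ = 0 := (hzero y₀ hy₀V).1 ((hfr _).2 ⟨hout, hin⟩)
  obtain ⟨P, hP⟩ := exists_side hV₀o inter_subset_left hhs hy₀V hh0 (hDh y₀ hy₀V)
    (fun z hz hzE ↦ (hzero z hz).1 hzE)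
  obtain ⟨Q, hQ⟩ := exists_side (h := fun z ↦ -h z) (E := E) hV₀o inter_subset_left hhs.neg hy₀V
    (by simp [hh0]) (by rw [fderiv_fun_neg]; simpa using hDh y₀ hy₀V)
    (fun z hz hzE ↦ by simp [(hzero z hz).1 hzE])
  obtain ⟨V, hVsub, hVo, hyV⟩ := eventually_nhds_iff.1 (hP.and (hQ.and (hV₀o.mem_nhds hy₀V)))
  have hnot : ∀ z ∈ V, h z = 0 → c.symm z ∉ E := fun z hz h0 ↦
    ((hfr _).1 ((hzero z (hVsub z hz).2.2).2 h0)).2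
  have hpull : c.symm y₀ ∈ closure E → ∀ V' : Set (EuclideanSpace ℝ (Fin (n + 1))), IsOpen V' →
      V' ⊆ c.target → y₀ ∈ V' → ∃ z ∈ V', c.symm z ∈ E := by
    intro hcl V' hV' hV't hyV'
    have h1 : IsOpen (c.symm '' V') := c.symm.isOpen_image_of_subset_source hV' hV't
    obtain ⟨x, ⟨z, hz, rfl⟩, hxE⟩ := mem_closure_iff.1 hcl _ h1 (mem_image_of_mem _ hyV')
    exact ⟨z, hz, hxE⟩
  have hVt : V ⊆ c.target := fun z hz ↦ (hVsub z hz).2.2.1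
  refine ⟨V, hVo, hyV, ?_⟩
  by_cases hPt : P
  · by_cases hQt : Q
    · -- `E` on both sides: the boundary point would be interior to the closure of `E`
      exfalso
      have h1 : c.symm '' V ⊆ closure E := by
        rintro _ ⟨z, hz, rfl⟩
        obtain ⟨hz1, hz2, hz3⟩ := hVsub z hz
        rcases lt_trichotomy (h z) 0 with hlt | heq | hgt
        · exact subset_closure ((hz2 (by linarith)).2 hQt)
        · exact ((hfr _).1 ((hzero z hz3).2 heq)).1
        · exact subset_closure ((hz1 hgt).2 hPt)
      have h2 : c.symm y₀ ∈ interior (closure E) :=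
        mem_interior.2 ⟨_, h1, c.symm.isOpen_image_of_subset_source hVo hVt,
          mem_image_of_mem _ hyV⟩
      have h3 : c.symm y₀ ∈ frontier (closure E) := by
        rw [← frontier_compl, hEbd]
        exact (hfr _).2 ⟨hout, hin⟩
      exact h3.2 h2
    · refine ⟨h, hhs.mono fun z hz ↦ (hVsub z hz).2.2, fun z hz ↦ ?_,
        fun z hz _ ↦ hDh z (hVsub z hz).2.2⟩
      obtain ⟨hz1, hz2, hz3⟩ := hVsub z hz
      rcases lt_trichotomy (h z) 0 with hlt | heq | hgt
      · simp only [hz2 (by linarith), hQt, false_iff]; linarith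
      · simp [hnot z hz heq, heq]
      · simp [hz1 hgt, hPt, hgt]
  · by_cases hQt : Q
    · refine ⟨fun z ↦ -h z, (hhs.mono fun z hz ↦ (hVsub z hz).2.2).neg, fun z hz ↦ ?_,
        fun z hz _ ↦ by rw [fderiv_fun_neg]; simpa using hDh z (hVsub z hz).2.2⟩
      obtain ⟨hz1, hz2, hz3⟩ := hVsub z hz
      rcases lt_trichotomy (h z) 0 with hlt | heq | hgt
      · simp [hz2 (by linarith), hQt, hlt]
      · simp [hnot z hz heq, heq]
      · simp only [hz1 hgt, hPt, false_iff]; linarith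
    · exfalso
      obtain ⟨z, hz, hzE⟩ := hpull hout V hVo hVt hyV
      obtain ⟨hz1, hz2, hz3⟩ := hVsub z hz
      rcases lt_trichotomy (h z) 0 with hlt | heq | hgt
      · exact hQt ((hz2 (by linarith)).1 hzE)
      · exact hnot z hz heq hzE
      · exact hPt ((hz1 hgt).1 hzE)

end DefiningFunction

/-! ### Transfer between the manifold and a chart -/

section Transfer

variable {n : ℕ} {N : Type*} [MetricSpace N] [ChartedSpace (EuclideanSpace ℝ (Fin (n + 1))) N]
  [IsManifold (𝓡 (n + 1)) ∞ N]
  {c : OpenPartialHomeomorph N (EuclideanSpace ℝ (Fin (n + 1)))}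

/-- A set which in a chart is a superlevel set at a regular value has smooth boundary. -/
lemma hasSmoothBoundaryIn_of_chart (hc : c ∈ IsManifold.maximalAtlas (𝓡 (n + 1)) ∞ N)
    {v : EuclideanSpace ℝ (Fin (n + 1)) → ℝ} (hv : ContDiff ℝ ∞ v) {G B : Set N}
    (hB : IsOpen B) (hBs : B ⊆ c.source) (hG : ∀ x ∈ B, (x ∈ G ↔ 0 < v (c x)))
    (hreg : ∀ x ∈ B, v (c x) = 0 → fderiv ℝ v (c x) ≠ 0) : HasSmoothBoundaryIn n G B := by
  have hcont : ∀ x ∈ B, ContinuousAt (fun z ↦ v (c z)) x := fun x hx ↦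
    hv.continuous.continuousAt.comp (c.continuousAt (hBs hx))
  have hfr : ∀ x ∈ B, (x ∈ frontier G ↔ v (c x) = 0) := by
    intro x hx
    rw [frontier_eq_closure_inter_closure]
    refine ⟨fun h ↦ ?_, fun h ↦ ⟨?_, subset_closure ((hG x hx).not.2 h.not_gt)⟩⟩
    · by_contra h0
      rcases lt_or_gt_of_ne h0 with h1 | h1
      · obtain ⟨z, ⟨hz1, hz2⟩, hz3⟩ := mem_closure_iff_nhds.1 h.1 _
          (((hcont x hx).eventually_lt_const h1).and (hB.mem_nhds hx))
        exact lt_asymm ((hG z hz2).1 hz3) hz1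
      · obtain ⟨z, ⟨hz1, hz2⟩, hz3⟩ := mem_closure_iff_nhds.1 h.2 _
          (((hcont x hx).eventually_const_lt h1).and (hB.mem_nhds hx))
        exact hz3 ((hG z hz2).2 hz1)
    · obtain ⟨e, he⟩ := exists_apply_pos (hreg x hx h)
      have hpos := eventually_pos_of_fderiv_pos (hv.differentiable (by simp) (c x)) h he
      -- the inverse chart carries points moved in the direction `e` into `G`, arbitrarily near `x`
      have hlim : Tendsto (fun s : ℝ ↦ c.symm (c x + s • e)) (𝓝[>] 0) (𝓝 x) := by
        have h1 : Tendsto (fun s : ℝ ↦ c x + s • e) (𝓝 0) (𝓝 (c x)) := by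
          have : ContinuousAt (fun s : ℝ ↦ c x + s • e) 0 := by fun_prop
          simpa [ContinuousAt] using this
        have h2 := c.continuousAt_symm (c.map_source (hBs hx))
        rw [ContinuousAt, c.left_inv (hBs hx)] at h2
        exact (h2.comp h1).mono_left nhdsWithin_le_nhds
      have htgt : ∀ᶠ s : ℝ in 𝓝[>] 0, c x + s • e ∈ c.target := by
        have : ContinuousAt (fun s : ℝ ↦ c x + s • e) 0 := by fun_prop
        exact (this.eventually_mem (c.open_target.mem_nhds
          (by simpa using c.map_source (hBs hx)))).filter_mono nhdsWithin_le_nhds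
      refine mem_closure_of_tendsto hlim ?_
      filter_upwards [hpos, htgt, hlim.eventually (hB.mem_nhds hx)] with s h1 h2 h3
      exact (hG _ h3).2 (by rwa [c.right_inv h2])
  have hvc : ∀ x ∈ B, ContMDiffAt (𝓡 (n + 1)) 𝓘(ℝ, ℝ) ∞ (v ∘ c) x := fun x hx ↦
    hv.contMDiff.contMDiffAt.comp x
      ((contMDiffOn_of_mem_maximalAtlas hc).contMDiffAt (c.open_source.mem_nhds (hBs hx)))
  set U : Set N := B ∩ (c.source ∩ c ⁻¹' {y | fderiv ℝ v y ≠ 0}) with hU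
  have hUo : IsOpen U := hB.inter (c.isOpen_inter_preimage
    (isOpen_ne.preimage (hv.continuous_fderiv (by simp))))
  rintro x ⟨hx, hxB⟩
  refine ⟨U, hUo, ⟨hxB, hBs hxB, hreg x hxB ((hfr x hxB).1 hx)⟩, v ∘ c,
    fun z hz ↦ (hvc z hz.1).contMDiffWithinAt, fun z hz h0 ↦ hz.2.2 ?_, ?_, ?_⟩
  · have h := mfderiv_comp z (I' := 𝓡 (n + 1)) (I'' := 𝓘(ℝ, ℝ))
      (hv.contMDiff.mdifferentiable (by simp) (c z))
      ((mdifferentiable_of_mem_maximalAtlas hc).mdifferentiableAt hz.2.1)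
    rw [h0, mfderiv_eq_fderiv] at h
    obtain ⟨y, hy, rfl⟩ : ∃ y ∈ c.target, c.symm y = z :=
      ⟨c z, c.map_source hz.2.1, c.left_inv hz.2.1⟩
    refine ContinuousLinearMap.ext fun e ↦ ?_
    have h1 := congrArg (fun L => L (chartFrame c y e)) h
    have h2 : fderiv ℝ v (c (c.symm y)) (chartCoframe c (c.symm y) (chartFrame c y e)) = 0 :=
      h1.symm
    rwa [chartCoframe_chartFrame hc hy] at h2
  · ext z
    exact ⟨fun h ↦ ⟨h.2, (hfr z h.2.1).1 h.1⟩, fun h ↦ ⟨(hfr z h.1.1).2 h.2, h.1⟩⟩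
  · ext z
    exact ⟨fun h ↦ ⟨h.2, (hG z h.2.1).1 h.1⟩, fun h ↦ ⟨(hG z h.1.1).2 h.2, h.1⟩⟩

variable [Bundle.RiemannianBundle (fun x : N ↦ TangentSpace (𝓡 (n + 1)) x)]
  [IsContMDiffRiemannianBundle (𝓡 (n + 1)) ∞ (EuclideanSpace ℝ (Fin (n + 1)))
      (fun x : N ↦ TangentSpace (𝓡 (n + 1)) x)]

/-- The metric and the density of a chart, restricted to a ball inside the target, extend to all
of the model space: outside a larger ball one interpolates with the Euclidean metric. -/
lemma exists_smoothMetric_extension (hc : c ∈ IsManifold.maximalAtlas (𝓡 (n + 1)) ∞ N) {r R : ℝ}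
    (hr : 0 < r) (hrR : r < R) (hR : Metric.ball 0 R ⊆ c.target) :
    ∃ (g : SmoothMetric (n + 1)) (ρ : EuclideanSpace ℝ (Fin (n + 1)) → ℝ),
      ContDiff ℝ ∞ ρ ∧ (∀ y, 0 < ρ y) ∧
      (∀ y ∈ Metric.ball (0 : EuclideanSpace ℝ (Fin (n + 1))) r, ∀ v,
        g.nrm y v = ‖chartFrame c y v‖) ∧
      ∀ y ∈ Metric.ball (0 : EuclideanSpace ℝ (Fin (n + 1))) r, ρ y = chartDensity c y := by
  let b : ContDiffBump (0 : EuclideanSpace ℝ (Fin (n + 1))) :=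
    ⟨r, (r + R) / 2, hr, by linarith⟩
  have hbs : Metric.closedBall (0 : EuclideanSpace ℝ (Fin (n + 1))) ((r + R) / 2) ⊆ c.target :=
    (Metric.closedBall_subset_ball (by linarith)).trans hR
  have hb0 : ∀ y ∉ c.target, b y = 0 := fun y hy ↦ by
    by_contra h
    have h1 : y ∈ Function.support b := h
    rw [b.support_eq] at h1
    exact hy (hbs (Metric.ball_subset_closedBall h1))
  have hcut : ∀ h : EuclideanSpace ℝ (Fin (n + 1)) → ℝ, ContDiffOn ℝ ∞ h c.target →
      ContDiff ℝ ∞ (fun y ↦ b y * h y) := by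
    intro h hh
    have h1 := (contDiff_indicator c.open_target (isCompact_closedBall 0 ((r + R) / 2)) hbs
      (W := fun y ↦ b y * h y) (b.contDiff.contDiffOn.mul hh) (fun y _ hy ↦ by
        have : b y = 0 := by
          by_contra h
          have h1 : y ∈ Function.support b := h
          rw [b.support_eq] at h1
          exact hy (Metric.ball_subset_closedBall h1)
        rw [this, zero_mul])).1
    have h2 : c.target.indicator (fun y ↦ b y * h y) = fun y ↦ b y * h y := by
      refine funext fun y ↦ ?_
      by_cases hy : y ∈ c.target
      · exact indicator_of_mem hy _
      · rw [hb0 y hy, zero_mul, indicator_of_notMem hy]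
    rwa [h2] at h1
  have hb1 : ∀ y ∈ Metric.ball (0 : EuclideanSpace ℝ (Fin (n + 1))) r, b y = 1 := fun y hy ↦
    b.one_of_mem_closedBall (Metric.ball_subset_closedBall hy)
  have hpos : ∀ y, ∀ α β : ℝ, (y ∈ c.target → 0 < α) → 0 < β →
      0 < b y * α + (1 - b y) * β := by
    intro y α β hα hβ
    by_cases hy : y ∈ c.target
    · have h0 : 0 ≤ b y := b.nonneg
      have h1 : b y ≤ 1 := b.le_one
      rcases h0.eq_or_lt with h | h
      · rw [← h]; simpa using hβ
      · have := mul_pos h (hα hy)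
        have := mul_nonneg (sub_nonneg.2 h1) hβ.le
        linarith
    · rw [hb0 y hy]; simpa using hβ
  -- the bilinear forms `v, w ↦ v i * w j`
  let P : Fin (n + 1) → Fin (n + 1) → (EuclideanSpace ℝ (Fin (n + 1)) →L[ℝ]
      EuclideanSpace ℝ (Fin (n + 1)) →L[ℝ] ℝ) := fun i j ↦
    (EuclideanSpace.proj i : EuclideanSpace ℝ (Fin (n + 1)) →L[ℝ] ℝ).smulRight
      (EuclideanSpace.proj j : EuclideanSpace ℝ (Fin (n + 1)) →L[ℝ] ℝ)
  let form : EuclideanSpace ℝ (Fin (n + 1)) → (EuclideanSpace ℝ (Fin (n + 1)) →L[ℝ]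
      EuclideanSpace ℝ (Fin (n + 1)) →L[ℝ] ℝ) := fun y ↦
    (∑ i, ∑ j, (b y * chartMetric c y (EuclideanSpace.single i 1) (EuclideanSpace.single j 1)) •
      P i j) + (1 - b y) • ∑ i, P i i
  have hform : ∀ y v w, form y v w =
      b y * chartMetric c y v w + (1 - b y) * inner ℝ v w := by
    intro y v w
    have hP : ∀ i j, P i j v w = v i * w j := fun i j ↦ rfl
    rw [chartMetric_eq_sum, PiLp.inner_apply]
    simp only [form, add_apply, smul_apply, sum_apply, hP, smul_eq_mul, Finset.mul_sum]
    congr 1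
    · refine Finset.sum_congr rfl fun i _ ↦ Finset.sum_congr rfl fun j _ ↦ ?_
      ring
    · refine Finset.sum_congr rfl fun i _ ↦ ?_
      simp [mul_comm]
  refine ⟨⟨form, ?_, fun y v w ↦ ?_, fun y v hv ↦ ?_⟩,
    fun y ↦ b y * chartDensity c y + (1 - b y) * 1, ?_, fun y ↦ ?_, fun y hy v ↦ ?_,
    fun y hy ↦ ?_⟩
  · refine contDiff_clm_apply_iff.2 fun v ↦ contDiff_clm_apply_iff.2 fun w ↦ ?_
    simp only [hform]
    exact (hcut _ (contDiffOn_chartMetric hc v w)).add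
      ((contDiff_const.sub b.contDiff).mul contDiff_const)
  · rw [hform, hform, chartMetric_comm, real_inner_comm w v]
  · rw [hform]
    exact hpos y _ _ (fun hy ↦ chartMetric_pos hc hy hv) (real_inner_self_pos.2 hv)
  · exact (hcut _ (contDiffOn_chartDensity hc)).add
      ((contDiff_const.sub b.contDiff).mul contDiff_const)
  · exact hpos y _ _ (chartDensity_pos hc) one_pos
  · rw [SmoothMetric.nrm, norm_chartFrame]
    congr 1
    exact (hform y v v).trans (by rw [hb1 y hy]; ring)
  · simp only [hb1 y hy]
    ring

variable [IsRiemannianManifold (𝓡 (n + 1)) N] [MeasurableSpace N] [BorelSpace N] [CompactSpace N]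

/-- The flux of a transplanted field through `S`, when the support of the field lies where the
chart sees `S` as `A` and the density as `ρ`. -/
lemma setIntegral_divergence_transplant_eq (hc : c ∈ IsManifold.maximalAtlas (𝓡 (n + 1)) ∞ N)
    {Y : EuclideanSpace ℝ (Fin (n + 1)) → EuclideanSpace ℝ (Fin (n + 1))}
    (hY : ContDiff ℝ ∞ Y) {K O A : Set (EuclideanSpace ℝ (Fin (n + 1)))} (hK : IsCompact K)
    (hYK : tsupport Y ⊆ K) (hO : IsOpen O) (hKO : K ⊆ O) (hOc : O ⊆ c.target)
    {ρ : EuclideanSpace ℝ (Fin (n + 1)) → ℝ} (hρ : ∀ y ∈ O, ρ y = chartDensity c y)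
    {S : Set N} (hS : NullMeasurableSet S (vol n N)) (hA : NullMeasurableSet A volume)
    (hSA : ∀ᵐ y : EuclideanSpace ℝ (Fin (n + 1)), y ∈ K → (c.symm y ∈ S ↔ y ∈ A)) :
    ∫ x in S, divergence (transplant c Y) x ∂(vol n N) =
      ∫ y in A, ediv (fun z ↦ ρ z • Y z) y := by
  have hYc : HasCompactSupport Y := hK.of_isClosed_subset (isClosed_tsupport Y) hYK
  rw [setIntegral_divergence_transplant hc hY hYc (hYK.trans (hKO.trans hOc)) hS,
    ← integral_indicator₀ (nullMeasurableSet_target_inter_preimage hc hS),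
    ← integral_indicator₀ hA]
  refine integral_congr_ae ?_
  filter_upwards [hSA] with y hy
  by_cases hyK : y ∈ K
  · have h1 : ediv (fun z ↦ chartDensity c z • Y z) y = ediv (fun z ↦ ρ z • Y z) y := by
      apply ediv_congr
      filter_upwards [hO.mem_nhds (hKO hyK)] with z hz
      rw [hρ z hz]
    by_cases hyA : y ∈ A
    · rw [indicator_of_mem hyA, indicator_of_mem
        (show y ∈ c.target ∩ c.symm ⁻¹' S from ⟨hOc (hKO hyK), (hy hyK).2 hyA⟩), h1]
    · rw [indicator_of_notMem hyA, indicator_of_notMem fun h ↦ hyA ((hy hyK).1 h.2)]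
  · have h0 : ∀ τ : EuclideanSpace ℝ (Fin (n + 1)) → ℝ, ediv (fun z ↦ τ z • Y z) y = 0 := by
      intro τ
      apply ediv_zero_of_eventuallyEq
      filter_upwards [(isClosed_tsupport Y).isOpen_compl.mem_nhds fun h ↦ hyK (hYK h)] with z hz
      rw [image_eq_zero_of_notMem_tsupport hz, smul_zero]
      rfl
    simp [indicator, h0]

/-- A bound for the volume of a set, measurable or not, by the Lebesgue measure of its image in a
chart. -/
lemma vol_le_of_subset_image (hc : c ∈ IsManifold.maximalAtlas (𝓡 (n + 1)) ∞ N)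
    {S : Set (EuclideanSpace ℝ (Fin (n + 1)))} (hS : MeasurableSet S) (hSt : S ⊆ c.target)
    {C : ℝ} (hC : ∀ y ∈ S, chartDensity c y ≤ C) {D : Set N} (hD : D ⊆ c.symm '' S) :
    vol n N D ≤ ENNReal.ofReal C * volume (S ∩ c.symm ⁻¹' D) := by
  set B := S ∩ toMeasurable volume (S ∩ c.symm ⁻¹' D) with hB
  have hBm : MeasurableSet B := hS.inter (measurableSet_toMeasurable _ _)
  have hDB : D ⊆ c.symm '' B := by
    intro x hx
    obtain ⟨y, hy, rfl⟩ := hD hx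
    exact ⟨y, ⟨hy, subset_toMeasurable _ _ ⟨hy, hx⟩⟩, rfl⟩
  calc vol n N D ≤ vol n N (c.symm '' B) := measure_mono hDB
    _ = ∫⁻ y in B, ENNReal.ofReal (chartDensity c y) :=
        vol_symm_image hc hBm (inter_subset_left.trans hSt)
    _ ≤ ∫⁻ _ in B, ENNReal.ofReal C :=
        setLIntegral_mono measurable_const fun y hy ↦ ENNReal.ofReal_le_ofReal (hC y hy.1)
    _ = ENNReal.ofReal C * volume B := by rw [setLIntegral_const]
    _ ≤ ENNReal.ofReal C * volume (S ∩ c.symm ⁻¹' D) := by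
        exact mul_le_mul' le_rfl
          ((measure_mono inter_subset_right).trans_eq (measure_toMeasurable _))

end Transfer

/-! ### Localisation of the perimeter in a chart -/

section Localisation

variable {n : ℕ} {N : Type*} [MetricSpace N] [ChartedSpace (EuclideanSpace ℝ (Fin (n + 1))) N]
  [IsManifold (𝓡 (n + 1)) ∞ N]
  {c : OpenPartialHomeomorph N (EuclideanSpace ℝ (Fin (n + 1)))}
  [Bundle.RiemannianBundle (fun x : N ↦ TangentSpace (𝓡 (n + 1)) x)]
  [IsContMDiffRiemannianBundle (𝓡 (n + 1)) ∞ (EuclideanSpace ℝ (Fin (n + 1)))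
      (fun x : N ↦ TangentSpace (𝓡 (n + 1)) x)]

/-- Multiplication of a unit field by a cutoff that lives in a chart splits the field into a part
given in the chart and a remainder, and the norms of the two parts add up to at most one. -/
lemma exists_chart_part (hc : c ∈ IsManifold.maximalAtlas (𝓡 (n + 1)) ∞ N)
    {X : ∀ x : N, TangentSpace (𝓡 (n + 1)) x}
    (hX : ContMDiff (𝓡 (n + 1)) (𝓡 (n + 1)).tangent ∞
      (fun x ↦ (⟨x, X x⟩ : TangentBundle (𝓡 (n + 1)) N))) (hX1 : ∀ x, ‖X x‖ ≤ 1)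
    {ξ : EuclideanSpace ℝ (Fin (n + 1)) → ℝ} (hξ : ContDiff ℝ ∞ ξ) (hξ01 : ∀ y, ξ y ∈ Icc (0 : ℝ) 1)
    {K : Set (EuclideanSpace ℝ (Fin (n + 1)))} (hK : IsCompact K) (hKc : K ⊆ c.target)
    (hξK : ∀ y ∉ K, ξ y = 0) :
    ∃ W : EuclideanSpace ℝ (Fin (n + 1)) → EuclideanSpace ℝ (Fin (n + 1)),
      ContDiff ℝ ∞ W ∧ tsupport W ⊆ K ∧
      (∀ y ∈ c.target, ‖chartFrame c y (W y)‖ ≤ ξ y) ∧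
      ∀ y ∈ c.target, ‖X (c.symm y) + (-1 : ℝ) • transplant c W (c.symm y)‖ ≤ 1 - ξ y := by
  obtain ⟨hWs, -⟩ := contDiff_indicator c.open_target hK hKc
    (W := fun y ↦ ξ y • chartField c X y) (hξ.contDiffOn.smul (contDiffOn_chartField hc hX))
    (fun y _ hy ↦ by rw [hξK y hy, zero_smul])
  have hfr : ∀ y ∈ c.target, chartFrame c y (c.target.indicator
      (fun y ↦ ξ y • chartField c X y) y) = ξ y • X (c.symm y) := by
    intro y hy
    rw [indicator_of_mem hy, map_smul, chartFrame_chartField hc hy]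
  refine ⟨_, hWs, closure_minimal (fun y hy ↦ ?_) hK.isClosed, fun y hy ↦ ?_, fun y hy ↦ ?_⟩
  · by_contra h
    refine hy ?_
    by_cases hyc : y ∈ c.target
    · rw [indicator_of_mem hyc, hξK y h, zero_smul]
    · exact indicator_of_notMem hyc _
  · rw [hfr y hy, norm_smul, Real.norm_of_nonneg (hξ01 y).1]
    exact mul_le_of_le_one_right (hξ01 y).1 (hX1 _)
  · rw [transplant_symm hy, hfr y hy]
    have : X (c.symm y) + (-1 : ℝ) • ξ y • X (c.symm y) = (1 - ξ y) • X (c.symm y) := by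
      rw [sub_smul, one_smul, neg_one_smul, sub_eq_add_neg]
    rw [this, norm_smul, Real.norm_of_nonneg (sub_nonneg.2 (hξ01 y).2)]
    exact mul_le_of_le_one_right (sub_nonneg.2 (hξ01 y).2) (hX1 _)

variable [IsRiemannianManifold (𝓡 (n + 1)) N] [MeasurableSpace N] [BorelSpace N] [CompactSpace N]

/-- A flux comparison in a chart, weighted by a cutoff `ξ`, bounds the perimeter of `G` by that
of `F`: the part of an admissible field near `F Δ G` is traded for the single field `Y`, and the
remaining part has the same flux through both sets. -/
lemma perimeter_le_of_flux_le (hc : c ∈ IsManifold.maximalAtlas (𝓡 (n + 1)) ∞ N)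
    {ξ ρ : EuclideanSpace ℝ (Fin (n + 1)) → ℝ} {s : ℝ} {g : SmoothMetric (n + 1)}
    {K O A B : Set (EuclideanSpace ℝ (Fin (n + 1)))}
    (hξ : ContDiff ℝ ∞ ξ) (hξ01 : ∀ y, ξ y ∈ Icc (0 : ℝ) 1)
    (hK : IsCompact K) (hO : IsOpen O) (hKO : K ⊆ O) (hOc : O ⊆ c.target)
    (hξK : ∀ y ∉ K, ξ y = 0) (hsK : Metric.ball 0 s ⊆ K) (hξs : ∀ y ∈ Metric.ball 0 s, ξ y = 1)
    (hg : ∀ y ∈ O, ∀ v, g.nrm y v = ‖chartFrame c y v‖)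
    (hρ : ∀ y ∈ O, ρ y = chartDensity c y)
    {F G : Set N} (hF : IsCaccioppoli n F) (hG : NullMeasurableSet G (vol n N))
    (hGF : ∀ x ∉ c.symm '' Metric.ball 0 s, (x ∈ G ↔ x ∈ F))
    (hA : NullMeasurableSet A volume) (hB : NullMeasurableSet B volume)
    (hFA : ∀ᵐ y : EuclideanSpace ℝ (Fin (n + 1)), y ∈ K → (c.symm y ∈ F ↔ y ∈ A))
    (hGB : ∀ᵐ y : EuclideanSpace ℝ (Fin (n + 1)), y ∈ K → (c.symm y ∈ G ↔ y ∈ B))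
    {κ : ℝ} (hκ : 0 < κ) {Y : EuclideanSpace ℝ (Fin (n + 1)) → EuclideanSpace ℝ (Fin (n + 1))}
    (hY : ContDiff ℝ ∞ Y) (hYK : tsupport Y ⊆ K) (hYn : ∀ y, g.nrm y (Y y) ≤ ξ y + κ)
    (hflux : ∀ W : EuclideanSpace ℝ (Fin (n + 1)) → EuclideanSpace ℝ (Fin (n + 1)),
      ContDiff ℝ ∞ W → HasCompactSupport W → (∀ y, g.nrm y (W y) ≤ ξ y) →
      ∫ y in B, ediv (fun z ↦ ρ z • W z) y ≤ (∫ y in A, ediv (fun z ↦ ρ z • Y z) y) + κ) :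
    perimeter n G ≤ ENNReal.ofReal ((1 + κ) * (perimeter n F).toReal + κ) := by
  refine perimeter_le fun X hX hX1 ↦ ?_
  have hKc := hKO.trans hOc
  obtain ⟨W, hW, hWK, hWn, hXW⟩ := exists_chart_part hc hX hX1 hξ hξ01 hK hKc hξK
  have hcpt : ∀ {V : EuclideanSpace ℝ (Fin (n + 1)) → EuclideanSpace ℝ (Fin (n + 1))},
      tsupport V ⊆ K → HasCompactSupport V := fun h ↦ hK.of_isClosed_subset (isClosed_tsupport _) h
  have hTW := contMDiff_transplant hc hW (hcpt hWK) (hWK.trans hKc)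
  have hTY := contMDiff_transplant hc hY (hcpt hYK) (hYK.trans hKc)
  set Z : ∀ x : N, TangentSpace (𝓡 (n + 1)) x := fun x ↦ X x + (-1 : ℝ) • transplant c W x
  have hZ : ContMDiff (𝓡 (n + 1)) (𝓡 (n + 1)).tangent ∞
      (fun x ↦ (⟨x, Z x⟩ : TangentBundle (𝓡 (n + 1)) N)) :=
    contMDiff_field_add hX (contMDiff_field_const_smul (-1) hTW)
  have hXsplit : ∀ x, divergence X x = divergence Z x + divergence (transplant c W) x := by
    intro x
    rw [← divergence_add hZ hTW]
    have : (fun x ↦ Z x + transplant c W x) = X := by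
      funext x
      show X x + (-1 : ℝ) • transplant c W x + transplant c W x = X x
      rw [neg_one_smul, neg_add_cancel_right]
    rw [this]
  have hopen : IsOpen (c.symm '' Metric.ball 0 s) :=
    c.symm.isOpen_image_of_subset_source Metric.isOpen_ball (hsK.trans hKc)
  -- `ξ = 1` where `F` and `G` differ, so the remainder vanishes there
  have hZ0 : ∀ x ∈ c.symm '' Metric.ball 0 s, divergence Z x = 0 := by
    intro x hx
    apply divergence_eq_zero_of_eventually
    filter_upwards [hopen.mem_nhds hx] with z hz
    obtain ⟨y, hy, rfl⟩ := hz
    have h := hXW y (hKc (hsK hy))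
    rw [hξs y hy, sub_self] at h
    exact norm_le_zero_iff.1 h
  have hZGF : ∫ x in G, divergence Z x ∂(vol n N) = ∫ x in F, divergence Z x ∂(vol n N) := by
    rw [← integral_indicator₀ hG, ← integral_indicator₀ hF.1]
    congr 1
    funext x
    by_cases hx : x ∈ c.symm '' Metric.ball 0 s
    · simp [indicator, hZ0 x hx]
    · by_cases hxF : x ∈ F
      · rw [indicator_of_mem hxF, indicator_of_mem ((hGF x hx).2 hxF)]
      · rw [indicator_of_notMem hxF, indicator_of_notMem ((hGF x hx).not.2 hxF)]
  have hW0 : ∫ x in G, divergence (transplant c W) x ∂(vol n N) =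
      ∫ y in B, ediv (fun z ↦ ρ z • W z) y :=
    setIntegral_divergence_transplant_eq hc hW hK hWK hO hKO hOc hρ hG hB hGB
  have hY0 : ∫ x in F, divergence (transplant c Y) x ∂(vol n N) =
      ∫ y in A, ediv (fun z ↦ ρ z • Y z) y :=
    setIntegral_divergence_transplant_eq hc hY hK hYK hO hKO hOc hρ hF.1 hA hFA
  have hout : ∀ {V : EuclideanSpace ℝ (Fin (n + 1)) → EuclideanSpace ℝ (Fin (n + 1))},
      tsupport V ⊆ K → ∀ y ∉ O, V y = 0 := fun h y hy ↦
    image_eq_zero_of_notMem_tsupport fun hy' ↦ hy (hKO (h hy'))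
  have hWle := hflux W hW (hcpt hWK) fun y ↦ by
    by_cases hy : y ∈ O
    · rw [hg y hy]
      exact hWn y (hOc hy)
    · rw [hout hWK y hy, SmoothMetric.nrm, map_zero, Real.sqrt_zero]
      exact (hξ01 y).1
  -- the competitor for `F`: the remainder `Z` together with `Y` in place of the chart part
  have hVn : ∀ x, ‖Z x + transplant c Y x‖ ≤ 1 + κ := by
    intro x
    by_cases hx : x ∈ c.source
    · obtain ⟨y, hy, rfl⟩ : ∃ y ∈ c.target, c.symm y = x := ⟨c x, c.map_source hx, c.left_inv hx⟩
      have h1 : ‖Z (c.symm y)‖ ≤ 1 - ξ y := hXW y hy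
      refine (norm_add_le _ _).trans ?_
      rw [transplant_symm hy]
      by_cases hyO : y ∈ O
      · have h2 := hYn y
        rw [hg y hyO] at h2
        linarith
      · rw [hout hYK y hyO, map_zero, norm_zero]
        linarith [(hξ01 y).1]
    · have h1 : Z x + transplant c Y x = X x := by
        show X x + (-1 : ℝ) • transplant c W x + transplant c Y x = X x
        rw [transplant_of_notMem hx, transplant_of_notMem hx, smul_zero, add_zero, add_zero]
      rw [h1]
      linarith [hX1 x]
  have hmain := integral_divergence_le_mul_perimeter hF.2 (contMDiff_field_add hZ hTY)
    (a := 1 + κ) (by positivity) hVn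
  simp_rw [divergence_add hZ hTY] at hmain
  rw [integral_add (integrable_divergence hZ).integrableOn (integrable_divergence hTY).integrableOn,
    hY0] at hmain
  simp_rw [hXsplit]
  rw [integral_add (integrable_divergence hZ).integrableOn (integrable_divergence hTW).integrableOn,
    hZGF, hW0]
  linarith

end Localisation

/-! ### Approximation in a normal chart -/

section Approximation

variable {n : ℕ} {N : Type*} [MetricSpace N] [ChartedSpace (EuclideanSpace ℝ (Fin (n + 1))) N]
  [IsManifold (𝓡 (n + 1)) ∞ N]
  {c : OpenPartialHomeomorph N (EuclideanSpace ℝ (Fin (n + 1)))}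
  [Bundle.RiemannianBundle (fun x : N ↦ TangentSpace (𝓡 (n + 1)) x)]
  [IsContMDiffRiemannianBundle (𝓡 (n + 1)) ∞ (EuclideanSpace ℝ (Fin (n + 1)))
      (fun x : N ↦ TangentSpace (𝓡 (n + 1)) x)]
  [IsRiemannianManifold (𝓡 (n + 1)) N] [MeasurableSpace N] [BorelSpace N] [CompactSpace N]

/-- The approximation in a chart under which the distance to `p` becomes the Euclidean norm. -/
theorem exists_smooth_approximation (hc : c ∈ IsManifold.maximalAtlas (𝓡 (n + 1)) ∞ N) {p : N}
    {R r₁ r₂' r₂ δ : ℝ} (hcs : c.source = Metric.ball p R) (hct : c.target = Metric.ball 0 R)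
    (hcd : ∀ y ∈ c.target, dist (c.symm y) p = ‖y‖) {E F : Set N} (hEo : IsOpen E)
    (hEbd : frontier (closure E)ᶜ = frontier E) (hr₁ : 0 < r₁) (h12' : r₁ < r₂') (h22' : r₂' < r₂)
    (h2R : r₂ < R) (hsmooth : IsSmoothHypersurfaceOn n (frontier E)
      (Metric.closedBall p r₂ \ Metric.ball p r₁))
    (hF : IsCaccioppoli n F) (hFE : ∀ x, r₁ ≤ dist x p → (x ∈ F ↔ x ∈ E)) (hδ : 0 < δ) :
    ∃ G : Set N, IsCaccioppoli n G ∧ HasSmoothBoundaryIn n G (Metric.ball p r₂) ∧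
      (∀ x, r₂' ≤ dist x p → (x ∈ G ↔ x ∈ E)) ∧
      |(perimeter n G).toReal - (perimeter n F).toReal| ≤ δ ∧
      (vol n N).real (symmDiff G F) ≤ δ := by
  have htgt : ∀ y : EuclideanSpace ℝ (Fin (n + 1)), ‖y‖ ≤ r₂ → y ∈ c.target := fun y hy ↦ by
    rw [hct, mem_ball_zero_iff]
    exact hy.trans_lt h2R
  have hsrc : ∀ x : N, dist x p ≤ r₂ → x ∈ c.source := fun x hx ↦ by
    rw [hcs, Metric.mem_ball]
    exact hx.trans_lt h2R
  have hcn : ∀ x ∈ c.source, ‖c x‖ = dist x p := fun x hx ↦ by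
    rw [← hcd _ (c.map_source hx), c.left_inv hx]
  -- a defining function of `E` in the annulus
  set K : Set (EuclideanSpace ℝ (Fin (n + 1))) := Metric.closedBall 0 r₂ ∩ {y | r₁ ≤ ‖y‖}
  have hK : IsCompact K :=
    (isCompact_closedBall 0 r₂).inter_right (isClosed_le continuous_const continuous_norm)
  obtain ⟨f, hf, hfK⟩ := exists_defining_of_local (P := fun y ↦ c.symm y ∈ E) hK fun y hy ↦ by
    have hy2 : ‖y‖ ≤ r₂ := mem_closedBall_zero_iff.1 hy.1
    refine exists_local_defining hc hEo hEbd hsmooth (htgt y hy2) ⟨?_, ?_⟩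
    · rwa [Metric.mem_closedBall, hcd y (htgt y hy2)]
    · rw [Metric.mem_ball, hcd y (htgt y hy2), not_lt]
      exact hy.2
  have hfE : ∀ y, r₁ ≤ ‖y‖ → ‖y‖ ≤ r₂ → (c.symm y ∈ E ↔ 0 < f y) := fun y h1 h2 ↦
    (hfK y ⟨mem_closedBall_zero_iff.2 h2, h1⟩).1
  obtain ⟨g, ρ, hρ, hρ0, hg, hρc⟩ := exists_smoothMetric_extension hc (r := r₂) (R := R)
    (by linarith) h2R hct.ge
  obtain ⟨A, hA, hFA⟩ := nullMeasurableSet_target_inter_preimage hc hF.1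
  have hFA' : ∀ᵐ y : EuclideanSpace ℝ (Fin (n + 1)), ‖y‖ ≤ r₂ → (c.symm y ∈ F ↔ y ∈ A) := by
    filter_upwards [hFA.mem_iff] with y hy hy2
    rw [← hy]
    exact ⟨fun h ↦ ⟨htgt y hy2, h⟩, fun h ↦ h.2⟩
  set s := (r₁ + r₂') / 2
  have hs1 : r₁ < s := by simp only [s]; linarith
  have hs2 : s < r₂' := by simp only [s]; linarith
  let ξ : ContDiffBump (0 : EuclideanSpace ℝ (Fin (n + 1))) := ⟨s, r₂', by linarith, hs2⟩
  have hξ0 : ∀ y : EuclideanSpace ℝ (Fin (n + 1)), r₂' ≤ ‖y‖ → ξ y = 0 := fun y hy ↦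
    ξ.zero_of_le_dist (by simpa using hy)
  have hξ1 : ∀ y : EuclideanSpace ℝ (Fin (n + 1)), ‖y‖ ≤ s → ξ y = 1 := fun y hy ↦
    ξ.one_of_mem_closedBall (mem_closedBall_zero_iff.2 hy)
  obtain ⟨ε, hε, hlsc⟩ := exists_perimeter_ge hF hδ
  obtain ⟨C, hC⟩ := (isCompact_closedBall (0 : EuclideanSpace ℝ (Fin (n + 1))) s
    ).exists_bound_of_continuousOn ((contDiffOn_chartDensity hc).continuousOn.mono fun y hy ↦
      htgt y ((mem_closedBall_zero_iff.1 hy).trans (by linarith)))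
  -- `κ` bounds the errors of perimeter and, in the chart, of volume
  set P := (perimeter n F).toReal
  have hP : 0 ≤ P := ENNReal.toReal_nonneg
  obtain ⟨κ, hκ, hκP, hκC⟩ : ∃ κ : ℝ, 0 < κ ∧ κ * (P + 1) ≤ δ ∧ |C| * κ ≤ min δ ε := by
    have hδε : 0 < min δ ε := lt_min hδ hε
    refine ⟨min (δ / (P + 1)) (min δ ε / (|C| + 1)), by positivity, ?_, ?_⟩
    · exact (le_div_iff₀ (by positivity)).1 (min_le_left _ _)
    · have h := (le_div_iff₀ (by positivity : 0 < |C| + 1)).1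
        (min_le_right (δ / (P + 1)) (min δ ε / (|C| + 1)))
      have : 0 < min (δ / (P + 1)) (min δ ε / (|C| + 1)) := by positivity
      linarith
  obtain ⟨v, hv, hv0, hvf, hvA, Y, hY, hYs, hYn, hflux⟩ := g.exists_smooth_superlevel hρ hρ0 hA hf
    hr₁ hs1 hs2 h22'.le
    (by
      filter_upwards [hFA'] with y hy h1 h2
      rw [← hy h2, hFE _ (by rwa [hcd y (htgt y h2)]), hfE y h1 h2])
    (fun y h1 h2 ↦ (hfK y ⟨mem_closedBall_zero_iff.2 h2, h1⟩).2)
    ξ.contDiff (fun y ↦ ⟨ξ.nonneg, ξ.le_one⟩) hξ1 hξ0 hκ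
  set B : Set (EuclideanSpace ℝ (Fin (n + 1))) := {y | 0 < v y}
  have hBo : IsOpen B := isOpen_lt continuous_const hv.continuous
  -- outside `B_s(p)` this is the set `E`, so nothing happens on the sphere of radius `r₂`
  set G : Set N := (Metric.ball p r₂ ∩ (c.source ∩ c ⁻¹' B)) ∪ (E \ Metric.ball p r₂)
  have hGv : ∀ x ∈ Metric.ball p r₂, (x ∈ G ↔ 0 < v (c x)) := by
    intro x hx
    refine ⟨?_, fun h ↦ Or.inl ⟨hx, hsrc x (Metric.mem_ball.1 hx).le, h⟩⟩
    rintro (h | h)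
    · exact h.2.2
    · exact absurd hx h.2
  have hGE : ∀ x, s ≤ dist x p → (x ∈ G ↔ x ∈ E) := by
    intro x hx
    by_cases hxb : x ∈ Metric.ball p r₂
    · have hx2 := (Metric.mem_ball.1 hxb).le
      have hn := hcn x (hsrc x hx2)
      rw [hGv x hxb, hvf (c x) (by rwa [hn]) (by rwa [hn]),
        ← hfE (c x) (by rw [hn]; linarith) (by rwa [hn]), c.left_inv (hsrc x hx2)]
    · refine ⟨?_, fun h ↦ Or.inr ⟨h, hxb⟩⟩
      rintro (h | h)
      · exact absurd h.1 hxb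
      · exact h.1
  have hGF : ∀ x, s ≤ dist x p → (x ∈ G ↔ x ∈ F) := fun x hx ↦
    (hGE x hx).trans (hFE x (hs1.le.trans hx)).symm
  have hGm : MeasurableSet G :=
    (Metric.isOpen_ball.inter (c.isOpen_inter_preimage hBo)).measurableSet.union
      (hEo.measurableSet.diff Metric.isOpen_ball.measurableSet)
  have hGB : ∀ y : EuclideanSpace ℝ (Fin (n + 1)), ‖y‖ < r₂ → (c.symm y ∈ G ↔ y ∈ B) := by
    intro y hy
    rw [hGv _ (by rwa [Metric.mem_ball, hcd y (htgt y hy.le)]), c.right_inv (htgt y hy.le)]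
    rfl
  have hclose : ∀ x, dist x p < s → x ∈ c.symm '' Metric.ball 0 s := fun x hx ↦ by
    have hxs := hsrc x (by linarith)
    exact ⟨c x, by rwa [mem_ball_zero_iff, hcn x hxs], c.left_inv hxs⟩
  have hD : symmDiff G F ⊆ c.symm '' Metric.closedBall 0 s := by
    intro x hx
    refine image_mono Metric.ball_subset_closedBall (hclose x ?_)
    by_contra! h
    rcases hx with hx | hx
    · exact hx.2 ((hGF x h).1 hx.1)
    · exact hx.2 ((hGF x h).2 hx.1)
  have hvol : vol n N (symmDiff G F) ≤ ENNReal.ofReal (min δ ε) := by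
    refine (vol_le_of_subset_image hc Metric.isClosed_closedBall.measurableSet
      (fun y hy ↦ htgt y ((mem_closedBall_zero_iff.1 hy).trans (by linarith)))
      (C := |C|) (fun y hy ↦ (le_abs_self _).trans ((hC y hy).trans (le_abs_self C))) hD).trans ?_
    have h1 : volume (Metric.closedBall 0 s ∩ c.symm ⁻¹' symmDiff G F) ≤
        volume (symmDiff B A ∩ Metric.closedBall 0 r₂) := by
      refine measure_mono_ae ?_
      filter_upwards [hFA'] with y hy hyS
      have hys : ‖y‖ ≤ s := mem_closedBall_zero_iff.1 hyS.1
      refine ⟨?_, mem_closedBall_zero_iff.2 (by linarith)⟩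
      have h2 := hGB y (by linarith)
      have h3 := hy (by linarith)
      rcases hyS.2 with h | h
      · exact Or.inl ⟨h2.1 h.1, h3.not.1 h.2⟩
      · exact Or.inr ⟨h3.1 h.1, h2.not.1 h.2⟩
    have h2 : volume (symmDiff B A ∩ Metric.closedBall 0 r₂) ≤ ENNReal.ofReal κ := by
      refine (ENNReal.le_ofReal_iff_toReal_le ?_ hκ.le).2 hvA
      exact measure_ne_top_of_subset inter_subset_right measure_closedBall_lt_top.ne
    refine (mul_le_mul' le_rfl (h1.trans h2)).trans ?_
    rw [← ENNReal.ofReal_mul (abs_nonneg C)]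
    exact ENNReal.ofReal_le_ofReal hκC
  have hvolr : (vol n N).real (symmDiff G F) ≤ min δ ε :=
    ENNReal.toReal_le_of_le_ofReal (lt_min hδ hε).le hvol
  have hsub : Metric.ball (0 : EuclideanSpace ℝ (Fin (n + 1))) s ⊆ Metric.closedBall 0 r₂' :=
    (Metric.ball_subset_ball hs2.le).trans Metric.ball_subset_closedBall
  have hper : perimeter n G ≤ ENNReal.ofReal ((1 + κ) * P + κ) :=
    perimeter_le_of_flux_le hc (K := Metric.closedBall 0 r₂') (O := Metric.ball 0 r₂) (A := A)
      (B := B) (s := s) (g := g) ξ.contDiff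
      (fun y ↦ ⟨ξ.nonneg, ξ.le_one⟩) (isCompact_closedBall 0 r₂') Metric.isOpen_ball
      (Metric.closedBall_subset_ball h22') (fun y hy ↦ htgt y (mem_ball_zero_iff.1 hy).le)
      (fun y hy ↦ hξ0 y (by simpa using (not_le.1 fun h ↦ hy (mem_closedBall_zero_iff.2 h)).le))
      hsub (fun y hy ↦ hξ1 y (mem_ball_zero_iff.1 hy).le) hg hρc hF hGm.nullMeasurableSet
      (fun x hx ↦ hGF x (not_lt.1 fun h ↦ hx (hclose x h))) hA.nullMeasurableSet
      hBo.measurableSet.nullMeasurableSet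
      (by
        filter_upwards [hFA'] with y hy hyK
        exact hy ((mem_closedBall_zero_iff.1 hyK).trans h22'.le))
      (Eventually.of_forall fun y hy ↦ hGB y ((mem_closedBall_zero_iff.1 hy).trans_lt h22'))
      hκ hY hYs hYn hflux
  have hG : IsCaccioppoli n G :=
    ⟨hGm.nullMeasurableSet, ne_top_of_le_ne_top ENNReal.ofReal_ne_top hper⟩
  have hperr : (perimeter n G).toReal ≤ (1 + κ) * P + κ :=
    ENNReal.toReal_le_of_le_ofReal (by positivity) hper
  refine ⟨G, hG, ?_, fun x hx ↦ hGE x (hs2.le.trans hx), abs_le.2 ⟨?_, ?_⟩,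
    hvolr.trans (min_le_left _ _)⟩
  · refine hasSmoothBoundaryIn_of_chart hc hv Metric.isOpen_ball
      (fun x hx ↦ hsrc x (Metric.mem_ball.1 hx).le) hGv fun x hx h0 ↦ hv0 (c x) ?_ h0
    have hx2 := (Metric.mem_ball.1 hx).le
    rwa [hcn x (hsrc x hx2)]
  · linarith [hlsc G hG (hvolr.trans (min_le_right _ _))]
  · linarith

/-- The functional `𝓕_λ` depends continuously on the perimeter and, in the sense of `L¹`, on the
set. -/
lemma abs_energy_sub_le {F G : Set N} (hF : IsCaccioppoli n F) (hG : IsCaccioppoli n G) {δ : ℝ}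
    (hper : |(perimeter n G).toReal - (perimeter n F).toReal| ≤ δ)
    (hvol : (vol n N).real (symmDiff G F) ≤ δ) (lam : ℝ) :
    |energy n lam G - energy n lam F| ≤ (1 + |lam|) * δ := by
  have := isFiniteMeasure_vol (n := n) (N := N)
  have h1 : |(vol n N).real G - (vol n N).real F| ≤ δ := by
    have h := abs_setIntegral_sub_le_of_symmDiff (μ := vol n N) (h := fun _ ↦ (1 : ℝ))
      (integrable_const 1) hF.1 hG.1 (M := 1) (fun _ ↦ by simp)
    simp only [setIntegral_const, smul_eq_mul, mul_one, one_mul] at h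
    exact h.trans hvol
  have h2 : energy n lam G - energy n lam F =
      ((perimeter n G).toReal - (perimeter n F).toReal) -
        lam * ((vol n N).real G - (vol n N).real F) := by
    unfold energy
    ring
  rw [h2]
  refine (abs_sub _ _).trans ?_
  rw [abs_mul, add_mul, one_mul]
  exact add_le_add hper (mul_le_mul_of_nonneg_left h1 (abs_nonneg lam))

end Approximation

end GeomBV

theorem mainTheorem5
    -- a closed connected Riemannian manifold `(N, g)` of dimension `n + 1 ≥ 3`
    (n : ℕ) (hn : 2 ≤ n)
    (N : Type*) [MetricSpace N] [CompactSpace N] [ConnectedSpace N]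
    [MeasurableSpace N] [BorelSpace N]
    [ChartedSpace (EuclideanSpace ℝ (Fin (n + 1))) N] [IsManifold (𝓡 (n + 1)) ∞ N]
    [Bundle.RiemannianBundle (fun x : N ↦ TangentSpace (𝓡 (n + 1)) x)]
    [IsContMDiffRiemannianBundle (𝓡 (n + 1)) ∞ (EuclideanSpace ℝ (Fin (n + 1)))
      (fun x : N ↦ TangentSpace (𝓡 (n + 1)) x)]
    [IsRiemannianManifold (𝓡 (n + 1)) N]
    -- the open Caccioppoli set `E`; `E` and `N \ closure E` have the common boundary `∂E`
    (E : Set N) (hE : GeomBV.IsCaccioppoli n E) (hEopen : IsOpen E)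
    (hEbd : frontier (closure E)ᶜ = frontier E)
    -- the radius `Rl` below which balls are 2-bi-Lipschitz to Euclidean balls in normal coordinates
    (Rl : ℝ)
    (hRl : ∀ R : ℝ, 0 < R → R < Rl → ∀ q : N, GeomBV.HasBiLipschitzNormalChart n q R)
    -- the radii `0 < r₁ < r₂ < Rl`, with `∂E` smooth in the closed annulus around `p`
    (p : N) (r₁ r₂ : ℝ) (hr₁ : 0 < r₁) (hr₁₂ : r₁ < r₂) (hr₂ : r₂ < Rl)
    (hsmooth : GeomBV.IsSmoothHypersurfaceOn n (frontier E)
      (Metric.closedBall p r₂ \ Metric.ball p r₁))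
    -- the Caccioppoli set `F`, equal to `E` outside `B_{r₁}(p)`
    (F : Set N) (hF : GeomBV.IsCaccioppoli n F)
    (hFE : F \ Metric.ball p r₁ = E \ Metric.ball p r₁)
    (r₂' : ℝ) (hr₂' : r₂' ∈ Set.Ioo r₁ r₂) (δ : ℝ) (hδ : 0 < δ) :
    ∃ G : Set N, GeomBV.IsCaccioppoli n G ∧
      GeomBV.HasSmoothBoundaryIn n G (Metric.ball p r₂) ∧
      G \ Metric.ball p r₂' = E \ Metric.ball p r₂' ∧
      |(GeomBV.perimeter n G).toReal - (GeomBV.perimeter n F).toReal| ≤ δ ∧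
      GeomBV.vol n N (symmDiff G F) ≤ ENNReal.ofReal δ ∧
      G \ Metric.ball p r₂' = F \ Metric.ball p r₂' ∧
      ∀ lam : ℝ, |GeomBV.energy n lam G - GeomBV.energy n lam F| ≤ (1 + |lam|) * δ := by
  have hR : r₂ < (r₂ + Rl) / 2 ∧ (r₂ + Rl) / 2 < Rl := ⟨by linarith, by linarith⟩
  obtain ⟨φ, ⟨hφ, hφs, hφt, hφp, hφd⟩, -⟩ := hRl ((r₂ + Rl) / 2) (by linarith) hR.2 p
  have hps : p ∈ φ.source := by
    rw [hφs]
    exact Metric.mem_ball_self (by linarith)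
  have hφ0 : φ.symm 0 = p := by rw [← hφp, φ.left_inv hps]
  have hdist : ∀ y ∈ φ.target, dist (φ.symm y) p = ‖y‖ := fun y hy ↦ by
    have h := hφd y (hφt ▸ hy) 1 ⟨zero_le_one, le_rfl⟩ 0 ⟨le_rfl, zero_le_one⟩
    rwa [one_smul, zero_smul, hφ0, sub_zero, abs_one, one_mul] at h
  have hFE' : ∀ r, r₁ ≤ r → ∀ x, r ≤ dist x p → (x ∈ F ↔ x ∈ E) := fun r hr x hx ↦ by
    have h := Set.ext_iff.1 hFE x
    have hxb : x ∉ Metric.ball p r₁ := fun h ↦ (Metric.mem_ball.1 h).not_ge (hr.trans hx)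
    exact ⟨fun hx ↦ (h.1 ⟨hx, hxb⟩).1, fun hx ↦ (h.2 ⟨hx, hxb⟩).1⟩
  obtain ⟨G, hG, hGs, hGE, hGp, hGv⟩ := GeomBV.exists_smooth_approximation hφ hφs hφt hdist hEopen
    hEbd hr₁ hr₂'.1 hr₂'.2 hR.1 hsmooth hF (hFE' r₁ le_rfl) hδ
  have hfin := GeomBV.isFiniteMeasure_vol (n := n) (N := N)
  refine ⟨G, hG, hGs, ?_, hGp, ?_, ?_, GeomBV.abs_energy_sub_le hF hG hGp hGv⟩
  · ext x
    refine and_congr_left fun hx ↦ hGE x (not_lt.1 hx)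
  · exact (ENNReal.le_ofReal_iff_toReal_le (MeasureTheory.measure_ne_top _ _) hδ.le).2 hGv
  · ext x
    refine and_congr_left fun hx ↦ (hGE x (not_lt.1 hx)).trans
      (hFE' r₂' hr₂'.1.le x (not_lt.1 hx)).symm
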